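/- **Setting.** Let $n\in\mathbb N$, real couplings $c_{ij}=c_{ji}$ ($1\le i<j\le n$), $a_1,\dots,a_n\in\mathbb R\setminus\{0\}$, and $H_i=a_iX_i+\sum_{p<q}c_{pq}Z_pZ_q$ on $n$ qubits. For every round $i=1,\dots,n-1$ choose $n-i$ two-dimensional invariant subspaces of $H_i$, labelled by $k\in\{i+1,\dots,n\}$, with logical zero $|v^{ik}\rangle$ a computational basis state whose $i$-th bit is $0$, and logical one $|v^{ik}\oplus e_i\rangle$. Let $\lambda^{ik}_{j}=\pm1$ be the eigenvalue of $Z_iZ_j$ on $|v^{ik}\rangle$, and assume that the matrices $(\lambda^{ik}_j)_{k,j>i}$ are invertible. Put $B_{ik}=T\sum_{j\ne i}\lambda^{ik}_jc_{ij}$. **Algorithms.** Let $d\ge2$ (number of repetition cycles), $T>0$ (evolution time per cycle), $N$ (shots per circuit), $\omega_j=j\pi/(2d-1)$ for $0\le j\le 2d-2$. One cycle is $e^{-iH_iT}$ followed by a logical rotation $Z_L(\omega_j)$; $d$ cycles are applied to the initial state, all qubits are measured in the computational basis, and this is repeated $N$ times; all shots of all circuits are independent. *Hybrid algorithm:* for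 every round $i$, every $j$ and $\phi\in\{1,\sqrt{-1}\}$ the initial state is $\frac1{\sqrt{2(n-i)}}\sum_{k>i}(|v^{ik}\rangle+\phi|v^{ik}\oplus e_i\rangle)$ and $Z_L(\omega)=e^{-i\omega Z_i}$; set $M_i=n-i$. *Analog algorithm:* for every $i<k$, every $j$ and $\phi$ the initial state is $\frac1{\sqrt2}(|v^{ik}\rangle+\phi|v^{ik}\oplus e_i\rangle)$ and $Z_L(\omega)=\exp(-i(bZ_i+\sum_{p<q}c_{pq}Z_pZ_q))$ with $b=\omega-B_{ik}/T$, which is $e^{-i\omega Z}$ on the subspace up to a global phase; set $M_i=1$. If $\hat p_X,\hat p_Y$ are the observed frequencies of $v^{ik}$ for $\phi=1,\sqrt{-1}$, put $h_j=(M_i\hat p_X-\frac12)+\sqrt{-1}\,(M_i\hat p_Y-\frac12)$, $\hat f_m=\frac1{2d-1}\sum_je^{2\sqrt{-1}\,m\omega_j}h_j$, $\hat\theta=\frac1d\sum_{m=0}^{d-1}|\hat f_m|$, $\Delta_m=\arg(\hat f_m\overline{\hat f_{m+1}})$ for $0\le m\le d-2$, and $\hat\zeta=\frac12\,\mathbb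 1^T\mathcal D^{-1}\Delta/(\mathbb 1^T\mathcal D^{-1}\mathbb 1)$ with $\mathcal D$ the $(d-1)\times(d-1)$ discrete Laplacian. Then $\hat B_{ik}$ is obtained from $(\hat\theta,\hat\zeta)$ by inverting $$\tan\zeta=\tfrac{B}{w}\tan w,\qquad \sin^2\theta=\tfrac{A^2}{w^2}\sin^2w,\qquad w=\sqrt{A^2+B^2},$$ on the branch $0\le w\le\pi/2$, and the $\hat c_{ij}$ are obtained by solving, for $i=1,2,\dots,n-1$ successively, $\hat B_{ik}=T\sum_{j\neq i}\lambda^{ik}_j\hat c_{ij}$ ($k>i$) for $\hat c_{ij}$, $j>i$, with the $\hat c_{li}$, $l<i$, taken from previous rounds. **Cramér–Rao bound.** The parameters are $\Xi=(\theta_{ik},\zeta_{ik},\chi_{ik})_{i<k}$, with the logical gate $\begin{pmatrix}\cos\theta\, e^{-i\zeta}&-i\sin\theta\, e^{i\chi}\\-i\sin\theta\, e^{-i\chi}&\cos\theta\, e^{i\zeta}\end{pmatrix}$ on subspace $(i,k)$. The data are the logical-zero counts used by the algorithm (multinomial over $k>i$ in every hybrid circuit, binomial in every analog circuit), and $I_N(\Xi)$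 is their Fisher information matrix. The bound for $c_{ij}$, as a function of $\Xi$ through the maps above, is $\mathrm{CRB}_{ij}=\nabla c_{ij}^T\,I_N(\Xi)^{-1}\,\nabla c_{ij}$ at the true $\Xi$ (given by $A=a_iT$, $B=B_{ik}$, $\theta_{ik}$ with the sign of $a_i$, $\chi_{ik}=0$). **Theorem.** There is a constant $C>0$ depending only on $n$ such that, for all choices of subspaces, all couplings $c$ and all nonzero $a_i$, the following holds for both algorithms. 1. There is $\kappa>0$ such that for all $d\ge2$ and $T>0$ with $dT\le\kappa$, and all sufficiently large $N$ (depending on $d,T$), for all $i<j$ $$\mathrm{Var}(\hat c_{ij})\le \frac{C}{T^4}\Big(\sum_{r\le i}\frac1{a_r^2}\Big)\frac1{Nd^4}.$$ 2. For every $\varepsilon>0$ there is $\kappa>0$ such that for all $d\ge2$ and $T>0$ with $dT\le\kappa$, and all sufficiently large $N$ (depending on $\varepsilon,d,T$), the Fisher information matrix is positive definite and $|\mathrm{Var}(\hat c_{ij})-\mathrm{CRB}_{ij}|\le\varepsilon\,\mathrm{CRB}_{ij}$ for all $i<j$. -/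

import Mathlib

open Matrix MeasureTheory ProbabilityTheory Filter

noncomputable section

namespace HamLearn

/-! Qubits, couplings and the physical Hamiltonians -/

/-- Computational basis labels of `n` qubits; `false` is the bit 0 and `true` is the bit 1. -/
abbrev Bits (n : ℕ) := Fin n → Bool

/-- The pairs `i < j`.  A pair labels the coupling `c_ij`; it also labels the invariant subspace
number `j` that is used in round `i`, since round `i` uses as many subspaces as there are `j > i`. -/
abbrev Pair (n : ℕ) := {p : Fin n × Fin n // p.1 < p.2}

/-- The indices that come after `i`. -/
abbrev Later {n : ℕ} (i : Fin n) := {k : Fin n // i < k}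

/-- The rounds of the algorithm: all qubits but the last one. -/
abbrev Round (n : ℕ) := {i : Fin n // ∃ k, i < k}

/-- The pair `(i, k)` for `k > i`. -/
def toPair {n : ℕ} (i : Fin n) (k : Later i) : Pair n := ⟨(i, k.1), k.2⟩

/-- The round in which the subspace labelled by a pair is used. -/
def roundOf {n : ℕ} (p : Pair n) : Round n := ⟨p.1.1, p.1.2, p.2⟩

/-- Eigenvalue of `Z` on a bit. -/
def zSign (b : Bool) : ℝ := if b then -1 else 1

/-- Eigenvalue `λ_pq` of `Z_p Z_q` on a computational basis state. -/
def zzSign {n : ℕ} (w : Bits n) (p q : Fin n) : ℝ := zSign (w p) * zSign (w q)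

/-- `w ⊕ e_i`. -/
def flipBit {n : ℕ} (i : Fin n) (w : Bits n) : Bits n := Function.update w i (!(w i))

/-- Pauli `Z` on qubit `i`. -/
def opZ {n : ℕ} (i : Fin n) : Matrix (Bits n) (Bits n) ℂ :=
  Matrix.diagonal fun w => ((zSign (w i) : ℝ) : ℂ)

/-- Pauli `X` on qubit `i`. -/
def opX {n : ℕ} (i : Fin n) : Matrix (Bits n) (Bits n) ℂ :=
  Matrix.of fun w w' => if w = flipBit i w' then 1 else 0

/-- The coupling of the unordered pair `{i, j}`. -/
def coupling {n : ℕ} (c : Pair n → ℝ) (i j : Fin n) : ℝ :=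
  if h : i < j then c ⟨(i, j), h⟩ else if h : j < i then c ⟨(j, i), h⟩ else 0

/-- The interaction Hamiltonian: the sum of `c_pq Z_p Z_q` over the `n(n-1)/2` pairs. -/
def interaction {n : ℕ} (c : Pair n → ℝ) : Matrix (Bits n) (Bits n) ℂ :=
  ∑ p : Pair n, ((c p : ℝ) : ℂ) • (opZ p.1.1 * opZ p.1.2)

/-- The full Hamiltonian `H_i = a_i X_i + ∑ c_pq Z_p Z_q`. -/
def fullHamiltonian {n : ℕ} (a : Fin n → ℝ) (c : Pair n → ℝ) (i : Fin n) :
    Matrix (Bits n) (Bits n) ℂ :=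
  ((a i : ℝ) : ℂ) • opX i + interaction c

/-- The propagator `exp(-i H t)`. -/
def propagator {n : ℕ} (H : Matrix (Bits n) (Bits n) ℂ) (t : ℝ) : Matrix (Bits n) (Bits n) ℂ :=
  NormedSpace.exp ((-(Complex.I * ((t : ℝ) : ℂ))) • H)

/-! Invariant subspaces -/

/-- The `±1` matrix that expresses the diagonal splittings of the subspaces of round `i` in terms
of the couplings `c_ij`, `j > i`, that are still unknown in round `i`. -/
def coeffMatrix {n : ℕ} (zero : Pair n → Bits n) (i : Fin n) : Matrix (Later i) (Later i) ℝ :=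
  Matrix.of fun k j => zzSign (zero (toPair i k)) i j.1

/-- A choice of the invariant subspaces used by the algorithm: for every round `i` and every
`k > i` the logical zero state `zero (i, k)`, whose `i`-th bit is 0 (the logical one state is
`flipBit i (zero (i, k))`), such that the linear system of every round is uniquely solvable. -/
structure SubspaceChoice (n : ℕ) where
  zero : Pair n → Bits n
  zero_bit : ∀ p : Pair n, zero p p.1.1 = false
  solvable : ∀ i : Fin n, IsUnit (coeffMatrix zero i).det

/-- Half of the difference of the diagonal entries of `H_i` on the subspace `p = (i, k)`:
the sum of `λ_ij c_ij` over all `j ≠ i`. -/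
def splitting {n : ℕ} (S : SubspaceChoice n) (c : Pair n → ℝ) (p : Pair n) : ℝ :=
  ∑ j ∈ Finset.univ.erase p.1.1, zzSign (S.zero p) p.1.1 j * coupling c p.1.1 j

/-! Circuits and their outcome probabilities.  The Boolean `s` selects the initial state:
`false` is the logical `|+⟩`, `true` is the logical `|i⟩`. -/

/-- Relative phase of the logical one state in the initial state. -/
def prepPhase (s : Bool) : ℂ := if s then Complex.I else 1

/-- The sampling angles `ω_j = jπ/(2d-1)`, `j = 0, …, 2d-2`. -/
def omega (d : ℕ) (j : Fin (2 * d - 1)) : ℝ := ((j : ℕ) : ℝ) * Real.pi / (2 * (d : ℝ) - 1)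

/-- `|v⟩ + phase |v ⊕ e_i⟩`, not normalized. -/
def bellVector {n : ℕ} (S : SubspaceChoice n) (p : Pair n) (s : Bool) : Bits n → ℂ :=
  Pi.single (S.zero p) 1 + Pi.single (flipBit p.1.1 (S.zero p)) (prepPhase s)

/-- Hybrid mode: normalized superposition of the logical states of all subspaces of round `i`. -/
def hybridState {n : ℕ} (S : SubspaceChoice n) (i : Fin n) (s : Bool) : Bits n → ℂ :=
  (((1 / Real.sqrt (2 * (Fintype.card (Later i) : ℝ)) : ℝ)) : ℂ) •
    ∑ k : Later i, bellVector S (toPair i k) s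

/-- Analog mode: the logical state of one subspace. -/
def analogState {n : ℕ} (S : SubspaceChoice n) (p : Pair n) (s : Bool) : Bits n → ℂ :=
  (((1 / Real.sqrt 2 : ℝ)) : ℂ) • bellVector S p s

/-- Hybrid mode: the logical rotation is the digital gate `exp(-i ω Z_i)`. -/
def hybridRotation {n : ℕ} (i : Fin n) (ω : ℝ) : Matrix (Bits n) (Bits n) ℂ :=
  propagator (opZ i) ω

/-- Analog mode: unit-time evolution under `b Z_i + ∑ c_pq Z_p Z_q`, with `b` calibrated such that
on the subspace `p = (i, k)` it acts as `exp(-i ω Z)` up to a global phase. -/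
def analogRotation {n : ℕ} (S : SubspaceChoice n) (c : Pair n → ℝ) (p : Pair n) (ω : ℝ) :
    Matrix (Bits n) (Bits n) ℂ :=
  propagator (((ω - splitting S c p : ℝ) : ℂ) • opZ p.1.1 + interaction c) 1

/-- Born probabilities in the computational basis. -/
def born {n : ℕ} (ψ : Bits n → ℂ) (w : Bits n) : ℝ := Complex.normSq (ψ w)

/-- The circuits of the hybrid algorithm: a round, an initial state, a sampling angle. -/
abbrev HybridCircuit (n d : ℕ) := Round n × Bool × Fin (2 * d - 1)

/-- The circuits of the analog algorithm: a subspace `(i, k)`, an initial state, an angle. -/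
abbrev AnalogCircuit (n d : ℕ) := Pair n × Bool × Fin (2 * d - 1)

/-- Outcome probabilities after `d` cycles (Hamiltonian evolution for time `T`, then the logical
rotation). -/
def hybridProb {n : ℕ} (S : SubspaceChoice n) (a : Fin n → ℝ) (c : Pair n → ℝ) (T : ℝ) (d : ℕ)
    (x : HybridCircuit n d) : Bits n → ℝ :=
  born (((hybridRotation x.1.1 (omega d x.2.2) *
    propagator (fullHamiltonian a c x.1.1) T) ^ d) *ᵥ hybridState S x.1.1 x.2.1)

/-- Outcome probabilities after `d` cycles in analog mode. -/
def analogProb {n : ℕ} (S : SubspaceChoice n) (a : Fin n → ℝ) (c : Pair n → ℝ) (T : ℝ) (d : ℕ)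
    (x : AnalogCircuit n d) : Bits n → ℝ :=
  born (((analogRotation S c x.1 (omega d x.2.2) *
    propagator (fullHamiltonian a c x.1.1.1) T) ^ d) *ᵥ analogState S x.1 x.2.1)

/-! The measurement record: `N` independent shots of every circuit -/

/-- The probability distribution with the given weights. -/
def lawOf {n : ℕ} (w : Bits n → ℝ) : Measure (Bits n) :=
  ∑ b : Bits n, ENNReal.ofReal (w b) • Measure.dirac b

/-- The joint law of the outcomes of `N` independent shots of each circuit in `K`. -/
def dataLaw {n : ℕ} {K : Type} [Fintype K] (prob : K → Bits n → ℝ) (N : ℕ) :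
    Measure (K × Fin N → Bits n) :=
  Measure.pi fun x => lawOf (prob x.1)

/-- Relative frequency of the outcome `b` among the `N` shots of the circuit `x`. -/
def freq {n N : ℕ} {K : Type} (data : K × Fin N → Bits n) (x : K) (b : Bits n) : ℝ :=
  ((Finset.univ.filter fun t : Fin N => data (x, t) = b).card : ℝ) / (N : ℝ)

/-- Reconstruction function of the subspace `p`, hybrid mode: the frequencies of the logical zero
state are rescaled by the number of subspaces of the round. -/
def hybridH {n d N : ℕ} (S : SubspaceChoice n) (data : HybridCircuit n d × Fin N → Bits n)
    (p : Pair n) (j : Fin (2 * d - 1)) : ℂ :=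
  let pX : ℝ := Fintype.card (Later p.1.1) * freq data (roundOf p, false, j) (S.zero p)
  let pY : ℝ := Fintype.card (Later p.1.1) * freq data (roundOf p, true, j) (S.zero p)
  ((pX - 1 / 2 : ℝ) : ℂ) + Complex.I * ((pY - 1 / 2 : ℝ) : ℂ)

/-- Reconstruction function of the subspace `p`, analog mode. -/
def analogH {n d N : ℕ} (S : SubspaceChoice n) (data : AnalogCircuit n d × Fin N → Bits n)
    (p : Pair n) (j : Fin (2 * d - 1)) : ℂ :=
  let pX : ℝ := freq data (p, false, j) (S.zero p)
  let pY : ℝ := freq data (p, true, j) (S.zero p)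
  ((pX - 1 / 2 : ℝ) : ℂ) + Complex.I * ((pY - 1 / 2 : ℝ) : ℂ)

/-! Classical post-processing -/

/-- The `k`-th Fourier coefficient of the reconstruction function.  With the rotation
`exp(-i ω Z)` the reconstruction function is a combination of the exponentials `exp(-2 i k ω)`,
and this is the discrete transform that extracts their coefficients, which are
`≈ i θ exp(-i (2k+1) ζ)` for `k = 0, …, d-1`. -/
def fourier (d : ℕ) (h : Fin (2 * d - 1) → ℂ) (k : ℕ) : ℂ :=
  (1 / (2 * (d : ℂ) - 1)) *
    ∑ j : Fin (2 * d - 1), Complex.exp (2 * Complex.I * (k : ℂ) * ((omega d j : ℝ) : ℂ)) * h j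

/-- `θ̂`, the mean amplitude of the Fourier coefficients. -/
def thetaHat (d : ℕ) (h : Fin (2 * d - 1) → ℂ) : ℝ :=
  (1 / (d : ℝ)) * ∑ k : Fin d, ‖fourier d h (k : ℕ)‖

/-- The phase differences `Δ_k = phase(c_k * conj c_{k+1})`, `k = 0, …, d-2`. -/
def phaseDiff (d : ℕ) (h : Fin (2 * d - 1) → ℂ) (k : Fin (d - 1)) : ℝ :=
  Complex.arg (fourier d h (k : ℕ) * star (fourier d h ((k : ℕ) + 1)))

/-- The discrete Laplacian: 2 on the diagonal, -1 next to it. -/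
def laplacian (m : ℕ) : Matrix (Fin m) (Fin m) ℝ :=
  Matrix.of fun k l =>
    if k = l then 2 else if (k : ℕ) + 1 = (l : ℕ) ∨ (l : ℕ) + 1 = (k : ℕ) then -1 else 0

/-- `ζ̂ = (1/2) (𝟙ᵀ D⁻¹ Δ) / (𝟙ᵀ D⁻¹ 𝟙)`. -/
def zetaHat (d : ℕ) (h : Fin (2 * d - 1) → ℂ) : ℝ :=
  (1 / 2) * ((fun _ => (1 : ℝ)) ⬝ᵥ ((laplacian (d - 1))⁻¹ *ᵥ phaseDiff d h)) /
    ((fun _ => (1 : ℝ)) ⬝ᵥ ((laplacian (d - 1))⁻¹ *ᵥ fun _ => (1 : ℝ)))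

/-- The `B`-component of the inverse of the map `(A, B) ↦ (θ, ζ)`,
`tan ζ = (B / ω) tan ω`, `sin² θ = (A / ω)² sin² ω`, `ω = √(A² + B²)`,
on the branch `0 ≤ ω ≤ π / 2`, where `cos ω = |cos θ cos ζ|`. -/
def splittingAngle (θ ζ : ℝ) : ℝ :=
  let ω := Real.arccos |Real.cos θ * Real.cos ζ|
  ω / Real.sin ω * (|Real.cos θ| * Real.sin ζ)

/-- Solves, round by round, the linear systems `B_(i,k) = ∑_{j ≠ i} λ_ij c_ij T` for the couplings
`c_ij`, `j > i`; the couplings `c_li` with `l < i` come from the previous rounds.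
The value for `j ≤ i` is not used. -/
def recover {n : ℕ} (S : SubspaceChoice n) (T : ℝ) (B : Pair n → ℝ) (i j : Fin n) : ℝ :=
  if h : i < j then
    ∑ k : Later i, (coeffMatrix S.zero i)⁻¹ ⟨j, h⟩ k *
      (B (toPair i k) / T -
        ∑ l : {l : Fin n // l < i}, zzSign (S.zero (toPair i k)) i l.1 * recover S T B l.1 i)
  else 0
termination_by i
decreasing_by exact l.2

/-- The estimator of the coupling `c_q` as a function of the reconstruction functions. -/
def couplingHat {n d : ℕ} (S : SubspaceChoice n) (T : ℝ) (h : Pair n → Fin (2 * d - 1) → ℂ)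
    (q : Pair n) : ℝ :=
  recover S T (fun p => splittingAngle (thetaHat d (h p)) (zetaHat d (h p))) q.1.1 q.1.2

/-- The variance of the estimator of `c_q` produced by the hybrid algorithm. -/
def hybridVar {n : ℕ} (S : SubspaceChoice n) (a : Fin n → ℝ) (c : Pair n → ℝ) (T : ℝ) (d N : ℕ)
    (q : Pair n) : ℝ :=
  variance (fun data => couplingHat S T (hybridH S data) q) (dataLaw (hybridProb S a c T d) N)

/-- The variance of the estimator of `c_q` produced by the analog algorithm. -/
def analogVar {n : ℕ} (S : SubspaceChoice n) (a : Fin n → ℝ) (c : Pair n → ℝ) (T : ℝ) (d N : ℕ)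
    (q : Pair n) : ℝ :=
  variance (fun data => couplingHat S T (analogH S data) q) (dataLaw (analogProb S a c T d) N)

/-! The Cramér–Rao bound -/

/-- The Fisher information matrix of a finite statistical model. -/
def fisher {P R : Type} [Fintype P] [DecidableEq P] [Fintype R] (f : (P → ℝ) → R → ℝ)
    (ξ : P → ℝ) : Matrix P P ℝ :=
  Matrix.of fun k l => ∑ r : R,
    fderiv ℝ (fun y => f y r) ξ (Pi.single k 1) * fderiv ℝ (fun y => f y r) ξ (Pi.single l 1) /
      f ξ r

/-- The Cramér–Rao lower bound `∇ψᵀ I⁻¹ ∇ψ` for the variance of an unbiased estimator of `ψ`. -/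
def cramerRao {P : Type} [Fintype P] [DecidableEq P] (info : Matrix P P ℝ) (ψ : (P → ℝ) → ℝ)
    (ξ : P → ℝ) : ℝ :=
  (fun k => fderiv ℝ ψ ξ (Pi.single k 1)) ⬝ᵥ
    (info⁻¹ *ᵥ fun k => fderiv ℝ ψ ξ (Pi.single k 1))

/-- The general two-level gate with swap angle `θ`, phase difference `ζ` and phase `χ`. -/
def gate (θ ζ χ : ℝ) : Matrix (Fin 2) (Fin 2) ℂ :=
  !![(Real.cos θ : ℂ) * Complex.exp (-(Complex.I * ζ)),
      -(Complex.I * (Real.sin θ : ℂ) * Complex.exp (Complex.I * χ));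
    -(Complex.I * (Real.sin θ : ℂ) * Complex.exp (-(Complex.I * χ))),
      (Real.cos θ : ℂ) * Complex.exp (Complex.I * ζ)]

/-- The rotation `exp(-i ω Z)` of a two-level system. -/
def zRot (ω : ℝ) : Matrix (Fin 2) (Fin 2) ℂ :=
  !![Complex.exp (-(Complex.I * ω)), 0; 0, Complex.exp (Complex.I * ω)]

/-- Probability of the logical zero after `d` cycles, for a standard logical Bell state. -/
def bellProb (d : ℕ) (s : Bool) (ω θ ζ χ : ℝ) : ℝ :=
  Complex.normSq (((((zRot ω) * gate θ ζ χ) ^ d) *ᵥ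
    ((((1 / Real.sqrt 2 : ℝ)) : ℂ) • ![1, prepPhase s])) 0)

/-- The unknown parameters: `(θ, ζ, χ)` for every subspace `p = (i, k)`, in positions 0, 1, 2. -/
abbrev Param (n : ℕ) := Pair n × Fin 3

/-- `bellProb` for the subspace `p`, as a function of the parameter vector. -/
def subspaceProb {n : ℕ} (d : ℕ) (p : Pair n) (s : Bool) (j : Fin (2 * d - 1))
    (ξ : Param n → ℝ) : ℝ :=
  bellProb d s (omega d j) (ξ (p, 0)) (ξ (p, 1)) (ξ (p, 2))

/-- Distribution of the record of one shot in hybrid mode: `some k` if the logical zero of the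
subspace `(i, k)` was observed, `none` otherwise. -/
def hybridModel {n d : ℕ} (x : HybridCircuit n d) (ξ : Param n → ℝ) : Option (Later x.1.1) → ℝ
  | some k => subspaceProb d (toPair x.1.1 k) x.2.1 x.2.2 ξ / Fintype.card (Later x.1.1)
  | none => 1 - ∑ k : Later x.1.1,
      subspaceProb d (toPair x.1.1 k) x.2.1 x.2.2 ξ / Fintype.card (Later x.1.1)

/-- Distribution of the record of one shot in analog mode: whether the logical zero was seen. -/
def analogModel {n d : ℕ} (x : AnalogCircuit n d) (ξ : Param n → ℝ) : Bool → ℝ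
  | true => subspaceProb d x.1 x.2.1 x.2.2 ξ
  | false => 1 - subspaceProb d x.1 x.2.1 x.2.2 ξ

/-- Fisher information of `N` independent shots of every circuit, hybrid mode. -/
def hybridInfo {n : ℕ} (d N : ℕ) (ξ : Param n → ℝ) : Matrix (Param n) (Param n) ℝ :=
  (N : ℝ) • ∑ x : HybridCircuit n d, fisher (hybridModel x) ξ

/-- Fisher information of `N` independent shots of every circuit, analog mode. -/
def analogInfo {n : ℕ} (d N : ℕ) (ξ : Param n → ℝ) : Matrix (Param n) (Param n) ℝ :=
  (N : ℝ) • ∑ x : AnalogCircuit n d, fisher (analogModel x) ξ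

/-- The true parameter vector: the image of `(A, B) = (a_i T, B_(i,k))` under
`(A, B) ↦ (θ, ζ)`, and `χ = 0`. -/
def trueParam {n : ℕ} (S : SubspaceChoice n) (a : Fin n → ℝ) (c : Pair n → ℝ) (T : ℝ) :
    Param n → ℝ := fun x =>
  let A := a x.1.1.1 * T
  let B := splitting S c x.1 * T
  let ω := Real.sqrt (A ^ 2 + B ^ 2)
  ![Real.arcsin (A / ω * Real.sin ω), Real.arctan (B / ω * Real.tan ω), 0] x.2

/-- The coupling `c_q` as a function of the parameter vector. -/
def couplingOf {n : ℕ} (S : SubspaceChoice n) (T : ℝ) (q : Pair n) (ξ : Param n → ℝ) : ℝ :=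
  recover S T (fun p => splittingAngle (ξ (p, 0)) (ξ (p, 1))) q.1.1 q.1.2

/-- Cramér–Rao bound for `c_q`, hybrid mode. -/
def hybridBound {n : ℕ} (S : SubspaceChoice n) (a : Fin n → ℝ) (c : Pair n → ℝ) (T : ℝ)
    (d N : ℕ) (q : Pair n) : ℝ :=
  cramerRao (hybridInfo d N (trueParam S a c T)) (couplingOf S T q) (trueParam S a c T)

/-- Cramér–Rao bound for `c_q`, analog mode. -/
def analogBound {n : ℕ} (S : SubspaceChoice n) (a : Fin n → ℝ) (c : Pair n → ℝ) (T : ℝ)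
    (d N : ℕ) (q : Pair n) : ℝ :=
  cramerRao (analogInfo d N (trueParam S a c T)) (couplingOf S T q) (trueParam S a c T)

end HamLearn

end

/-!
The circuits reduce to two-level systems, the estimator is a smooth function of empirical
frequencies, and for small `d T` its gradient, the gradient of an exactly unbiased statistic, and
one explicit reference statistic agree to leading order. This gives both the size of the variance
and its agreement with the Cramér–Rao bound.

*Reduction.* On the span of `|v⟩` and `|v ⊕ e_i⟩` one cycle acts, up to a phase, as `zRot ω * gate`
with the true angles `(θ, ζ, 0)` (`actsAs_fullPropagator`), so the probability of a logical zero is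
`bellProb`, divided by the number of subspaces that share the circuit (`analogProb_zero`,
`hybridProb_zero`). From here on both algorithms are treated at once: a map `grp` from subspaces to
circuits is `id` in the analog mode and `roundOf` in the hybrid mode.

*Fourier analysis.* The exact reconstruction function is a trigonometric polynomial with Fourier
coefficients `i · amp_m(θ) · exp(-i((2m+1)ζ + χ))` for `|m| < d` (`recon_eq_synth`). The amplitudes
do not depend on `ζ` and `χ`, and `amp_m(θ)` is `θ` for `m ≥ 0` and `0` for `m < 0`, up to a relative
error of order `(dθ)²` (`abs_amp_sub_le`). Parseval's identity on the sampling grid turns all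
variances and informations into sums over `m`.

*Variance.* By the delta method, `N` times the variance of a bounded function of the frequencies
tends to the variance `covForm` of its gradient in one shot (`tendsto_mul_variance_freq`). The
coupling estimator is a linear combination, with coefficients bounded in terms of `n`, of the
splittings estimated on the subspaces of the rounds up to `i` (`recover_eq_sum`,
`recoverCoeff_eq_zero`, `exists_abs_recoverCoeff_le`). The splitting is `ζ` to first order, with
negligible sensitivity to `θ` (`exists_hasFDerivAt_splittingAngle`), and the phase estimator weights
the phases of the Fourier coefficients by `3(d-1-2m)/((d-1)d(d+1))`. Its gradient is thus close to
the reference statistic, whose coefficients are proportional to `2m + 1 - d` for `0 ≤ m < d`, and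
the squared norm of the latter is of order `1 / (A² d⁴)` with `A = a_i T` (`scale_le`).

*Cramér–Rao bound.* The information form is the inverse of the covariance form, so completing the
square gives `infoForm (δ - Σ g) = infoForm δ - 2⟨g, δ⟩ + covForm g` (`infoForm_sub_covOp`). For a
statistic `g` that is exactly unbiased to first order for the gradient `u` of the coupling, the
right-hand side at the response `δ` to a direction `v` is `v ⬝ᵥ J v - 2 u ⬝ᵥ v + covForm g`. At
`v = J⁻¹ u` this shows that the bound is at most `covForm g`; and any direction for which the left
side is small shows that the bound is not much smaller. Such a direction exists: changing `ζ` by `β`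
and `χ` by `-dβ` changes the `m`-th coefficient by a multiple of `2m + 1 - d`, which is the reference
statistic again (`sum_resp_sub_sq_le`). The comparison is carried out in `NearIdeal.compare` and
`compare_cramerRao`, with all relative errors controlled by a single number `η` (`Regime`) that is
small together with `d T` (`exists_regime`).
-/

noncomputable section

namespace HamLearn

/-! ### Asymptotic variance of a statistic of empirical frequencies -/

lemma isProbabilityMeasure_lawOf {n : ℕ} {w : Bits n → ℝ} (h0 : ∀ b, 0 ≤ w b)
    (h1 : ∑ b, w b = 1) : IsProbabilityMeasure (lawOf w) := by
  constructor
  simp only [lawOf, Measure.coe_finsetSum, Finset.sum_apply, Measure.smul_apply, measure_univ,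
    smul_eq_mul, mul_one]
  rw [← ENNReal.ofReal_sum_of_nonneg fun b _ => h0 b, h1, ENNReal.ofReal_one]

lemma integral_lawOf {n : ℕ} {w : Bits n → ℝ} (h0 : ∀ b, 0 ≤ w b) (g : Bits n → ℝ) :
    ∫ b, g b ∂(lawOf w) = ∑ b, w b * g b := by
  unfold lawOf
  rw [integral_finsetSum_measure]
  · refine Finset.sum_congr rfl fun b _ => ?_
    rw [integral_smul_measure, integral_dirac, ENNReal.toReal_ofReal (h0 b), smul_eq_mul]
  · intro b _
    exact (integrable_dirac (by simp)).smul_measure ENNReal.ofReal_ne_top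

/-- Variance of the function `g` of one outcome drawn with the probabilities `w`. -/
def outcomeVar {n : ℕ} (w g : Bits n → ℝ) : ℝ := ∑ b, w b * g b ^ 2 - (∑ b, w b * g b) ^ 2

lemma variance_lawOf {n : ℕ} {w : Bits n → ℝ} (h0 : ∀ b, 0 ≤ w b)
    (h1 : ∑ b, w b = 1) (g : Bits n → ℝ) : Var[g; lawOf w] = outcomeVar w g := by
  have := isProbabilityMeasure_lawOf h0 h1
  rw [variance_eq_sub (MemLp.of_discrete), integral_lawOf h0, integral_lawOf h0]
  rfl

variable {n : ℕ} {K : Type}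

lemma freq_nonneg {N : ℕ} (data : K × Fin N → Bits n) (x : K) (b : Bits n) :
    0 ≤ freq data x b := by unfold freq; positivity

lemma freq_le_one {N : ℕ} (data : K × Fin N → Bits n) (x : K) (b : Bits n) :
    freq data x b ≤ 1 := by
  unfold freq
  refine div_le_one_of_le₀ ?_ (Nat.cast_nonneg _)
  exact_mod_cast (Finset.card_le_univ _).trans (by simp)

variable [Fintype K]

/-- A linear statistic of the frequencies is a normalized sum over the shots. -/
lemma sum_mul_freq {N : ℕ} (G : K → Bits n → ℝ) (data : K × Fin N → Bits n) :
    ∑ x, ∑ b, G x b * freq data x b = ∑ y : K × Fin N, (1 / (N : ℝ)) * G y.1 (data y) := by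
  classical
  rw [Fintype.sum_prod_type]
  refine Finset.sum_congr rfl fun x _ => ?_
  have : ∀ b, G x b * freq data x b =
      ∑ t : Fin N, if data (x, t) = b then (1 / (N : ℝ)) * G x b else 0 := by
    intro b
    rw [← Finset.sum_filter, Finset.sum_const, nsmul_eq_mul, freq]
    ring
  simp_rw [this]
  rw [Finset.sum_comm]
  refine Finset.sum_congr rfl fun t _ => ?_
  simp

lemma variance_sum_mul_freq {prob : K → Bits n → ℝ} (h0 : ∀ x b, 0 ≤ prob x b)
    (h1 : ∀ x, ∑ b, prob x b = 1) {N : ℕ} (hN : N ≠ 0) (G : K → Bits n → ℝ) :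
    Var[fun data => ∑ x, ∑ b, G x b * freq data x b; dataLaw prob N] =
      (1 / (N : ℝ)) * ∑ x, outcomeVar (prob x) (G x) := by
  have : ∀ y : K × Fin N, IsProbabilityMeasure (lawOf (prob y.1)) :=
    fun y => isProbabilityMeasure_lawOf (h0 _) (h1 _)
  have key := variance_sum_pi (μ := fun y : K × Fin N => lawOf (prob y.1))
    (X := fun y b => (1 / (N : ℝ)) * G y.1 b) (fun y => MemLp.of_discrete)
  have e : (fun data : K × Fin N → Bits n => ∑ x, ∑ b, G x b * freq data x b) =
      ∑ y : K × Fin N, fun data => (1 / (N : ℝ)) * G y.1 (data y) := by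
    ext data
    rw [sum_mul_freq, Finset.sum_apply]
  rw [e]
  unfold dataLaw
  rw [key, Fintype.sum_prod_type, Finset.mul_sum]
  refine Finset.sum_congr rfl fun x _ => ?_
  have hv : Var[fun b => (1 / (N : ℝ)) * G x b; lawOf (prob x)] =
      (1 / (N : ℝ)) ^ 2 * outcomeVar (prob x) (G x) := by
    rw [← variance_lawOf (h0 x) (h1 x)]
    exact variance_const_mul _ _ _
  simp only [hv, Finset.sum_const, Finset.card_univ, Fintype.card_fin, nsmul_eq_mul]
  have : (N : ℝ) ≠ 0 := by exact_mod_cast hN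
  field_simp

lemma integral_sum_mul_freq {prob : K → Bits n → ℝ} (h0 : ∀ x b, 0 ≤ prob x b)
    (h1 : ∀ x, ∑ b, prob x b = 1) {N : ℕ} (hN : N ≠ 0) (G : K → Bits n → ℝ) :
    ∫ data, (∑ x, ∑ b, G x b * freq data x b) ∂(dataLaw prob N) =
      ∑ x, ∑ b, G x b * prob x b := by
  have : ∀ y : K × Fin N, IsProbabilityMeasure (lawOf (prob y.1)) :=
    fun y => isProbabilityMeasure_lawOf (h0 _) (h1 _)
  have : IsProbabilityMeasure (dataLaw prob N) := by unfold dataLaw; infer_instance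
  simp_rw [sum_mul_freq]
  rw [integral_finsetSum _ (fun y _ => Integrable.of_finite)]
  have : ∀ y : K × Fin N, ∫ data, (1 / (N : ℝ)) * G y.1 (data y) ∂(dataLaw prob N) =
      (1 / (N : ℝ)) * ∑ b, G y.1 b * prob y.1 b := by
    intro y
    rw [integral_const_mul]
    congr 1
    rw [dataLaw, integral_comp_eval (μ := fun y : K × Fin N => lawOf (prob y.1)) (i := y)
      (f := G y.1) AEStronglyMeasurable.of_discrete, integral_lawOf (h0 _)]
    exact Finset.sum_congr rfl fun b _ => mul_comm _ _
  simp_rw [this]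
  rw [Fintype.sum_prod_type]
  refine Finset.sum_congr rfl fun x _ => ?_
  have : (N : ℝ) ≠ 0 := by exact_mod_cast hN
  simp only [Finset.sum_const, Finset.card_univ, Fintype.card_fin, nsmul_eq_mul]
  field_simp

/-- Hoeffding's inequality for one empirical frequency. -/
lemma measureReal_freq_sub_ge_le [DecidableEq K] {prob : K → Bits n → ℝ}
    (h0 : ∀ x b, 0 ≤ prob x b) (h1 : ∀ x, ∑ b, prob x b = 1) {N : ℕ} (hN : N ≠ 0) {δ : ℝ}
    (hδ : 0 < δ) (x : K) (b : Bits n) :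
    (dataLaw prob N).real {data | δ ≤ |freq data x b - prob x b|} ≤
      2 * Real.exp (-(2 * N * δ ^ 2)) := by
  have : ∀ y : K × Fin N, IsProbabilityMeasure (lawOf (prob y.1)) :=
    fun y => isProbabilityMeasure_lawOf (h0 _) (h1 _)
  have hP : IsProbabilityMeasure (dataLaw prob N) := by unfold dataLaw; infer_instance
  have hNR : (N : ℝ) ≠ 0 := by exact_mod_cast hN
  have one_side : ∀ σ : ℝ, σ = 1 ∨ σ = -1 →
      (dataLaw prob N).real {data | δ ≤ σ * (freq data x b - prob x b)} ≤
        Real.exp (-(2 * N * δ ^ 2)) := by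
    intro σ hσ
    let ξ : Bits n → ℝ := fun b' => σ * (if b' = b then 1 else 0)
    let s : Finset (K × Fin N) := Finset.univ.map ⟨fun t : Fin N => (x, t), fun t t' h => by
      simpa using h⟩
    let Y : K × Fin N → (K × Fin N → Bits n) → ℝ := fun y data =>
      ξ (data y) - ∫ b', ξ b' ∂(lawOf (prob y.1))
    have hind : iIndepFun Y (dataLaw prob N) :=
      iIndepFun_pi (μ := fun y : K × Fin N => lawOf (prob y.1))
        (X := fun y b' => ξ b' - ∫ b', ξ b' ∂(lawOf (prob y.1)))
        (fun y => AEMeasurable.of_discrete)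
    have hsub : ∀ y ∈ s, HasSubgaussianMGF (Y y) ((1 / 2) ^ 2) (dataLaw prob N) := by
      intro y _
      rcases hσ with rfl | rfl
      · have := hasSubgaussianMGF_of_mem_Icc (μ := dataLaw prob N)
          (X := fun data => ξ (data y)) (a := 0) (b := 1) AEMeasurable.of_discrete
          (ae_of_all _ fun data => by simp only [ξ]; split_ifs <;> norm_num)
        rw [dataLaw, integral_comp_eval (μ := fun y : K × Fin N => lawOf (prob y.1)) (i := y)
          (f := ξ) AEStronglyMeasurable.of_discrete] at this
        simpa [Y, dataLaw] using this
      · have := hasSubgaussianMGF_of_mem_Icc (μ := dataLaw prob N)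
          (X := fun data => ξ (data y)) (a := -1) (b := 0) AEMeasurable.of_discrete
          (ae_of_all _ fun data => by simp only [ξ]; split_ifs <;> norm_num)
        rw [dataLaw, integral_comp_eval (μ := fun y : K × Fin N => lawOf (prob y.1)) (i := y)
          (f := ξ) AEStronglyMeasurable.of_discrete] at this
        simpa [Y, dataLaw] using this
    have key := HasSubgaussianMGF.measure_sum_ge_le_of_iIndepFun hind hsub
      (ε := N * δ) (by positivity)
    have hsum : ∀ data, ∑ y ∈ s, Y y data = N * (σ * (freq data x b - prob x b)) := by
      intro data
      have hint : ∫ b', ξ b' ∂(lawOf (prob x)) = σ * prob x b := by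
        rw [integral_lawOf (h0 x)]
        simp only [ξ, mul_ite, mul_one, mul_zero, Finset.sum_ite_eq', Finset.mem_univ, if_true]
        ring
      have hcount : ∑ t : Fin N, (if data (x, t) = b then (1 : ℝ) else 0) =
          (Finset.univ.filter fun t : Fin N => data (x, t) = b).card := by
        rw [Finset.sum_boole]
      have hstep : ∑ y ∈ s, Y y data = ∑ t : Fin N, (ξ (data (x, t)) - σ * prob x b) := by
        rw [Finset.sum_map]
        refine Finset.sum_congr rfl fun t _ => ?_
        rw [← hint]
        rfl
      rw [hstep, Finset.sum_sub_distrib, Finset.sum_const, Finset.card_univ, Fintype.card_fin,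
        nsmul_eq_mul, ← Finset.mul_sum, hcount, freq]
      field_simp
    have hset : {data : K × Fin N → Bits n | δ ≤ σ * (freq data x b - prob x b)} =
        {data | N * δ ≤ ∑ y ∈ s, Y y data} := by
      ext data
      have : (0 : ℝ) < N := lt_of_le_of_ne (Nat.cast_nonneg _) hNR.symm
      simp only [Set.mem_ofPred_eq, hsum]
      exact (mul_le_mul_iff_right₀ this).symm
    rw [hset]
    refine key.trans (le_of_eq ?_)
    congr 1
    simp only [Finset.sum_const, s, Finset.card_map, Finset.card_univ, Fintype.card_fin,
      nsmul_eq_mul]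
    push_cast
    field_simp
  have hsub : {data : K × Fin N → Bits n | δ ≤ |freq data x b - prob x b|} ⊆
      {data | δ ≤ 1 * (freq data x b - prob x b)} ∪
        {data | δ ≤ (-1) * (freq data x b - prob x b)} := by
    intro data hdata
    have hdata' : δ ≤ |freq data x b - prob x b| := hdata
    rcases le_abs.mp hdata' with h | h
    · left; simpa using h
    · right; simpa using h
  calc _ ≤ _ := measureReal_mono hsub
    _ ≤ _ := measureReal_union_le _ _
    _ ≤ _ := add_le_add (one_side 1 (Or.inl rfl)) (one_side (-1) (Or.inr rfl))
    _ = _ := by ring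

/-- A small additive perturbation changes a variance little. -/
lemma variance_add_le {Ω : Type*} [MeasurableSpace Ω] [Finite Ω] [DiscreteMeasurableSpace Ω]
    (μ : Measure Ω) [IsProbabilityMeasure μ] (X R : Ω → ℝ) {t : ℝ} (ht : 0 < t) :
    Var[X + R; μ] ≤ (1 + t) * Var[X; μ] + (1 + 1 / t) * ∫ ω, R ω ^ 2 ∂μ := by
  have h1 : Var[X + R; μ] ≤ (1 + t) * Var[X; μ] + (1 + 1 / t) * Var[R; μ] := by
    rw [variance_eq_integral AEMeasurable.of_discrete, variance_eq_integral AEMeasurable.of_discrete,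
      variance_eq_integral AEMeasurable.of_discrete, ← integral_const_mul, ← integral_const_mul,
      ← integral_add Integrable.of_finite Integrable.of_finite]
    refine integral_mono Integrable.of_finite Integrable.of_finite fun ω => ?_
    have e : ∫ ω, (X + R) ω ∂μ = μ[X] + μ[R] :=
      integral_add Integrable.of_finite Integrable.of_finite
    rw [e, Pi.add_apply]
    set x := X ω - μ[X]
    set r := R ω - μ[R]
    have : X ω + R ω - (μ[X] + μ[R]) = x + r := by simp only [x, r]; ring
    rw [this]
    have h2 : 0 ≤ (t * x - r) ^ 2 / t := by positivity
    have h3 : (t * x - r) ^ 2 / t = t * x ^ 2 - 2 * x * r + 1 / t * r ^ 2 := by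
      field_simp
      ring
    nlinarith
  refine h1.trans ?_
  have h2 : Var[R; μ] ≤ ∫ ω, R ω ^ 2 ∂μ := variance_le_expectation_sq AEStronglyMeasurable.of_discrete
  have : 0 ≤ 1 + 1 / t := by positivity
  gcongr

lemma outcomeVar_indicator_le {w : Bits n → ℝ} (h0 : ∀ b, 0 ≤ w b) (h1 : ∑ b, w b = 1)
    (b : Bits n) : outcomeVar w (Pi.single b 1) ≤ 1 := by
  have : outcomeVar w (Pi.single b 1) = w b - w b ^ 2 := by
    simp [outcomeVar, Pi.single_apply, ite_pow]
  rw [this]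
  have : w b ≤ 1 := h1 ▸ Finset.single_le_sum (fun b _ => h0 b) (Finset.mem_univ b)
  nlinarith [h0 b, sq_nonneg (w b)]

lemma integral_freq_sub_sq_le [DecidableEq K] {prob : K → Bits n → ℝ}
    (h0 : ∀ x b, 0 ≤ prob x b) (h1 : ∀ x, ∑ b, prob x b = 1) {N : ℕ} (hN : N ≠ 0)
    (x : K) (b : Bits n) :
    ∫ data, (freq data x b - prob x b) ^ 2 ∂(dataLaw prob N) ≤ 1 / N := by
  have : ∀ y : K × Fin N, IsProbabilityMeasure (lawOf (prob y.1)) :=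
    fun y => isProbabilityMeasure_lawOf (h0 _) (h1 _)
  have hP : IsProbabilityMeasure (dataLaw prob N) := by unfold dataLaw; infer_instance
  let G : K → Bits n → ℝ := Pi.single x (Pi.single b 1)
  have hG : ∀ F : K → Bits n → ℝ, ∑ x', ∑ b', G x' b' * F x' b' = F x b := by
    intro F
    rw [Finset.sum_eq_single x, Finset.sum_eq_single b]
    · simp [G]
    · intro b' _ hb
      simp [G, hb]
    · simp
    · intro x' _ hx
      simp [G, hx]
    · simp
  have hm := integral_sum_mul_freq h0 h1 hN G
  have hv := variance_sum_mul_freq h0 h1 hN G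
  simp only [hG] at hm hv
  rw [variance_eq_integral AEMeasurable.of_discrete, hm] at hv
  rw [hv, Finset.sum_eq_single x]
  · have := outcomeVar_indicator_le (h0 x) (h1 x) b
    have h2 : outcomeVar (prob x) (G x) ≤ 1 := by simpa [G] using this
    calc (1 / (N : ℝ)) * outcomeVar (prob x) (G x) ≤ 1 / N * 1 := by gcongr
      _ = _ := mul_one _
  · intro x' _ hx
    simp [G, hx, outcomeVar]
  · simp

lemma clm_apply_eq_sum [DecidableEq K] (L : (K → Bits n → ℝ) →L[ℝ] ℝ) (F : K → Bits n → ℝ) :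
    L F = ∑ x, ∑ b, L (Pi.single x (Pi.single b 1)) * F x b := by
  have : F = ∑ x, ∑ b, F x b • (Pi.single x (Pi.single b 1) : K → Bits n → ℝ) := by
    ext x b
    simp only [Finset.sum_apply, Pi.smul_apply, smul_eq_mul]
    rw [Finset.sum_eq_single x, Finset.sum_eq_single b]
    · simp
    · intro b' _ hb
      simp [hb.symm]
    · simp
    · intro x' _ hx
      simp [hx.symm]
    · simp
  conv_lhs => rw [this]
  simp only [map_sum, map_smul, smul_eq_mul, mul_comm]

/-- The mean square of the remainder in the first-order expansion is `o(1/N)`: near the true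
probabilities differentiability controls it, and the rest has exponentially small probability. -/
lemma tendsto_mul_integral_remainder [DecidableEq K] {prob : K → Bits n → ℝ}
    (h0 : ∀ x b, 0 ≤ prob x b) (h1 : ∀ x, ∑ b, prob x b = 1)
    {Φ : (K → Bits n → ℝ) → ℝ} {C : ℝ} (hC : ∀ F, |Φ F| ≤ C)
    {L : (K → Bits n → ℝ) →L[ℝ] ℝ} (hL : HasFDerivAt Φ L prob) :
    Tendsto (fun N : ℕ => (N : ℝ) * ∫ data, (Φ (freq data) - Φ prob -
      L (freq data - prob)) ^ 2 ∂(dataLaw prob N)) atTop (nhds 0) := by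
  have hP : ∀ N, IsProbabilityMeasure (dataLaw prob N) := by
    intro N
    have : ∀ y : K × Fin N, IsProbabilityMeasure (lawOf (prob y.1)) :=
      fun y => isProbabilityMeasure_lawOf (h0 _) (h1 _)
    unfold dataLaw; infer_instance
  have hp1 : ∀ x b, prob x b ≤ 1 := fun x b =>
    h1 x ▸ Finset.single_le_sum (fun b _ => h0 x b) (Finset.mem_univ b)
  have hC0 : 0 ≤ C := (abs_nonneg _).trans (hC 0)
  set c : ℝ := Fintype.card K * Fintype.card (Bits n) with hc
  set C' : ℝ := 2 * C + ‖L‖ with hC'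
  have hC'0 : 0 ≤ C' := by positivity
  rw [Metric.tendsto_atTop']
  intro ε hε
  obtain ⟨η, hη, hηε⟩ : ∃ η : ℝ, 0 < η ∧ η ^ 2 * c < ε / 2 := by
    have : Tendsto (fun η : ℝ => η ^ 2 * c) (nhdsWithin 0 (Set.Ioi 0)) (nhds (0 ^ 2 * c)) :=
      ((continuous_pow 2).mul continuous_const).continuousAt.tendsto.mono_left nhdsWithin_le_nhds
    have h := this.eventually (gt_mem_nhds (show (0 : ℝ) ^ 2 * c < ε / 2 by simpa using hε))
    obtain ⟨η, h1, h2⟩ := (h.and self_mem_nhdsWithin).exists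
    exact ⟨η, h2, h1⟩
  obtain ⟨δ, hδ, hrem⟩ : ∃ δ > 0, ∀ F : K → Bits n → ℝ, ‖F - prob‖ < δ →
      |Φ F - Φ prob - L (F - prob)| ≤ η * ‖F - prob‖ := by
    have := (hasFDerivAt_iff_isLittleO.mp hL).bound hη
    rw [Metric.eventually_nhds_iff] at this
    obtain ⟨δ, hδ, h⟩ := this
    exact ⟨δ, hδ, fun F hF => by simpa using h (by rwa [dist_eq_norm])⟩
  have hpt : ∀ N (data : K × Fin N → Bits n),
      (Φ (freq data) - Φ prob - L (freq data - prob)) ^ 2 ≤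
        ∑ x, ∑ b, (η ^ 2 * (freq data x b - prob x b) ^ 2 +
          C' ^ 2 * Set.indicator {data : K × Fin N → Bits n | δ ≤ |freq data x b - prob x b|}
            (fun _ => (1 : ℝ)) data) := by
    intro N data
    have hterm : ∀ x b, 0 ≤ (η ^ 2 * (freq data x b - prob x b) ^ 2 +
          C' ^ 2 * Set.indicator {data : K × Fin N → Bits n | δ ≤ |freq data x b - prob x b|}
            (fun _ => (1 : ℝ)) data) := by
      intro x b
      have : 0 ≤ Set.indicator {data : K × Fin N → Bits n | δ ≤ |freq data x b - prob x b|}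
            (fun _ => (1 : ℝ)) data := Set.indicator_nonneg (fun _ _ => zero_le_one) _
      positivity
    have hsingle : ∀ x b, (η ^ 2 * (freq data x b - prob x b) ^ 2 +
          C' ^ 2 * Set.indicator {data : K × Fin N → Bits n | δ ≤ |freq data x b - prob x b|}
            (fun _ => (1 : ℝ)) data) ≤ ∑ x, ∑ b, (η ^ 2 * (freq data x b - prob x b) ^ 2 +
          C' ^ 2 * Set.indicator {data : K × Fin N → Bits n | δ ≤ |freq data x b - prob x b|}
            (fun _ => (1 : ℝ)) data) := by
      intro x b
      refine le_trans ?_ (Finset.single_le_sum (fun x _ => Finset.sum_nonneg fun b _ => hterm x b)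
        (Finset.mem_univ x))
      exact Finset.single_le_sum (f := fun b => (η ^ 2 * (freq data x b - prob x b) ^ 2 +
          C' ^ 2 * Set.indicator {data : K × Fin N → Bits n | δ ≤ |freq data x b - prob x b|}
            (fun _ => (1 : ℝ)) data)) (fun b _ => hterm x b) (Finset.mem_univ b)
    set D : K → Bits n → ℝ := fun x b => freq data x b - prob x b
    have hD : freq data - prob = D := rfl
    -- near the true probabilities the remainder is at most `η` times the distance, elsewhere it is
    -- bounded and Hoeffding's inequality applies
    by_cases hnear : ‖freq data - prob‖ < δ
    · have hr := hrem _ hnear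
      have h3 : (Φ (freq data) - Φ prob - L (freq data - prob)) ^ 2 ≤
          (η * ‖freq data - prob‖) ^ 2 := sq_le_sq' (by linarith [abs_le.mp hr]) (abs_le.mp hr).2
      by_cases hz : ‖freq data - prob‖ = 0
      · rw [hz] at h3
        refine h3.trans ?_
        rw [mul_zero, zero_pow two_ne_zero]
        exact Finset.sum_nonneg fun x _ => Finset.sum_nonneg fun b _ => hterm x b
      have hex : ∃ x b, ‖freq data - prob‖ ≤ |freq data x b - prob x b| := by
        by_contra! hcon
        have hpos : 0 < ‖freq data - prob‖ := lt_of_le_of_ne (norm_nonneg _) (Ne.symm hz)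
        have : ‖freq data - prob‖ < ‖freq data - prob‖ := by
          conv_lhs => rw [hD]
          rw [pi_norm_lt_iff hpos]
          intro x
          rw [pi_norm_lt_iff hpos]
          exact fun b => hcon x b
        exact lt_irrefl _ this
      obtain ⟨x, b, hxb⟩ := hex
      refine h3.trans (le_trans ?_ (hsingle x b))
      have h4 : ‖freq data - prob‖ ^ 2 ≤ (freq data x b - prob x b) ^ 2 := by
        rw [← sq_abs (freq data x b - prob x b)]
        gcongr
      have : 0 ≤ Set.indicator {data : K × Fin N → Bits n | δ ≤ |freq data x b - prob x b|}
            (fun _ => (1 : ℝ)) data := Set.indicator_nonneg (fun _ _ => zero_le_one) _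
      have : 0 ≤ C' ^ 2 * Set.indicator {data : K × Fin N → Bits n | δ ≤ |freq data x b - prob x b|}
            (fun _ => (1 : ℝ)) data := by positivity
      rw [mul_pow]
      nlinarith [sq_nonneg η]
    · have hex : ∃ x b, δ ≤ |freq data x b - prob x b| := by
        by_contra! hcon
        apply hnear
        rw [pi_norm_lt_iff hδ]
        intro x
        rw [pi_norm_lt_iff hδ]
        exact fun b => hcon x b
      obtain ⟨x, b, hxb⟩ := hex
      refine le_trans ?_ (hsingle x b)
      rw [Set.indicator_of_mem (by exact hxb)]
      have hn1 : ‖freq data - prob‖ ≤ 1 := by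
        rw [pi_norm_le_iff_of_nonneg zero_le_one]
        intro x
        rw [pi_norm_le_iff_of_nonneg zero_le_one]
        intro b
        rw [Real.norm_eq_abs, abs_le]
        have := freq_nonneg data x b
        have := freq_le_one data x b
        have := h0 x b
        have := hp1 x b
        constructor <;> simp only [Pi.sub_apply] <;> linarith
      have hr : |Φ (freq data) - Φ prob - L (freq data - prob)| ≤ C' := by
        have a1 := hC (freq data)
        have a2 := hC prob
        have a3 : |L (freq data - prob)| ≤ ‖L‖ := by
          have := L.le_opNorm (freq data - prob)
          rw [Real.norm_eq_abs] at this
          exact this.trans (mul_le_of_le_one_right (norm_nonneg _) hn1)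
        rw [abs_le] at *
        constructor <;> simp only [hC'] <;> linarith
      have h3 := sq_le_sq' (by linarith [abs_le.mp hr]) (abs_le.mp hr).2
      nlinarith [mul_nonneg (sq_nonneg η) (sq_nonneg (freq data x b - prob x b))]
  -- the contribution of the large deviations vanishes
  have hexp : Tendsto (fun N : ℕ => C' ^ 2 * c * 2 *
      ((N : ℝ) * Real.exp (-(2 * N * δ ^ 2)))) atTop (nhds (C' ^ 2 * c * 2 * 0)) := by
    refine Tendsto.const_mul _ ?_
    have h := (tendsto_rpow_mul_exp_neg_mul_atTop_nhds_zero 1 (2 * δ ^ 2) (by positivity)).comp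
      (tendsto_natCast_atTop_atTop (R := ℝ))
    refine h.congr fun N => ?_
    simp only [Function.comp_apply, Real.rpow_one]
    congr 2
    ring
  rw [mul_zero] at hexp
  have hev := hexp.eventually (gt_mem_nhds (half_pos hε))
  obtain ⟨N₀, hN₀⟩ := eventually_atTop.mp hev
  refine ⟨N₀ + 1, fun N hN => ?_⟩
  have hNne : N ≠ 0 := by omega
  have hNR : (0 : ℝ) < N := by exact_mod_cast Nat.pos_of_ne_zero hNne
  rw [Real.dist_eq, sub_zero, abs_of_nonneg (mul_nonneg hNR.le (integral_nonneg fun _ => sq_nonneg _))]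
  have hint : ∫ data, (Φ (freq data) - Φ prob - L (freq data - prob)) ^ 2 ∂(dataLaw prob N) ≤
      c * (η ^ 2 * (1 / N) + C' ^ 2 * (2 * Real.exp (-(2 * N * δ ^ 2)))) := by
    refine (integral_mono Integrable.of_finite Integrable.of_finite (hpt N)).trans ?_
    rw [integral_finsetSum _ (fun _ _ => Integrable.of_finite)]
    have : ∀ x, ∫ data, (∑ b, (η ^ 2 * (freq data x b - prob x b) ^ 2 +
          C' ^ 2 * Set.indicator {data : K × Fin N → Bits n | δ ≤ |freq data x b - prob x b|}
            (fun _ => (1 : ℝ)) data)) ∂(dataLaw prob N) ≤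
        ∑ b : Bits n, (η ^ 2 * (1 / N) + C' ^ 2 * (2 * Real.exp (-(2 * N * δ ^ 2)))) := by
      intro x
      rw [integral_finsetSum _ (fun _ _ => Integrable.of_finite)]
      refine Finset.sum_le_sum fun b _ => ?_
      rw [integral_add Integrable.of_finite Integrable.of_finite, integral_const_mul,
        integral_const_mul, integral_indicator_const _ (MeasurableSet.of_discrete), smul_eq_mul,
        mul_one]
      have i1 := integral_freq_sub_sq_le h0 h1 hNne x b
      have i2 := measureReal_freq_sub_ge_le h0 h1 hNne hδ x b
      gcongr
    refine (Finset.sum_le_sum fun x _ => this x).trans (le_of_eq ?_)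
    simp only [Finset.sum_const, Finset.card_univ, nsmul_eq_mul, hc]
    ring
  have h5 := mul_le_mul_of_nonneg_left hint hNR.le
  have h6 : (N : ℝ) * (c * (η ^ 2 * (1 / N) + C' ^ 2 * (2 * Real.exp (-(2 * N * δ ^ 2))))) =
      η ^ 2 * c + C' ^ 2 * c * 2 * (N * Real.exp (-(2 * N * δ ^ 2))) := by
    field_simp
  have h7 := hN₀ N (by omega)
  linarith

/-- The delta method for variances: the variance of a bounded function `Φ` of the empirical
frequencies of `N` shots is asymptotic to that of its linearization at the true probabilities. -/
theorem tendsto_mul_variance_freq [DecidableEq K] {prob : K → Bits n → ℝ}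
    (h0 : ∀ x b, 0 ≤ prob x b) (h1 : ∀ x, ∑ b, prob x b = 1)
    {Φ : (K → Bits n → ℝ) → ℝ} {C : ℝ} (hC : ∀ F, |Φ F| ≤ C)
    {L : (K → Bits n → ℝ) →L[ℝ] ℝ} (hL : HasFDerivAt Φ L prob) :
    Tendsto (fun N : ℕ => (N : ℝ) * Var[fun data => Φ (freq data); dataLaw prob N]) atTop
      (nhds (∑ x, outcomeVar (prob x) fun b => L (Pi.single x (Pi.single b 1)))) := by
  have hP : ∀ N, IsProbabilityMeasure (dataLaw prob N) := by
    intro N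
    have : ∀ y : K × Fin N, IsProbabilityMeasure (lawOf (prob y.1)) :=
      fun y => isProbabilityMeasure_lawOf (h0 _) (h1 _)
    unfold dataLaw; infer_instance
  set V := ∑ x, outcomeVar (prob x) fun b => L (Pi.single x (Pi.single b 1)) with hV
  set ρ : ℕ → ℝ := fun N => (N : ℝ) * ∫ data, (Φ (freq data) - Φ prob -
      L (freq data - prob)) ^ 2 ∂(dataLaw prob N)
  have hρ : Tendsto ρ atTop (nhds 0) := tendsto_mul_integral_remainder h0 h1 hC hL
  have hρ0 : ∀ N, 0 ≤ ρ N := fun N =>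
    mul_nonneg (Nat.cast_nonneg _) (integral_nonneg fun _ => sq_nonneg _)
  -- with `t = √ρ`, both errors in `variance_add_le` vanish; the second summand keeps `t` positive
  set t : ℕ → ℝ := fun N => Real.sqrt (ρ N) + 1 / ((N : ℝ) + 1)
  have ht0 : ∀ N, 0 < t N := fun N => by positivity
  have ht : Tendsto t atTop (nhds 0) := by
    have h := (Real.continuous_sqrt.tendsto 0).comp hρ
    have h' := h.add tendsto_one_div_add_atTop_nhds_zero_nat
    simpa [t, Function.comp_def] using h'
  have hρt : ∀ N, (1 + 1 / t N) * ρ N ≤ ρ N + Real.sqrt (ρ N) := by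
    intro N
    have : ρ N / t N ≤ Real.sqrt (ρ N) := by
      rw [div_le_iff₀ (ht0 N)]
      have h2 : Real.sqrt (ρ N) * Real.sqrt (ρ N) = ρ N := Real.mul_self_sqrt (hρ0 N)
      have h3 : Real.sqrt (ρ N) ≤ t N := by simp only [t]; linarith [show 0 < 1 / ((N : ℝ) + 1) by positivity]
      nlinarith [Real.sqrt_nonneg (ρ N)]
    have e : (1 + 1 / t N) * ρ N = ρ N + ρ N / t N := by ring
    linarith
  set y : ℕ → ℝ := fun N => (N : ℝ) * Var[fun data => Φ (freq data); dataLaw prob N]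
  have hlin : ∀ N : ℕ, N ≠ 0 → (N : ℝ) * Var[fun data => L (freq data); dataLaw prob N] = V := by
    intro N hN
    have : (N : ℝ) ≠ 0 := by exact_mod_cast hN
    have e : (fun data : K × Fin N → Bits n => L (freq data)) = fun data =>
        ∑ x, ∑ b, L (Pi.single x (Pi.single b 1)) * freq data x b :=
      funext fun data => clm_apply_eq_sum L _
    rw [e, variance_sum_mul_freq h0 h1 hN, ← mul_assoc, mul_one_div_cancel this, one_mul]
  have hupper : ∀ N : ℕ, N ≠ 0 → y N ≤ (1 + t N) * V + (ρ N + Real.sqrt (ρ N)) := by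
    intro N hN
    have h := variance_add_le (dataLaw prob N) (fun data => L (freq data) + (Φ prob - L prob))
      (fun data => Φ (freq data) - Φ prob - L (freq data - prob)) (ht0 N)
    have e : ((fun data => L (freq data) + (Φ prob - L prob)) +
        (fun data => Φ (freq data) - Φ prob - L (freq data - prob)) :
        (K × Fin N → Bits n) → ℝ) = fun data => Φ (freq data) := by
      ext data
      simp only [Pi.add_apply, map_sub]
      ring
    rw [e, variance_add_const AEStronglyMeasurable.of_discrete] at h
    have h' := mul_le_mul_of_nonneg_left h (Nat.cast_nonneg (α := ℝ) N)
    have h2 := hρt N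
    have h3 := hlin N hN
    have e2 : (N : ℝ) * ((1 + t N) * Var[fun data => L (freq data); dataLaw prob N] +
        (1 + 1 / t N) * ∫ data, (Φ (freq data) - Φ prob - L (freq data - prob)) ^ 2
          ∂(dataLaw prob N)) = (1 + t N) * V + (1 + 1 / t N) * ρ N := by
      rw [← h3]; simp only [ρ]; ring
    rw [e2] at h'
    exact h'.trans (by linarith)
  have hlower : ∀ N : ℕ, N ≠ 0 → (V - (ρ N + Real.sqrt (ρ N))) / (1 + t N) ≤ y N := by
    intro N hN
    have h := variance_add_le (dataLaw prob N) (fun data => Φ (freq data) + (L prob - Φ prob))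
      (fun data => -(Φ (freq data) - Φ prob - L (freq data - prob))) (ht0 N)
    have e : ((fun data => Φ (freq data) + (L prob - Φ prob)) +
        (fun data => -(Φ (freq data) - Φ prob - L (freq data - prob))) :
        (K × Fin N → Bits n) → ℝ) = fun data => L (freq data) := by
      ext data
      simp only [Pi.add_apply, map_sub]
      ring
    rw [e, variance_add_const AEStronglyMeasurable.of_discrete] at h
    simp only [neg_sq] at h
    have h' := mul_le_mul_of_nonneg_left h (Nat.cast_nonneg (α := ℝ) N)
    rw [hlin N hN] at h'
    have h2 := hρt N
    have e2 : (N : ℝ) * ((1 + t N) * Var[fun data => Φ (freq data); dataLaw prob N] +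
        (1 + 1 / t N) * ∫ data, (Φ (freq data) - Φ prob - L (freq data - prob)) ^ 2
          ∂(dataLaw prob N)) = (1 + t N) * y N + (1 + 1 / t N) * ρ N := by
      simp only [ρ, y]; ring
    rw [e2] at h'
    rw [div_le_iff₀ (by linarith [ht0 N])]
    linarith
  have hsq : Tendsto (fun N => Real.sqrt (ρ N)) atTop (nhds 0) := by
    simpa [Function.comp_def] using (Real.continuous_sqrt.tendsto 0).comp hρ
  have hu : Tendsto (fun N => (1 + t N) * V + (ρ N + Real.sqrt (ρ N))) atTop (nhds V) := by
    simpa using ((ht.const_add 1).mul_const V).add (hρ.add hsq)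
  have hl : Tendsto (fun N => (V - (ρ N + Real.sqrt (ρ N))) / (1 + t N)) atTop (nhds V) := by
    have h := ((hρ.add hsq).const_sub V).div (ht.const_add 1) (by norm_num)
    simpa [Pi.div_def] using h
  refine tendsto_of_tendsto_of_tendsto_of_le_of_le' hl hu ?_ ?_
  · filter_upwards [eventually_ne_atTop 0] with N hN using hlower N hN
  · filter_upwards [eventually_ne_atTop 0] with N hN using hupper N hN

/-! ### The inverse of the map from splittings to gate angles -/

/-- The splitting angle is bounded everywhere, which the delta method requires, because `w ≤ π / 2`
on its branch and `w ≤ (π / 2) sin w` there. -/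
lemma abs_splittingAngle_le (θ ζ : ℝ) : |splittingAngle θ ζ| ≤ Real.pi / 2 := by
  unfold splittingAngle
  set w := Real.arccos |Real.cos θ * Real.cos ζ| with hw
  have hw0 : 0 ≤ w := Real.arccos_nonneg _
  have hw1 : w ≤ Real.pi / 2 := Real.arccos_le_pi_div_two.mpr (abs_nonneg _)
  have h1 : |w / Real.sin w| ≤ Real.pi / 2 := by
    have hs : 0 ≤ Real.sin w := Real.sin_nonneg_of_nonneg_of_le_pi hw0 (by linarith [Real.pi_pos])
    rw [abs_of_nonneg (by positivity)]
    rcases hs.eq_or_lt with h | h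
    · rw [← h, div_zero]; positivity
    · rw [div_le_iff₀ h]
      have := Real.mul_le_sin hw0 hw1
      have h2 : Real.pi / 2 * (2 / Real.pi * w) = w := by
        field_simp
      calc w = Real.pi / 2 * (2 / Real.pi * w) := h2.symm
        _ ≤ _ := by gcongr
  have h2 : |(|Real.cos θ|) * Real.sin ζ| ≤ 1 := by
    rw [abs_mul, abs_abs]
    exact mul_le_one₀ (Real.abs_cos_le_one θ) (abs_nonneg _) (Real.abs_sin_le_one ζ)
  calc _ = |w / Real.sin w| * |(|Real.cos θ|) * Real.sin ζ| := abs_mul _ _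
    _ ≤ Real.pi / 2 * 1 := by gcongr
    _ = _ := mul_one _

/-- Bounds for `w / sin w` and for its derivative with respect to `-cos w`. -/
lemma sin_sub_mul_cos_bounds {w : ℝ} (h0 : 0 < w) (h1 : w ≤ 1) :
    0 ≤ Real.sin w - w * Real.cos w ∧ Real.sin w - w * Real.cos w ≤ 4 * Real.sin w ^ 3 ∧
      w ≤ 2 * Real.sin w := by
  have hs : w / 2 ≤ Real.sin w := by
    have := Real.sin_gt_sub_cube h0
    nlinarith [mul_pos h0 h0, mul_pos h0 (mul_pos h0 h0)]
  have hc := Real.one_sub_sq_div_two_le_cos (x := w)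
  have hs1 := Real.sin_lt h0
  refine ⟨?_, ?_, by linarith⟩
  · have ht : w < Real.tan w := Real.lt_tan h0 (by linarith [Real.pi_gt_three])
    have hcos : 0 < Real.cos w := Real.cos_pos_of_mem_Ioo
      ⟨by linarith [Real.pi_gt_three], by linarith [Real.pi_gt_three]⟩
    rw [Real.tan_eq_sin_div_cos, lt_div_iff₀ hcos] at ht
    linarith
  · have h3 : (w / 2) ^ 3 ≤ Real.sin w ^ 3 := by gcongr
    nlinarith

set_option maxHeartbeats 800000 in
/-- Near the origin the splitting angle depends on `ζ` with slope close to `1`, and its sensitivity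
to `θ` is of first order in `θ`. The line `θ = 0` is excluded because the arccosine is not
differentiable at `1`. -/
lemma exists_hasFDerivAt_splittingAngle {η : ℝ} (hη : 0 < η) : ∃ δ : ℝ, 0 < δ ∧
    ∀ θ ζ : ℝ, θ ≠ 0 → |θ| ≤ δ → |ζ| ≤ δ → ∃ bθ bζ : ℝ,
      HasFDerivAt (fun x : ℝ × ℝ => splittingAngle x.1 x.2)
        (bθ • ContinuousLinearMap.fst ℝ ℝ ℝ + bζ • ContinuousLinearMap.snd ℝ ℝ ℝ) (θ, ζ) ∧
      |bζ - 1| ≤ η ∧ |bθ| ≤ |θ| := by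
  refine ⟨min (1 / 6) (η / 2), by positivity, fun θ ζ hθ0 hθ hζ => ?_⟩
  obtain ⟨hθ1, hθ2⟩ := le_min_iff.mp hθ
  obtain ⟨hζ1, hζ2⟩ := le_min_iff.mp hζ
  have hcpos : ∀ x : ℝ, |x| ≤ 1 / 6 → 35 / 36 ≤ Real.cos x := by
    intro x hx
    have := Real.one_sub_sq_div_two_le_cos (x := x)
    have h2 : x ^ 2 ≤ (1 / 6) ^ 2 := sq_le_sq' (abs_le.mp hx).1 (abs_le.mp hx).2
    linarith
  have hcθ := hcpos θ hθ1
  have hcζ := hcpos ζ hζ1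
  have hcθ1 : Real.cos θ < 1 := by
    refine lt_of_le_of_ne (Real.cos_le_one θ) fun h => hθ0 ?_
    have hpi := Real.pi_gt_three
    exact (Real.cos_eq_one_iff_of_lt_of_lt (by linarith [abs_le.mp hθ1])
      (by linarith [abs_le.mp hθ1])).mp h
  set x := Real.cos θ * Real.cos ζ with hx
  have hx0 : 0.9 < x := by rw [hx]; nlinarith
  have hx1 : x < 1 := by
    have := Real.cos_le_one ζ
    rw [hx]; nlinarith
  set w := Real.arccos x with hw
  have hw0 : 0 < w := Real.arccos_pos.mpr hx1
  have hcosw : Real.cos w = x := Real.cos_arccos (by linarith) hx1.le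
  have hsinw : Real.sin w = Real.sqrt (1 - x ^ 2) := Real.sin_arccos x
  have hw1 : w ≤ 1 := by
    have : Real.arccos (Real.cos 1) = 1 :=
      Real.arccos_cos zero_le_one (by linarith [Real.pi_gt_three])
    rw [← this]
    exact Real.arccos_le_arccos (by linarith [Real.cos_one_le])
  have hsin0 : 0 < Real.sin w := Real.sin_pos_of_pos_of_lt_pi hw0 (by linarith [Real.pi_gt_three])
  obtain ⟨hb0, hb1, hb2⟩ := sin_sub_mul_cos_bounds hw0 hw1
  set ψ := (Real.sin w - w * Real.cos w) / Real.sin w ^ 3 with hψ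
  have hψ0 : 0 ≤ ψ := by positivity
  have hψ4 : ψ ≤ 4 := by rw [hψ, div_le_iff₀ (by positivity)]; exact hb1
  set φ := w / Real.sin w with hφ
  have hφ0 : 0 ≤ φ := by positivity
  have hφ2 : φ ≤ 2 := by rw [hφ, div_le_iff₀ hsin0]; exact hb2
  have hsin2 : Real.sin w ^ 2 ≤ θ ^ 2 + ζ ^ 2 := by
    have h1 : Real.sin w ^ 2 = 1 - x ^ 2 := by rw [← hcosw]; linarith [Real.sin_sq_add_cos_sq w]
    have h2 : Real.sin θ ^ 2 ≤ θ ^ 2 := by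
      exact sq_le_sq.mpr Real.abs_sin_le_abs
    have h3 : Real.sin ζ ^ 2 ≤ ζ ^ 2 := by
      exact sq_le_sq.mpr Real.abs_sin_le_abs
    have h4 := Real.sin_sq_add_cos_sq θ
    have h5 := Real.sin_sq_add_cos_sq ζ
    have h6 : 1 - x ^ 2 = Real.sin θ ^ 2 + Real.cos θ ^ 2 * Real.sin ζ ^ 2 := by
      rw [hx, mul_pow, Real.cos_sq' ζ]; linear_combination (-1 : ℝ) * h4
    have h7 : Real.cos θ ^ 2 ≤ 1 := Real.cos_sq_le_one θ
    nlinarith [sq_nonneg (Real.sin ζ)]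
  -- the function `w ↦ w / sin w` composed with the arccosine
  have hφd : HasDerivAt (fun y => Real.arccos y / Real.sin (Real.arccos y)) (-ψ) x := by
    have ha := Real.hasDerivAt_arccos (x := x) (by linarith) hx1.ne
    have hs := (Real.hasDerivAt_sin w).comp x ha
    have := ha.div hs hsin0.ne'
    refine this.congr_deriv ?_
    rw [← hsinw, hψ]
    simp only [Function.comp_apply, ← hw]
    field_simp
    ring
  have hev : (fun y : ℝ × ℝ => splittingAngle y.1 y.2) =ᶠ[nhds (θ, ζ)] fun y =>
      Real.arccos (Real.cos y.1 * Real.cos y.2) /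
        Real.sin (Real.arccos (Real.cos y.1 * Real.cos y.2)) * (Real.cos y.1 * Real.sin y.2) := by
    have c1 : Tendsto (fun y : ℝ × ℝ => Real.cos y.1) (nhds (θ, ζ)) (nhds (Real.cos θ)) :=
      (Real.continuous_cos.comp continuous_fst).tendsto (θ, ζ)
    have c2 : Tendsto (fun y : ℝ × ℝ => Real.cos y.2) (nhds (θ, ζ)) (nhds (Real.cos ζ)) :=
      (Real.continuous_cos.comp continuous_snd).tendsto (θ, ζ)
    filter_upwards [c1.eventually (lt_mem_nhds (show 0 < Real.cos θ by linarith)),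
      c2.eventually (lt_mem_nhds (show 0 < Real.cos ζ by linarith))] with y h1 h2
    simp only [splittingAngle, abs_of_pos (mul_pos h1 h2), abs_of_pos h1]
  have h1 : HasFDerivAt (fun y : ℝ × ℝ => y.1) (ContinuousLinearMap.fst ℝ ℝ ℝ) (θ, ζ) :=
    hasFDerivAt_fst
  have h2 : HasFDerivAt (fun y : ℝ × ℝ => y.2) (ContinuousLinearMap.snd ℝ ℝ ℝ) (θ, ζ) :=
    hasFDerivAt_snd
  have hprod := h1.cos.mul h2.cos
  have hcomp := hφd.comp_hasFDerivAt (θ, ζ) hprod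
  have hfull := (hcomp.mul (h1.cos.mul h2.sin)).congr_of_eventuallyEq hev
  refine ⟨ψ * Real.sin θ * Real.cos ζ * Real.cos θ * Real.sin ζ - φ * Real.sin θ * Real.sin ζ,
    ψ * (Real.cos θ * Real.sin ζ) ^ 2 + φ * x, ?_, ?_, ?_⟩
  · refine hfull.congr_fderiv ?_
    ext
    · simp [← hx, ← hw, ← hφ]
      ring
    · simp [← hx, ← hw, ← hφ]
      ring
  · have e : φ * x - 1 = -((Real.sin w - w * Real.cos w) / Real.sin w) := by
      rw [hφ, ← hcosw]; field_simp; ring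
    have e2 : (Real.sin w - w * Real.cos w) / Real.sin w = ψ * Real.sin w ^ 2 := by
      rw [hψ]; field_simp
    have e3 : ψ * (Real.cos θ * Real.sin ζ) ^ 2 + φ * x - 1 =
        ψ * (Real.cos θ * Real.sin ζ) ^ 2 - ψ * Real.sin w ^ 2 := by
      rw [← e2]; linarith
    have h3 : (Real.cos θ * Real.sin ζ) ^ 2 ≤ ζ ^ 2 := by
      have h3 : Real.sin ζ ^ 2 ≤ ζ ^ 2 := by
        exact sq_le_sq.mpr Real.abs_sin_le_abs
      rw [mul_pow]
      nlinarith [Real.cos_sq_le_one θ, sq_nonneg (Real.sin ζ)]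
    have hζsq : ζ ^ 2 ≤ η / 12 := by
      rw [← sq_abs]; nlinarith [abs_nonneg ζ]
    have hθsq : θ ^ 2 ≤ η / 12 := by
      rw [← sq_abs]; nlinarith [abs_nonneg θ]
    have k1 : ψ * (Real.cos θ * Real.sin ζ) ^ 2 ≤ 4 * (η / 12) :=
      mul_le_mul hψ4 (h3.trans hζsq) (sq_nonneg _) (by norm_num)
    have k2 : ψ * Real.sin w ^ 2 ≤ 4 * (η / 12 + η / 12) :=
      mul_le_mul hψ4 (by linarith) (sq_nonneg _) (by norm_num)
    have k3 : 0 ≤ ψ * (Real.cos θ * Real.sin ζ) ^ 2 := by positivity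
    have k4 : 0 ≤ ψ * Real.sin w ^ 2 := by positivity
    rw [e3, abs_le]
    constructor <;> linarith
  · have e : ψ * Real.sin θ * Real.cos ζ * Real.cos θ * Real.sin ζ - φ * Real.sin θ * Real.sin ζ =
        Real.sin θ * Real.sin ζ * (ψ * x - φ) := by rw [hx]; ring
    have h3 : |ψ * x - φ| ≤ 4 := by
      have k1 : ψ * x ≤ 4 * 1 := mul_le_mul hψ4 hx1.le (by linarith) (by norm_num)
      have k2 : 0 ≤ ψ * x := mul_nonneg hψ0 (by linarith)
      rw [abs_le]; constructor <;> linarith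
    rw [e, abs_mul, abs_mul]
    have ha : |Real.sin θ| ≤ |θ| := Real.abs_sin_le_abs
    have hb : |Real.sin ζ| ≤ 1 / 6 := Real.abs_sin_le_abs.trans hζ1
    calc _ ≤ |θ| * (1 / 6) * 4 :=
          mul_le_mul (mul_le_mul ha hb (abs_nonneg _) (abs_nonneg _)) h3 (abs_nonneg _)
            (by positivity)
      _ ≤ |θ| := by linarith [abs_nonneg θ]

/-! ### Fourier coefficients of the reconstruction function -/

mutual
/-- Coefficients of the polynomial `p_m` in `W = exp(2i(ω+ζ))` that describes the diagonal entry of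
the `m`-fold cycle; `c` and `s` stand for the cosine and the sine of the swap angle. -/
def diagCoeff (c s : ℝ) : ℕ → ℕ → ℝ
  | 0, 0 => 1
  | 0, _ + 1 => 0
  | m + 1, 0 => c * diagCoeff c s m 0
  | m + 1, k + 1 => c * diagCoeff c s m (k + 1) - s * offCoeff c s m k
/-- Coefficients of the polynomial `r_m` in `W` that describes the off-diagonal entry of the
`m`-fold cycle. -/
def offCoeff (c s : ℝ) : ℕ → ℕ → ℝ
  | 0, _ => 0
  | m + 1, 0 => s * diagCoeff c s m 0
  | m + 1, k + 1 => s * diagCoeff c s m (k + 1) + c * offCoeff c s m k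
end

@[simp] lemma diagCoeff_zero_zero (c s : ℝ) : diagCoeff c s 0 0 = 1 := by rw [diagCoeff]
@[simp] lemma diagCoeff_zero_succ (c s : ℝ) (k : ℕ) : diagCoeff c s 0 (k + 1) = 0 := by
  rw [diagCoeff]
lemma diagCoeff_succ_zero (c s : ℝ) (m : ℕ) :
    diagCoeff c s (m + 1) 0 = c * diagCoeff c s m 0 := by rw [diagCoeff]
lemma diagCoeff_succ_succ (c s : ℝ) (m k : ℕ) : diagCoeff c s (m + 1) (k + 1) =
    c * diagCoeff c s m (k + 1) - s * offCoeff c s m k := by rw [diagCoeff]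
@[simp] lemma offCoeff_zero (c s : ℝ) (k : ℕ) : offCoeff c s 0 k = 0 := by rw [offCoeff]
lemma offCoeff_succ_zero (c s : ℝ) (m : ℕ) :
    offCoeff c s (m + 1) 0 = s * diagCoeff c s m 0 := by rw [offCoeff]
lemma offCoeff_succ_succ (c s : ℝ) (m k : ℕ) : offCoeff c s (m + 1) (k + 1) =
    s * diagCoeff c s m (k + 1) + c * offCoeff c s m k := by rw [offCoeff]

lemma diagCoeff_zero_right (c s : ℝ) (m : ℕ) : diagCoeff c s m 0 = c ^ m := by
  induction m with
  | zero => simp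
  | succ m ih => rw [diagCoeff_succ_zero, ih]; ring

/-- The diagonal polynomial has degree below `m` and the off-diagonal one too, except that
`p_0 = 1`. -/
lemma coeff_eq_zero (c s : ℝ) (m : ℕ) : (∀ k, m ≤ k → 1 ≤ k → diagCoeff c s m k = 0) ∧
    ∀ k, m ≤ k → offCoeff c s m k = 0 := by
  induction m with
  | zero =>
    refine ⟨fun k _ hk => ?_, fun k _ => by simp⟩
    obtain ⟨k, rfl⟩ := Nat.exists_eq_add_of_le' hk
    simp
  | succ m ih =>
    refine ⟨fun k hk _ => ?_, fun k hk => ?_⟩ <;>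
      obtain ⟨k, rfl⟩ := Nat.exists_eq_add_of_le' (show 1 ≤ k by omega)
    · rw [diagCoeff_succ_succ, ih.1 _ (by omega) (by omega), ih.2 _ (by omega)]; ring
    · rw [offCoeff_succ_succ, ih.1 _ (by omega) (by omega), ih.2 _ (by omega)]; ring

lemma diagCoeff_eq_zero (c s : ℝ) {m k : ℕ} (h : m ≤ k) (hk : 1 ≤ k) : diagCoeff c s m k = 0 :=
  (coeff_eq_zero c s m).1 k h hk

lemma offCoeff_eq_zero (c s : ℝ) {m k : ℕ} (h : m ≤ k) : offCoeff c s m k = 0 :=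
  (coeff_eq_zero c s m).2 k h

/-- The last off-diagonal coefficient has a closed form. -/
lemma offCoeff_succ_self (c s : ℝ) (m : ℕ) : offCoeff c s (m + 1) m = s * c ^ m := by
  induction m with
  | zero => rw [offCoeff_succ_zero]; simp
  | succ m ih =>
    rw [offCoeff_succ_succ, diagCoeff_eq_zero c s (by omega) (by omega), ih]; ring

lemma differentiable_coeff (m : ℕ) :
    (∀ k, Differentiable ℝ fun θ => diagCoeff (Real.cos θ) (Real.sin θ) m k) ∧
    ∀ k, Differentiable ℝ fun θ => offCoeff (Real.cos θ) (Real.sin θ) m k := by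
  induction m with
  | zero =>
    refine ⟨fun k => ?_, fun k => by simp⟩
    cases k <;> simp
  | succ m ih =>
    refine ⟨fun k => ?_, fun k => ?_⟩
    · cases k with
      | zero =>
        simp only [diagCoeff_succ_zero]
        exact Real.differentiable_cos.mul (ih.1 0)
      | succ k =>
        simp only [diagCoeff_succ_succ]
        exact (Real.differentiable_cos.mul (ih.1 _)).sub (Real.differentiable_sin.mul (ih.2 _))
    · cases k with
      | zero =>
        simp only [offCoeff_succ_zero]
        exact Real.differentiable_sin.mul (ih.1 0)
      | succ k =>
        simp only [offCoeff_succ_succ]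
        exact (Real.differentiable_sin.mul (ih.1 _)).add (Real.differentiable_cos.mul (ih.2 _))

lemma one_sub_cos_le (θ : ℝ) : |Real.cos θ - 1| ≤ θ ^ 2 / 2 := by
  rw [abs_le]
  constructor <;> linarith [Real.one_sub_sq_div_two_le_cos (x := θ), Real.cos_le_one θ, sq_nonneg θ]

lemma abs_cos_pow_sub_one_le (θ : ℝ) (m : ℕ) : |Real.cos θ ^ m - 1| ≤ m * (θ ^ 2 / 2) := by
  induction m with
  | zero => simp
  | succ m ih =>
    have e : Real.cos θ ^ (m + 1) - 1 =
      Real.cos θ * (Real.cos θ ^ m - 1) + (Real.cos θ - 1) := by ring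
    rw [e]
    calc _ ≤ |Real.cos θ| * |Real.cos θ ^ m - 1| + |Real.cos θ - 1| := by
          rw [← abs_mul]; exact abs_add_le _ _
      _ ≤ 1 * (m * (θ ^ 2 / 2)) + θ ^ 2 / 2 := by
          gcongr
          · exact Real.abs_cos_le_one θ
          · exact one_sub_cos_le θ
      _ = _ := by push_cast; ring

lemma abs_sin_sub_le (θ : ℝ) (hθ : |θ| ≤ 1) : |Real.sin θ - θ| ≤ |θ| ^ 3 := by
  rcases eq_or_ne θ 0 with rfl | h
  · simp
  have key : ∀ x : ℝ, 0 < x → x ≤ 1 → |Real.sin x - x| ≤ x ^ 3 := by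
    intro x h0 h1
    rw [abs_le]
    constructor <;> nlinarith [Real.sin_gt_sub_cube h0, Real.sin_lt h0, pow_pos h0 3]
  rcases lt_or_gt_of_ne h with h | h
  · have := key (-θ) (by linarith) (by rwa [abs_of_neg h] at hθ)
    rw [Real.sin_neg] at this
    rw [abs_of_neg h]
    rw [show Real.sin θ - θ = -(-Real.sin θ - -θ) by ring, abs_neg]
    exact this
  · rw [abs_of_pos h]
    rw [abs_of_pos h] at hθ
    exact key θ h hθ

/-- For `m |θ|` small, the diagonal polynomial is close to `1` and the off-diagonal one to
`θ ∑_{k<m} W^k`, coefficient by coefficient. -/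
lemma abs_coeff_le {θ : ℝ} {m : ℕ} (h : (m : ℝ) * |θ| ≤ 1 / 2) :
    (∀ k, 1 ≤ k → |diagCoeff (Real.cos θ) (Real.sin θ) m k| ≤ 2 * m * |θ| ^ 2) ∧
    (∀ k, k < m → |offCoeff (Real.cos θ) (Real.sin θ) m k - θ| ≤ 2 * m ^ 2 * |θ| ^ 3) ∧
    ∀ k, |offCoeff (Real.cos θ) (Real.sin θ) m k| ≤ 2 * |θ| := by
  have third : ∀ m : ℕ, (m : ℝ) * |θ| ≤ 1 / 2 →
      (∀ k, k < m → |offCoeff (Real.cos θ) (Real.sin θ) m k - θ| ≤ 2 * m ^ 2 * |θ| ^ 3) →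
      ∀ k, |offCoeff (Real.cos θ) (Real.sin θ) m k| ≤ 2 * |θ| := by
    intro m hm h2 k
    rcases lt_or_ge k m with hk | hk
    · have h3 := h2 k hk
      have h4 : 2 * (m : ℝ) ^ 2 * |θ| ^ 3 = 2 * (m * |θ|) ^ 2 * |θ| := by ring
      have h5 : ((m : ℝ) * |θ|) ^ 2 ≤ (1 / 2) ^ 2 := by gcongr
      have h6 : |offCoeff (Real.cos θ) (Real.sin θ) m k| ≤
          |offCoeff (Real.cos θ) (Real.sin θ) m k - θ| + |θ| := by
        have := abs_add_le (offCoeff (Real.cos θ) (Real.sin θ) m k - θ) θ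
        simpa using this
      nlinarith [abs_nonneg θ]
    · rw [offCoeff_eq_zero _ _ hk, abs_zero]; positivity
  induction m with
  | zero =>
    refine ⟨fun k hk => ?_, fun k hk => absurd hk (by omega), fun k => by simp⟩
    rw [diagCoeff_eq_zero _ _ (by omega) hk]; simp
  | succ m ih =>
    set τ := |θ| with hτ
    have hτ0 : 0 ≤ τ := abs_nonneg θ
    push_cast at h
    have hm : (m : ℝ) * τ ≤ 1 / 2 := by nlinarith
    have hτ1 : τ ≤ 1 := by nlinarith [Nat.cast_nonneg (α := ℝ) m]
    have hmn : (0 : ℝ) ≤ m := Nat.cast_nonneg m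
    obtain ⟨ih1, ih2, ih3⟩ := ih hm
    have hs : |Real.sin θ| ≤ τ := Real.abs_sin_le_abs
    have hc : |Real.cos θ| ≤ 1 := Real.abs_cos_le_one θ
    have hθ2 : θ ^ 2 = τ ^ 2 := (sq_abs θ).symm
    have a2 : ∀ k, k < m + 1 → |offCoeff (Real.cos θ) (Real.sin θ) (m + 1) k - θ| ≤
        2 * (m + 1 : ℕ) ^ 2 * τ ^ 3 := by
      intro k hk
      cases k with
      | zero =>
        rw [offCoeff_succ_zero, diagCoeff_zero_right]
        have e : Real.sin θ * Real.cos θ ^ m - θ =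
          Real.sin θ * (Real.cos θ ^ m - 1) + (Real.sin θ - θ) := by ring
        rw [e]
        calc _ ≤ |Real.sin θ| * |Real.cos θ ^ m - 1| + |Real.sin θ - θ| := by
              rw [← abs_mul]; exact abs_add_le _ _
          _ ≤ τ * (m * (τ ^ 2 / 2)) + τ ^ 3 := by
              rw [← hθ2]
              gcongr
              · exact abs_cos_pow_sub_one_le θ m
              · exact abs_sin_sub_le θ hτ1
          _ ≤ _ := by
              push_cast
              have : 0 ≤ τ ^ 3 := by positivity
              nlinarith [mul_nonneg hmn this, mul_nonneg (mul_nonneg hmn hmn) this]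
      | succ k =>
        rw [offCoeff_succ_succ]
        have e : Real.sin θ * diagCoeff (Real.cos θ) (Real.sin θ) m (k + 1) +
            Real.cos θ * offCoeff (Real.cos θ) (Real.sin θ) m k - θ =
            Real.sin θ * diagCoeff (Real.cos θ) (Real.sin θ) m (k + 1) +
            (Real.cos θ - 1) * offCoeff (Real.cos θ) (Real.sin θ) m k +
            (offCoeff (Real.cos θ) (Real.sin θ) m k - θ) := by ring
        rw [e]
        calc _ ≤ |Real.sin θ| * |diagCoeff (Real.cos θ) (Real.sin θ) m (k + 1)| +
            |Real.cos θ - 1| * |offCoeff (Real.cos θ) (Real.sin θ) m k| +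
            |offCoeff (Real.cos θ) (Real.sin θ) m k - θ| := by
              rw [← abs_mul, ← abs_mul]; exact abs_add_three _ _ _
          _ ≤ τ * (2 * m * τ ^ 2) + τ ^ 2 / 2 * (2 * τ) + 2 * m ^ 2 * τ ^ 3 := by
              rw [← hθ2]
              gcongr
              · rw [hθ2]; exact ih1 _ (by omega)
              · exact one_sub_cos_le θ
              · exact ih3 k
              · exact ih2 k (by omega)
          _ ≤ _ := by
              push_cast
              have : 0 ≤ τ ^ 3 := by positivity
              nlinarith [mul_nonneg hmn this]
    refine ⟨fun k hk => ?_, a2, third (m + 1) (by push_cast; exact h) a2⟩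
    obtain ⟨k, rfl⟩ := Nat.exists_eq_add_of_le' hk
    rw [diagCoeff_succ_succ]
    calc _ ≤ |Real.cos θ| * |diagCoeff (Real.cos θ) (Real.sin θ) m (k + 1)| +
          |Real.sin θ| * |offCoeff (Real.cos θ) (Real.sin θ) m k| := by
            rw [← abs_mul, ← abs_mul]; exact abs_sub _ _
      _ ≤ 1 * (2 * m * τ ^ 2) + τ * (2 * τ) := by
            gcongr
            · exact ih1 _ (by omega)
            · exact ih3 k
      _ = _ := by push_cast; ring

/-- The real amplitude of the `m`-th Fourier mode of the reconstruction function. -/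
def amp (d : ℕ) (θ : ℝ) (m : ℤ) : ℝ :=
  ∑ k ∈ Finset.range d, ∑ l ∈ Finset.range d, if (l : ℤ) - k = m then
    diagCoeff (Real.cos θ) (Real.sin θ) d k * offCoeff (Real.cos θ) (Real.sin θ) d l else 0

lemma differentiable_amp (d : ℕ) (m : ℤ) : Differentiable ℝ fun θ => amp d θ m := by
  unfold amp
  refine Differentiable.fun_sum fun k _ => Differentiable.fun_sum fun l _ => ?_
  split_ifs
  · exact ((differentiable_coeff d).1 k).mul ((differentiable_coeff d).2 l)
  · exact differentiable_const _

/-- The highest mode has a closed form. -/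
lemma amp_last {d : ℕ} (hd : 1 ≤ d) (θ : ℝ) :
    amp d θ ((d : ℤ) - 1) = Real.sin θ * Real.cos θ ^ (2 * d - 1) := by
  obtain ⟨e, rfl⟩ := Nat.exists_eq_add_of_le' hd
  unfold amp
  rw [Finset.sum_eq_single 0, Finset.sum_eq_single e, if_pos (by push_cast; ring),
    diagCoeff_zero_right, offCoeff_succ_self, show 2 * (e + 1) - 1 = (e + 1) + e by omega]
  · ring
  · intro l hl hle
    rw [if_neg]
    have := Finset.mem_range.mp hl
    push_cast; omega
  · simp
  · intro k hk hk0
    refine Finset.sum_eq_zero fun l hl => if_neg ?_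
    have := Finset.mem_range.mp hl
    push_cast; omega
  · simp

/-- The reconstruction function has amplitude `θ` on the modes `0 ≤ m < d` and none on the others,
up to a relative error of order `(dθ)²`. -/
lemma abs_amp_sub_le {d : ℕ} {θ : ℝ} (h : (d : ℝ) * |θ| ≤ 1 / 2) {m : ℤ}
    (hm : m ∈ Finset.Ioo (-(d : ℤ)) d) :
    |amp d θ m - if 0 ≤ m then θ else 0| ≤ 7 * d ^ 2 * |θ| ^ 3 := by
  obtain ⟨h1, h2, h3⟩ := abs_coeff_le h
  obtain ⟨hm1, hm2⟩ := Finset.mem_Ioo.mp hm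
  have hd : 0 < d := by omega
  obtain ⟨e, rfl⟩ := Nat.exists_eq_add_of_le' (show 1 ≤ d from hd)
  set d := e + 1 with hde
  set c := Real.cos θ
  set s := Real.sin θ
  set τ := |θ| with hτ
  have hτ0 : 0 ≤ τ := abs_nonneg θ
  set S : ℕ → ℝ := fun k => ∑ l ∈ Finset.range d, if (l : ℤ) - k = m then
    diagCoeff c s d k * offCoeff c s d l else 0 with hS
  have hdR : (1 : ℝ) ≤ d := by exact_mod_cast hd
  -- every inner sum has at most one nonzero term
  have hone : ∀ k, 1 ≤ k → |S k| ≤ 2 * d * τ ^ 2 * (2 * τ) := by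
    intro k hk
    by_cases hex : ∃ l ∈ Finset.range d, (l : ℤ) - k = m
    · obtain ⟨l, hl, hlk⟩ := hex
      simp only [hS]
      rw [Finset.sum_eq_single_of_mem l hl, if_pos hlk, abs_mul]
      · gcongr
        · exact h1 k hk
        · exact h3 l
      · intro l' _ hne
        exact if_neg (by omega)
    · simp only [hS]
      rw [Finset.sum_eq_zero, abs_zero]
      · positivity
      · intro l hl
        exact if_neg fun hh => hex ⟨l, hl, hh⟩
  -- the constant term `p_0 = cos θ ^ d` of the diagonal polynomial produces the main term
  have hzero : |S 0 - if 0 ≤ m then θ else 0| ≤ 3 * d ^ 2 * τ ^ 3 := by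
    by_cases hm0 : 0 ≤ m
    · obtain ⟨l, rfl⟩ := Int.eq_ofNat_of_zero_le hm0
      have hl : l < d := by omega
      simp only [hS]
      rw [Finset.sum_eq_single_of_mem l (Finset.mem_range.mpr hl), if_pos (by simp), if_pos hm0,
        diagCoeff_zero_right]
      · have e1 : c ^ d * offCoeff c s d l - θ =
            (c ^ d - 1) * offCoeff c s d l + (offCoeff c s d l - θ) := by ring
        rw [e1]
        calc _ ≤ |c ^ d - 1| * |offCoeff c s d l| + |offCoeff c s d l - θ| := by
              rw [← abs_mul]; exact abs_add_le _ _
          _ ≤ d * (τ ^ 2 / 2) * (2 * τ) + 2 * d ^ 2 * τ ^ 3 := by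
              have := abs_cos_pow_sub_one_le θ d
              rw [← sq_abs θ] at this
              exact add_le_add (mul_le_mul this (h3 l) (abs_nonneg _) (by positivity)) (h2 l hl)
          _ ≤ _ := by
              have : 0 ≤ τ ^ 3 := by positivity
              nlinarith [mul_nonneg (mul_nonneg (show (0 : ℝ) ≤ d by linarith)
                (sub_nonneg.mpr hdR)) this]
      · intro l' _ hne
        exact if_neg (by push_cast; omega)
    · rw [if_neg hm0, sub_zero]
      simp only [hS]
      rw [Finset.sum_eq_zero, abs_zero]
      · positivity
      · intro l _
        exact if_neg (by push_cast; omega)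
  have hsplit : amp d θ m = S 0 + ∑ k ∈ Finset.range e, S (k + 1) := by
    change ∑ k ∈ Finset.range (e + 1), S k = _
    rw [Finset.sum_range_succ']
    ring
  have hrest : |∑ k ∈ Finset.range e, S (k + 1)| ≤ 4 * d ^ 2 * τ ^ 3 := by
    calc _ ≤ ∑ k ∈ Finset.range e, |S (k + 1)| := Finset.abs_sum_le_sum_abs _ _
      _ ≤ ∑ k ∈ Finset.range e, 2 * d * τ ^ 2 * (2 * τ) :=
          Finset.sum_le_sum fun k _ => hone _ (by omega)
      _ = e * (4 * d * τ ^ 3) := by rw [Finset.sum_const, Finset.card_range, nsmul_eq_mul]; ring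
      _ ≤ d * (4 * d * τ ^ 3) := by gcongr; omega
      _ = _ := by ring
  rw [hsplit, show S 0 + ∑ k ∈ Finset.range e, S (k + 1) - (if 0 ≤ m then θ else 0) =
    (S 0 - if 0 ≤ m then θ else 0) + ∑ k ∈ Finset.range e, S (k + 1) by ring]
  calc _ ≤ _ := abs_add_le _ _
    _ ≤ _ := add_le_add hzero hrest
    _ = _ := by ring

/-! ### Discrete Fourier analysis on the sampling grid -/

/-- The Fourier mode `exp(-2imω_j)` on the grid of sampling angles. -/
def mode (d : ℕ) (j : Fin (2 * d - 1)) (m : ℤ) : ℂ :=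
  Complex.exp (-(2 * Complex.I * (m : ℂ) * ((omega d j : ℝ) : ℂ)))

lemma mode_add (d : ℕ) (j : Fin (2 * d - 1)) (m l : ℤ) :
    mode d j (m + l) = mode d j m * mode d j l := by
  simp only [mode, ← Complex.exp_add]
  congr 1
  push_cast
  ring

lemma star_mode (d : ℕ) (j : Fin (2 * d - 1)) (m : ℤ) : star (mode d j m) = mode d j (-m) := by
  have h2 : (starRingEnd ℂ) 2 = 2 := map_ofNat (starRingEnd ℂ) 2
  simp only [mode, RCLike.star_def, ← Complex.exp_conj]
  congr 1
  simp [h2]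

lemma norm_mode (d : ℕ) (j : Fin (2 * d - 1)) (m : ℤ) : ‖mode d j m‖ = 1 := by
  have : mode d j m = Complex.exp (((-(2 * m * omega d j) : ℝ) : ℂ) * Complex.I) := by
    rw [mode]; congr 1; push_cast; ring
  rw [this, Complex.norm_exp_ofReal_mul_I]

lemma cast_two_mul_sub_one {d : ℕ} (hd : 1 ≤ d) : ((2 * d - 1 : ℕ) : ℝ) = 2 * d - 1 := by
  rw [Nat.cast_sub (by omega)]; push_cast; ring

/-- Orthogonality of the modes. Differences of two frequencies in the band are at most `2d - 2` in
absolute value, so the `2d - 1` grid points separate them. -/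
lemma sum_mode {d : ℕ} (hd : 1 ≤ d) {m : ℤ} (hm : |m| < 2 * d - 1) :
    ∑ j, mode d j m = if m = 0 then (2 * (d : ℂ) - 1) else 0 := by
  have hn : ((2 * d - 1 : ℕ) : ℂ) = 2 * (d : ℂ) - 1 := by
    exact_mod_cast congrArg (fun x : ℝ => (x : ℂ)) (cast_two_mul_sub_one hd)
  have hn0 : 2 * (d : ℂ) - 1 ≠ 0 := by
    rw [← hn]; exact_mod_cast (show 2 * d - 1 ≠ 0 by omega)
  split_ifs with h0
  · subst h0
    simp [mode, hn]
  · set x : ℂ := Complex.exp (2 * Real.pi * Complex.I * (((-m : ℤ) : ℂ) / (2 * (d : ℂ) - 1))) with hx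
    have hpow : ∀ j : Fin (2 * d - 1), mode d j m = x ^ (j : ℕ) := by
      intro j
      rw [hx, ← Complex.exp_nat_mul, mode, omega]
      congr 1
      push_cast
      field_simp
    have hx1 : x ≠ 1 := by
      intro h
      rw [hx, Complex.exp_eq_one_iff] at h
      obtain ⟨k, hk⟩ := h
      have hpi : (2 * Real.pi * Complex.I : ℂ) ≠ 0 := Complex.two_pi_I_ne_zero
      have h2 : ((-m : ℤ) : ℂ) / (2 * (d : ℂ) - 1) = k := by
        apply mul_left_cancel₀ hpi
        rw [hk]; ring
      rw [div_eq_iff hn0] at h2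
      have h3 : -m = k * (2 * (d : ℤ) - 1) := by exact_mod_cast h2
      rcases eq_or_ne k 0 with rfl | hk0
      · apply h0; linarith
      · have h4 : |m| = |k| * (2 * (d : ℤ) - 1) := by
          rw [← abs_neg, h3, abs_mul, abs_of_nonneg (show 0 ≤ 2 * (d : ℤ) - 1 by omega)]
        have h5 : 1 ≤ |k| := Int.one_le_abs hk0
        nlinarith [show (0 : ℤ) < 2 * (d : ℤ) - 1 by omega]
    have hxn : x ^ (2 * d - 1) = 1 := by
      rw [hx, ← Complex.exp_nat_mul, hn, Complex.exp_eq_one_iff]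
      exact ⟨-m, by field_simp⟩
    simp_rw [hpow]
    rw [Fin.sum_univ_eq_sum_range (fun j => x ^ j) (2 * d - 1)]
    have := mul_neg_geom_sum x (2 * d - 1)
    rw [hxn, sub_self] at this
    exact (mul_eq_zero.mp this).resolve_left (sub_ne_zero.mpr hx1.symm)

/-- The frequencies that occur in reconstruction functions. -/
abbrev band (d : ℕ) : Finset ℤ := Finset.Ioo (-(d : ℤ)) d

/-- The function on the grid with prescribed Fourier coefficients. -/
def synth (d : ℕ) (b : ℤ → ℂ) (j : Fin (2 * d - 1)) : ℂ := ∑ m ∈ band d, b m * mode d j m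

/-- Parseval's identity on the grid. -/
lemma sum_star_synth_mul {d : ℕ} (hd : 1 ≤ d) (a b : ℤ → ℂ) :
    ∑ j, star (synth d a j) * synth d b j =
      (2 * (d : ℂ) - 1) * ∑ m ∈ band d, star (a m) * b m := by
  have e : ∀ j, star (synth d a j) * synth d b j =
      ∑ l ∈ band d, ∑ m ∈ band d, star (a l) * b m * mode d j (m - l) := by
    intro j
    simp only [synth, star_sum, Finset.sum_mul, Finset.mul_sum, star_mul']
    rw [Finset.sum_comm]
    refine Finset.sum_congr rfl fun l _ => Finset.sum_congr rfl fun m _ => ?_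
    rw [star_mode, sub_eq_add_neg, mode_add]
    ring
  simp_rw [e]
  rw [Finset.sum_comm, Finset.mul_sum]
  refine Finset.sum_congr rfl fun l hl => ?_
  rw [Finset.sum_comm]
  have hl' := Finset.mem_Ioo.mp hl
  have : ∀ m ∈ band d, ∑ j, star (a l) * b m * mode d j (m - l) =
      if m = l then (2 * (d : ℂ) - 1) * (star (a l) * b l) else 0 := by
    intro m hm
    have hm' := Finset.mem_Ioo.mp hm
    rw [← Finset.mul_sum, sum_mode hd (by rw [abs_lt]; constructor <;> omega)]
    by_cases h : m = l
    · subst h; simp; ring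
    · rw [if_neg (sub_ne_zero.mpr h), if_neg h, mul_zero]
  rw [Finset.sum_congr rfl this, Finset.sum_ite_eq' , if_pos hl]

/-- No aliasing occurs: the discrete transform returns the coefficients exactly. -/
lemma fourier_synth {d : ℕ} (b : ℤ → ℂ) {k : ℕ} (hk : k < d) :
    fourier d (synth d b) k = b k := by
  have hd : 1 ≤ d := by omega
  have hn0 : 2 * (d : ℂ) - 1 ≠ 0 := by
    have := cast_two_mul_sub_one hd
    have h2 : ((2 * d - 1 : ℕ) : ℂ) = 2 * (d : ℂ) - 1 := by exact_mod_cast congrArg (fun x : ℝ => (x : ℂ)) this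
    rw [← h2]; exact_mod_cast (show 2 * d - 1 ≠ 0 by omega)
  have hmem : (k : ℤ) ∈ band d := Finset.mem_Ioo.mpr ⟨by omega, by omega⟩
  have h := sum_star_synth_mul hd (Pi.single (k : ℤ) 1) b
  have e1 : ∀ j, synth d (Pi.single (k : ℤ) 1) j = mode d j k := by
    intro j
    rw [synth, Finset.sum_eq_single_of_mem (k : ℤ) hmem]
    · simp
    · intro m _ hm
      simp [hm]
  have e2 : ∑ m ∈ band d, star ((Pi.single (k : ℤ) 1 : ℤ → ℂ) m) * b m = b k := by
    rw [Finset.sum_eq_single_of_mem (k : ℤ) hmem]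
    · simp
    · intro m _ hm
      simp [hm]
  simp_rw [e1, star_mode] at h
  rw [e2] at h
  have e3 : ∀ j : Fin (2 * d - 1), Complex.exp (2 * Complex.I * (k : ℂ) * ((omega d j : ℝ) : ℂ)) =
      mode d j (-k) := by
    intro j
    rw [mode]; congr 1; push_cast; ring
  rw [fourier]
  simp_rw [e3]
  rw [h]
  field_simp

/-! ### Evaluation of the cycle -/

/-- The reconstruction function computed from the exact outcome probabilities. -/
def recon (d : ℕ) (θ ζ χ : ℝ) (j : Fin (2 * d - 1)) : ℂ :=
  ((bellProb d false (omega d j) θ ζ χ - 1 / 2 : ℝ) : ℂ) +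
    Complex.I * ((bellProb d true (omega d j) θ ζ χ - 1 / 2 : ℝ) : ℂ)

/-- Fourier coefficients of the exact reconstruction function. -/
def reconCoeff (d : ℕ) (θ ζ χ : ℝ) (m : ℤ) : ℂ :=
  Complex.I * (amp d θ m : ℂ) * Complex.exp (-(Complex.I * ((2 * (m : ℂ) + 1) * ζ + χ)))

/-- First row of the `m`-fold cycle: a phase times polynomials in `W = exp(2i(ω+ζ))`. With
`P` and `R` for the two polynomials, one more cycle replaces `(P, R)` by
`(cos θ P - sin θ W R, sin θ P + cos θ W R)`. -/
lemma cycle_row (ω θ ζ χ : ℝ) (m : ℕ) :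
    ((zRot ω * gate θ ζ χ) ^ m) 0 0 = Complex.exp (-(Complex.I * (ω + ζ))) ^ m *
      ∑ k ∈ Finset.range (m + 1), (diagCoeff (Real.cos θ) (Real.sin θ) m k : ℂ) *
        Complex.exp (2 * Complex.I * (ω + ζ)) ^ k ∧
    ((zRot ω * gate θ ζ χ) ^ m) 0 1 = -Complex.I * Complex.exp (Complex.I * (χ + ζ)) *
      (Complex.exp (-(Complex.I * (ω + ζ))) ^ m *
      ∑ k ∈ Finset.range (m + 1), (offCoeff (Real.cos θ) (Real.sin θ) m k : ℂ) *
        Complex.exp (2 * Complex.I * (ω + ζ)) ^ k) := by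
  set Z := Complex.exp (-(Complex.I * (ω + ζ))) with hZ
  set W := Complex.exp (2 * Complex.I * (ω + ζ)) with hW
  set u := Complex.exp (Complex.I * (χ + ζ)) with hu
  set u' := Complex.exp (-(Complex.I * (χ + ζ))) with hu'
  have huu : u * u' = 1 := by rw [hu, hu', ← Complex.exp_add]; simp
  have v00 : (zRot ω * gate θ ζ χ) 0 0 = Real.cos θ * Z := by
    simp only [zRot, gate, Matrix.mul_apply, Fin.sum_univ_two, Matrix.of_apply, Matrix.cons_val',
      Matrix.cons_val_zero, Matrix.cons_val_one, Matrix.cons_val_fin_one, zero_mul, add_zero]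
    rw [hZ, mul_left_comm, ← Complex.exp_add]
    congr 2; ring
  have v01 : (zRot ω * gate θ ζ χ) 0 1 = -Complex.I * Real.sin θ * u * Z := by
    simp only [zRot, gate, Matrix.mul_apply, Fin.sum_univ_two, Matrix.of_apply, Matrix.cons_val',
      Matrix.cons_val_zero, Matrix.cons_val_one, Matrix.cons_val_fin_one, zero_mul, add_zero]
    have : u * Z = Complex.exp (-(Complex.I * ω)) * Complex.exp (Complex.I * χ) := by
      rw [hZ, hu, ← Complex.exp_add, ← Complex.exp_add]; congr 1; ring
    linear_combination (Complex.I * Real.sin θ) * this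
  have v10 : (zRot ω * gate θ ζ χ) 1 0 = -Complex.I * Real.sin θ * u' * (W * Z) := by
    simp only [zRot, gate, Matrix.mul_apply, Fin.sum_univ_two, Matrix.of_apply, Matrix.cons_val',
      Matrix.cons_val_zero, Matrix.cons_val_one, Matrix.cons_val_fin_one, zero_mul, zero_add]
    have : u' * (W * Z) = Complex.exp (Complex.I * ω) * Complex.exp (-(Complex.I * χ)) := by
      rw [hZ, hu', hW, ← Complex.exp_add, ← Complex.exp_add, ← Complex.exp_add]; congr 1; ring
    linear_combination (Complex.I * Real.sin θ) * this
  have v11 : (zRot ω * gate θ ζ χ) 1 1 = Real.cos θ * (W * Z) := by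
    simp only [zRot, gate, Matrix.mul_apply, Fin.sum_univ_two, Matrix.of_apply, Matrix.cons_val',
      Matrix.cons_val_zero, Matrix.cons_val_one, Matrix.cons_val_fin_one, zero_mul, zero_add]
    have : W * Z = Complex.exp (Complex.I * ω) * Complex.exp (Complex.I * ζ) := by
      rw [hZ, hW, ← Complex.exp_add, ← Complex.exp_add]; congr 1; ring
    linear_combination (-(Real.cos θ : ℂ)) * this
  induction m with
  | zero => simp
  | succ m ih =>
    obtain ⟨ih0, ih1⟩ := ih
    set P := ∑ k ∈ Finset.range (m + 1), (diagCoeff (Real.cos θ) (Real.sin θ) m k : ℂ) * W ^ k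
    set R := ∑ k ∈ Finset.range (m + 1), (offCoeff (Real.cos θ) (Real.sin θ) m k : ℂ) * W ^ k
    have hP0 : P = (diagCoeff (Real.cos θ) (Real.sin θ) m 0 : ℂ) +
        ∑ k ∈ Finset.range (m + 1), (diagCoeff (Real.cos θ) (Real.sin θ) m (k + 1) : ℂ) *
          W ^ (k + 1) := by
      have h : ∑ k ∈ Finset.range (m + 2), (diagCoeff (Real.cos θ) (Real.sin θ) m k : ℂ) * W ^ k =
          P := by
        rw [Finset.sum_range_succ, diagCoeff_eq_zero _ _ (by omega) (by omega)]
        simp [P]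
      rw [← h, Finset.sum_range_succ', pow_zero, mul_one, add_comm]
    have hP : ∑ k ∈ Finset.range (m + 1 + 1),
        (diagCoeff (Real.cos θ) (Real.sin θ) (m + 1) k : ℂ) * W ^ k =
        Real.cos θ * P - Real.sin θ * W * R := by
      rw [Finset.sum_range_succ', hP0]
      simp only [diagCoeff_succ_zero, diagCoeff_succ_succ, R]
      push_cast
      simp only [sub_mul, Finset.sum_sub_distrib, Finset.mul_sum, mul_add]
      have e1 : ∀ k, (Complex.cos θ * diagCoeff (Real.cos θ) (Real.sin θ) m (k + 1)) * W ^ (k + 1) =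
        Complex.cos θ * (diagCoeff (Real.cos θ) (Real.sin θ) m (k + 1) * W ^ (k + 1)) :=
          fun k => by ring
      have e2 : ∀ k, (Complex.sin θ * offCoeff (Real.cos θ) (Real.sin θ) m k) * W ^ (k + 1) =
        Complex.sin θ * W * (offCoeff (Real.cos θ) (Real.sin θ) m k * W ^ k) :=
          fun k => by ring
      simp only [e1, e2]
      ring
    have hR : ∑ k ∈ Finset.range (m + 1 + 1),
        (offCoeff (Real.cos θ) (Real.sin θ) (m + 1) k : ℂ) * W ^ k =
        Real.sin θ * P + Real.cos θ * W * R := by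
      rw [Finset.sum_range_succ', hP0]
      simp only [offCoeff_succ_zero, offCoeff_succ_succ, R]
      push_cast
      simp only [add_mul, Finset.sum_add_distrib, Finset.mul_sum, mul_add]
      have e1 : ∀ k, (Complex.sin θ * diagCoeff (Real.cos θ) (Real.sin θ) m (k + 1)) * W ^ (k + 1) =
        Complex.sin θ * (diagCoeff (Real.cos θ) (Real.sin θ) m (k + 1) * W ^ (k + 1)) :=
          fun k => by ring
      have e2 : ∀ k, (Complex.cos θ * offCoeff (Real.cos θ) (Real.sin θ) m k) * W ^ (k + 1) =
        Complex.cos θ * W * (offCoeff (Real.cos θ) (Real.sin θ) m k * W ^ k) :=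
          fun k => by ring
      simp only [e1, e2]
      ring
    rw [hP, hR, pow_succ, Matrix.mul_apply, Matrix.mul_apply, Fin.sum_univ_two, Fin.sum_univ_two,
      ih0, ih1, v00, v01, v10, v11]
    constructor
    · linear_combination (-Real.sin θ * W * Z * Z ^ m * R) * huu +
        (Real.sin θ * W * Z * Z ^ m * R * u * u') * Complex.I_sq
    · ring

lemma cycle_mem_unitary (ω θ ζ χ : ℝ) :
    zRot ω * gate θ ζ χ ∈ Matrix.unitaryGroup (Fin 2) ℂ := by
  have hexp : ∀ x : ℝ, Complex.exp (Complex.I * x) * Complex.exp (-(Complex.I * x)) = 1 := by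
    intro x; rw [← Complex.exp_add]; simp
  have hc : ∀ x : ℝ, (starRingEnd ℂ) (Complex.exp (Complex.I * x)) =
      Complex.exp (-(Complex.I * x)) := by
    intro x; rw [← Complex.exp_conj]; simp
  have hc' : ∀ x : ℝ, (starRingEnd ℂ) (Complex.exp (-(Complex.I * x))) =
      Complex.exp (Complex.I * x) := by
    intro x; rw [← Complex.exp_conj]; simp
  have hcs : (Complex.sin θ) ^ 2 + (Complex.cos θ) ^ 2 = 1 := Complex.sin_sq_add_cos_sq _
  have hsr : (starRingEnd ℂ) (Complex.sin θ) = Complex.sin θ := by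
    rw [← Complex.ofReal_sin, Complex.conj_ofReal]
  have hcr : (starRingEnd ℂ) (Complex.cos θ) = Complex.cos θ := by
    rw [← Complex.ofReal_cos, Complex.conj_ofReal]
  refine mul_mem ?_ ?_ <;> rw [Matrix.mem_unitaryGroup_iff] <;> ext i j
  · fin_cases i <;> fin_cases j <;>
      simp [zRot, Matrix.mul_apply, Fin.sum_univ_two, Matrix.star_apply, hc, hc', hexp,
        mul_comm (Complex.exp (-(Complex.I * (ω : ℂ))))]
  · fin_cases i <;> fin_cases j <;>
      simp [gate, Matrix.mul_apply, Fin.sum_univ_two, Matrix.star_apply, hc, hc', hsr, hcr]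
    · linear_combination (Complex.cos θ ^ 2) * hexp ζ + (-Complex.I ^ 2 * Complex.sin θ ^ 2) * hexp χ
        - (Complex.sin θ ^ 2) * Complex.I_sq + hcs
    · ring
    · ring
    · linear_combination (Complex.cos θ ^ 2) * hexp ζ + (-Complex.I ^ 2 * Complex.sin θ ^ 2) * hexp χ
        - (Complex.sin θ ^ 2) * Complex.I_sq + hcs

/-- The two initial states measure the real and the imaginary part of the product of the entries
of the first row, by polarization. -/
lemma recon_eq_mul (d : ℕ) (θ ζ χ : ℝ) (j : Fin (2 * d - 1)) :
    recon d θ ζ χ j = ((zRot (omega d j) * gate θ ζ χ) ^ d) 0 0 *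
      star (((zRot (omega d j) * gate θ ζ χ) ^ d) 0 1) := by
  set V := (zRot (omega d j) * gate θ ζ χ) ^ d with hV
  have hmem : V ∈ Matrix.unitaryGroup (Fin 2) ℂ := pow_mem (cycle_mem_unitary _ _ _ _) d
  have hrow : Complex.normSq (V 0 0) + Complex.normSq (V 0 1) = 1 := by
    have h := congrFun (congrFun (Matrix.mem_unitaryGroup_iff.mp hmem) 0) 0
    rw [Matrix.mul_apply, Fin.sum_univ_two, Matrix.star_apply, Matrix.star_apply,
      Matrix.one_apply_eq] at h
    simp only [RCLike.star_def, Complex.mul_conj] at h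
    exact_mod_cast h
  have hsq : Complex.normSq (((1 / Real.sqrt 2 : ℝ)) : ℂ) = 1 / 2 := by
    rw [Complex.normSq_ofReal, div_mul_div_comm, Real.mul_self_sqrt (by norm_num)]; norm_num
  have hb : ∀ s, bellProb d s (omega d j) θ ζ χ =
      1 / 2 * Complex.normSq (V 0 0 + V 0 1 * prepPhase s) := by
    intro s
    rw [bellProb, ← hV, Matrix.mulVec_smul, Pi.smul_apply, smul_eq_mul, Complex.normSq_mul, hsq]
    congr 2
    simp [Matrix.mulVec, dotProduct, Fin.sum_univ_two]
  rw [recon, hb, hb]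
  apply Complex.ext
  · simp only [prepPhase, Complex.normSq_apply] at hrow ⊢
    simp
    linarith
  · simp only [prepPhase, Complex.normSq_apply] at hrow ⊢
    simp
    linarith

/-- The exact reconstruction function is a trigonometric polynomial in which `ζ` and `χ` enter only
through the phases of the coefficients. -/
lemma recon_eq_synth {d : ℕ} (hd : 1 ≤ d) (θ ζ χ : ℝ) :
    recon d θ ζ χ = synth d (reconCoeff d θ ζ χ) := by
  ext j
  obtain ⟨h0, h1⟩ := cycle_row (omega d j) θ ζ χ d
  rw [recon_eq_mul, h0, h1]
  set p := fun k => diagCoeff (Real.cos θ) (Real.sin θ) d k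
  set r := fun k => offCoeff (Real.cos θ) (Real.sin θ) d k
  set σ : ℂ := (omega d j : ℂ) + ζ with hσ
  have hσc : (starRingEnd ℂ) σ = σ := by rw [hσ]; simp
  have hp : ∑ k ∈ Finset.range (d + 1), (p k : ℂ) * Complex.exp (2 * Complex.I * σ) ^ k =
      ∑ k ∈ Finset.range d, (p k : ℂ) * Complex.exp (2 * Complex.I * σ) ^ k := by
    rw [Finset.sum_range_succ]
    simp [p, diagCoeff_eq_zero _ _ le_rfl hd]
  have hr : ∑ k ∈ Finset.range (d + 1), (r k : ℂ) * Complex.exp (2 * Complex.I * σ) ^ k =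
      ∑ k ∈ Finset.range d, (r k : ℂ) * Complex.exp (2 * Complex.I * σ) ^ k := by
    rw [Finset.sum_range_succ]
    simp [r, offCoeff_eq_zero _ _ (le_refl d)]
  have hZ : Complex.exp (-(Complex.I * σ)) ^ d * star (Complex.exp (-(Complex.I * σ)) ^ d) = 1 := by
    rw [star_pow, ← mul_pow, RCLike.star_def, ← Complex.exp_conj, ← Complex.exp_add]
    simp [hσc]
  have hrs : star (∑ k ∈ Finset.range d, (r k : ℂ) * Complex.exp (2 * Complex.I * σ) ^ k) =
      ∑ k ∈ Finset.range d, (r k : ℂ) * Complex.exp (-(2 * Complex.I * σ)) ^ k := by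
    rw [star_sum]
    refine Finset.sum_congr rfl fun k _ => ?_
    have h2 : (starRingEnd ℂ) 2 = 2 := map_ofNat (starRingEnd ℂ) 2
    rw [star_mul', star_pow, RCLike.star_def, Complex.conj_ofReal, ← Complex.exp_conj]
    simp [hσc, h2]
  have hu : star (-Complex.I * Complex.exp (Complex.I * ((χ : ℂ) + ζ))) =
      Complex.I * Complex.exp (-(Complex.I * (χ + ζ))) := by
    rw [star_mul', RCLike.star_def, ← Complex.exp_conj]
    simp
  rw [hp, hr, star_mul', hu, star_mul', hrs]
  have hlhs : ∀ P R u Z Z' : ℂ, Z * Z' = 1 → Z * P * (u * (Z' * R)) = u * (P * R) := by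
    intro P R u Z Z' h
    linear_combination (u * P * R) * h
  rw [hlhs _ _ _ _ _ hZ, Finset.sum_mul_sum]
  -- collect the pairs of exponents with the same difference
  have hcollect : synth d (reconCoeff d θ ζ χ) j =
      Complex.I * Complex.exp (-(Complex.I * (χ + ζ))) * ∑ k ∈ Finset.range d,
        ∑ l ∈ Finset.range d, ∑ m ∈ band d, if (l : ℤ) - k = m then
          (p k : ℂ) * r l * Complex.exp (-(2 * Complex.I * m * σ)) else 0 := by
    rw [Finset.mul_sum]
    simp_rw [Finset.mul_sum]
    rw [Finset.sum_congr rfl fun k _ => Finset.sum_comm, Finset.sum_comm, synth]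
    refine Finset.sum_congr rfl fun m _ => ?_
    rw [reconCoeff, amp, mode]
    push_cast
    simp only [Finset.mul_sum, Finset.sum_mul]
    refine Finset.sum_congr rfl fun k _ => Finset.sum_congr rfl fun l _ => ?_
    split_ifs
    · have : Complex.exp (-(Complex.I * ((2 * (m : ℂ) + 1) * ζ + χ))) *
          Complex.exp (-(2 * Complex.I * m * (omega d j : ℂ))) =
          Complex.exp (-(Complex.I * (χ + ζ))) * Complex.exp (-(2 * Complex.I * m * σ)) := by
        rw [← Complex.exp_add, ← Complex.exp_add, hσ]; congr 1; ring
      simp only [p, r, Complex.ofReal_mul]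
      linear_combination (Complex.I * (diagCoeff (Real.cos θ) (Real.sin θ) d k : ℂ) *
        (offCoeff (Real.cos θ) (Real.sin θ) d l : ℂ)) * this
    · simp
  rw [hcollect]
  congr 1
  refine Finset.sum_congr rfl fun k hk => Finset.sum_congr rfl fun l hl => ?_
  have hk' := Finset.mem_range.mp hk
  have hl' := Finset.mem_range.mp hl
  rw [Finset.sum_ite_eq, if_pos (Finset.mem_Ioo.mpr ⟨by omega, by omega⟩), ← Complex.exp_nat_mul,
    ← Complex.exp_nat_mul]
  have : Complex.exp (-(2 * Complex.I * (((l : ℤ) - k : ℤ) : ℂ) * σ)) =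
      Complex.exp (k * (2 * Complex.I * σ)) * Complex.exp (l * -(2 * Complex.I * σ)) := by
    rw [← Complex.exp_add]; congr 1; push_cast; ring
  rw [this]
  ring

/-! ### Restriction of the circuits to an invariant subspace -/

section ExpEigen
attribute [local instance] Matrix.linftyOpNormedRing Matrix.linftyOpNormedAlgebra

/-- The exponential of a matrix acts on an eigenvector by the exponential of the eigenvalue. -/
lemma exp_mulVec_of_eigenvector {ι : Type*} [Fintype ι] [DecidableEq ι] (A : Matrix ι ι ℂ)
    (x : ι → ℂ) (μ : ℂ) (h : A *ᵥ x = μ • x) :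
    NormedSpace.exp A *ᵥ x = Complex.exp μ • x := by
  have hpow : ∀ k : ℕ, (A ^ k) *ᵥ x = μ ^ k • x := by
    intro k
    induction k with
    | zero => simp
    | succ k ih => rw [pow_succ, ← Matrix.mulVec_mulVec, h, Matrix.mulVec_smul, ih, smul_smul,
        pow_succ, mul_comm]
  have h1 := NormedSpace.exp_series_hasSum_exp' (𝕂 := ℂ) A
  have h2 := NormedSpace.exp_series_hasSum_exp' (𝕂 := ℂ) μ
  let φ : Matrix ι ι ℂ →+ (ι → ℂ) :=
    { toFun := fun M => M *ᵥ x, map_zero' := Matrix.zero_mulVec x,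
      map_add' := fun M N => Matrix.add_mulVec M N x }
  have h3 := h1.map φ (show Continuous fun M : Matrix ι ι ℂ => M *ᵥ x from
    Continuous.matrix_mulVec continuous_id continuous_const)
  have h4 := h2.smul_const x
  rw [← Complex.exp_eq_exp_ℂ] at h4
  refine h3.unique ?_
  convert! h4 using 1
  ext k i
  simp [φ, Matrix.smul_mulVec, hpow, mul_assoc]

end ExpEigen

lemma exp_mem_unitaryGroup {ι : Type*} [Fintype ι] [DecidableEq ι] {H : Matrix ι ι ℂ}
    (hH : H.IsHermitian) (t : ℝ) :
    NormedSpace.exp ((-(Complex.I * ((t : ℝ) : ℂ))) • H) ∈ Matrix.unitaryGroup ι ℂ := by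
  rw [Matrix.mem_unitaryGroup_iff, Matrix.star_eq_conjTranspose, ← Matrix.exp_conjTranspose,
    Matrix.conjTranspose_smul, hH.eq]
  have : star (-(Complex.I * ((t : ℝ) : ℂ))) • H = -((-(Complex.I * ((t : ℝ) : ℂ))) • H) := by
    rw [← neg_smul]
    congr 1
    simp
  rw [this, Matrix.exp_neg]
  exact Matrix.mul_nonsing_inv _ ((Matrix.isUnit_iff_isUnit_det _).mp (Matrix.isUnit_exp _))

variable {n : ℕ}

lemma flipBit_same (i : Fin n) (w : Bits n) : flipBit i w i = !(w i) := by simp [flipBit]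

lemma flipBit_of_ne {i j : Fin n} (h : j ≠ i) (w : Bits n) : flipBit i w j = w j := by
  simp [flipBit, h]

lemma flipBit_flipBit (i : Fin n) (w : Bits n) : flipBit i (flipBit i w) = w := by
  ext j
  by_cases h : j = i
  · subst h; simp [flipBit]
  · simp [flipBit, h]

lemma zSign_not (b : Bool) : zSign (!b) = -zSign b := by cases b <;> simp [zSign]

lemma opZ_mulVec_single (i : Fin n) (w : Bits n) :
    opZ i *ᵥ Pi.single w 1 = ((zSign (w i) : ℝ) : ℂ) • (Pi.single w 1 : Bits n → ℂ) := by
  ext b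
  by_cases h : b = w
  · subst h; simp [opZ, Matrix.diagonal]
  · simp [opZ, Matrix.diagonal, h]

lemma opX_mulVec_single (i : Fin n) (w : Bits n) :
    opX i *ᵥ Pi.single w 1 = (Pi.single (flipBit i w) 1 : Bits n → ℂ) := by
  ext b
  simp [opX, Pi.single_apply]

/-- Diagonal entry of the interaction at a basis state. -/
def energy (c : Pair n → ℝ) (w : Bits n) : ℝ := ∑ q : Pair n, c q * zzSign w q.1.1 q.1.2

lemma interaction_mulVec_single (c : Pair n → ℝ) (w : Bits n) :
    interaction c *ᵥ Pi.single w 1 = ((energy c w : ℝ) : ℂ) • (Pi.single w 1 : Bits n → ℂ) := by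
  rw [interaction, Matrix.sum_mulVec, energy]
  push_cast
  rw [Finset.sum_smul]
  refine Finset.sum_congr rfl fun q _ => ?_
  rw [Matrix.smul_mulVec, ← Matrix.mulVec_mulVec, opZ_mulVec_single, Matrix.mulVec_smul,
    opZ_mulVec_single, smul_smul, smul_smul, zzSign]
  push_cast
  congr 1
  ring

lemma sum_pair (F : Pair n → ℝ) :
    ∑ q, F q = ∑ x, ∑ y, if h : x < y then F ⟨(x, y), h⟩ else 0 := by
  rw [← Fintype.sum_prod_type (f := fun z : Fin n × Fin n => if h : z.1 < z.2 then F ⟨z, h⟩ else 0)]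
  rw [Finset.sum_dite]
  simp only [Finset.sum_const_zero, add_zero]
  refine Finset.sum_bij' (fun q _ => ⟨q.1, by simpa using q.2⟩)
    (fun z _ => ⟨z.1, (Finset.mem_filter.mp z.2).2⟩) ?_ ?_ ?_ ?_ ?_ <;> simp

/-- Half of the difference of the diagonal entries of the interaction is the splitting. -/
lemma energy_sub_energy_flipBit (S : SubspaceChoice n) (c : Pair n → ℝ) (p : Pair n) :
    energy c (S.zero p) - energy c (flipBit p.1.1 (S.zero p)) = 2 * splitting S c p := by
  set i := p.1.1
  set v := S.zero p
  rw [energy, energy, ← Finset.sum_sub_distrib, sum_pair, splitting]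
  have hterm : ∀ x y : Fin n, (if h : x < y then c ⟨(x, y), h⟩ * zzSign v x y -
      c ⟨(x, y), h⟩ * zzSign (flipBit i v) x y else 0) =
      (if x = i then (if i < y then 2 * (zzSign v i y * coupling c i y) else 0) else 0) +
      (if y = i then (if x < i then 2 * (zzSign v i x * coupling c i x) else 0) else 0) := by
    intro x y
    by_cases h : x < y
    · rw [dif_pos h]
      by_cases hx : x = i
      · subst hx
        rw [if_pos rfl, if_pos h, if_neg h.ne', coupling, dif_pos h, zzSign, zzSign, flipBit_same,
          flipBit_of_ne h.ne', zSign_not]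
        ring
      · by_cases hy : y = i
        · subst hy
          rw [if_neg hx, if_pos rfl, if_pos h, coupling, dif_neg h.not_gt, dif_pos h, zzSign,
            zzSign, zzSign, flipBit_same, flipBit_of_ne h.ne, zSign_not]
          ring
        · rw [if_neg hx, if_neg hy, zzSign, zzSign, flipBit_of_ne hx, flipBit_of_ne hy]
          ring
    · rw [dif_neg h]
      by_cases hx : x = i
      · rw [hx] at h
        by_cases hy : y = i
        · simp [hx, hy]
        · simp [hx, h, hy]
      · by_cases hy : y = i
        · rw [hy] at h
          simp [h, hx]
        · simp [hx, hy]
  simp_rw [hterm, Finset.sum_add_distrib]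
  have h1 : ∑ x, ∑ y, (if x = i then (if i < y then 2 * (zzSign v i y * coupling c i y) else 0)
      else 0) = ∑ y, (if i < y then 2 * (zzSign v i y * coupling c i y) else 0) := by
    rw [Finset.sum_comm]
    simp
  have h2 : ∑ x, ∑ y, (if y = i then (if x < i then 2 * (zzSign v i x * coupling c i x) else 0)
      else 0) = ∑ x, (if x < i then 2 * (zzSign v i x * coupling c i x) else 0) := by
    simp
  rw [h1, h2, ← Finset.sum_add_distrib, Finset.mul_sum,
    ← Finset.add_sum_erase Finset.univ _ (Finset.mem_univ i)]
  simp only [lt_self_iff_false, if_false, add_zero, zero_add]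
  refine Finset.sum_congr rfl fun j hj => ?_
  rcases lt_trichotomy i j with h | h | h
  · simp [h, h.not_gt, i, v]
  · exact absurd h.symm (Finset.ne_of_mem_erase hj)
  · simp [h, h.not_gt, i, v]

/-- The vector with prescribed components on two basis states. -/
def embed (v v' : Bits n) (x : Fin 2 → ℂ) : Bits n → ℂ := x 0 • Pi.single v 1 + x 1 • Pi.single v' 1

/-- The matrix `A` acts on the span of two basis states as `α G`. -/
def ActsAs (A : Matrix (Bits n) (Bits n) ℂ) (v v' : Bits n) (α : ℂ) (G : Matrix (Fin 2) (Fin 2) ℂ) :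
    Prop := ∀ x, A *ᵥ embed v v' x = α • embed v v' (G *ᵥ x)

lemma actsAs_of_single {A : Matrix (Bits n) (Bits n) ℂ} {v v' : Bits n} {α : ℂ}
    {G : Matrix (Fin 2) (Fin 2) ℂ}
    (h0 : A *ᵥ Pi.single v 1 = α • (G 0 0 • Pi.single v 1 + G 1 0 • Pi.single v' 1))
    (h1 : A *ᵥ Pi.single v' 1 = α • (G 0 1 • Pi.single v 1 + G 1 1 • Pi.single v' 1)) :
    ActsAs A v v' α G := by
  intro x
  rw [embed, Matrix.mulVec_add, Matrix.mulVec_smul, Matrix.mulVec_smul, h0, h1, embed]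
  ext b
  simp [Matrix.mulVec, dotProduct, Fin.sum_univ_two]
  ring

lemma ActsAs.mul {A A' : Matrix (Bits n) (Bits n) ℂ} {v v' : Bits n} {α α' : ℂ}
    {G G' : Matrix (Fin 2) (Fin 2) ℂ} (h : ActsAs A v v' α G) (h' : ActsAs A' v v' α' G') :
    ActsAs (A * A') v v' (α * α') (G * G') := by
  intro x
  rw [← Matrix.mulVec_mulVec, h', Matrix.mulVec_smul, h, smul_smul, Matrix.mulVec_mulVec,
    mul_comm α]

lemma ActsAs.pow {A : Matrix (Bits n) (Bits n) ℂ} {v v' : Bits n} {α : ℂ}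
    {G : Matrix (Fin 2) (Fin 2) ℂ} (h : ActsAs A v v' α G) (d : ℕ) :
    ActsAs (A ^ d) v v' (α ^ d) (G ^ d) := by
  induction d with
  | zero => intro x; simp
  | succ d ih => rw [pow_succ, pow_succ, pow_succ]; exact ih.mul h

lemma propagator_mulVec_single {H : Matrix (Bits n) (Bits n) ℂ} {w : Bits n} {E : ℝ}
    (h : H *ᵥ Pi.single w 1 = (E : ℂ) • (Pi.single w 1 : Bits n → ℂ)) (t : ℝ) :
    propagator H t *ᵥ Pi.single w 1 =
      Complex.exp (-(Complex.I * (t * E))) • (Pi.single w 1 : Bits n → ℂ) := by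
  refine exp_mulVec_of_eigenvector _ _ _ ?_
  rw [Matrix.smul_mulVec, h, smul_smul]
  congr 1
  ring

/-- The gate angles reproduce the evolution of a two-level system with tunnelling `A` and
splitting `B`. -/
lemma gate_angles {A B : ℝ} (hA : A ≠ 0) (hw : Real.sqrt (A ^ 2 + B ^ 2) < Real.pi / 2) :
    let w := Real.sqrt (A ^ 2 + B ^ 2)
    let θ := Real.arcsin (A / w * Real.sin w)
    let ζ := Real.arctan (B / w * Real.tan w)
    Real.sin θ = A / w * Real.sin w ∧ Real.cos θ * Real.cos ζ = Real.cos w ∧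
      Real.cos θ * Real.sin ζ = B / w * Real.sin w := by
  intro w θ ζ
  have hpos : 0 < A ^ 2 + B ^ 2 := by positivity
  have hw0 : 0 < w := Real.sqrt_pos.mpr hpos
  have hw2 : w ^ 2 = A ^ 2 + B ^ 2 := Real.sq_sqrt hpos.le
  have hcos : 0 < Real.cos w := Real.cos_pos_of_mem_Ioo ⟨by linarith [Real.pi_pos], hw⟩
  have hle : |A / w| ≤ 1 := by
    rw [abs_div, abs_of_pos hw0, div_le_one hw0]
    exact Real.abs_le_sqrt (by nlinarith)
  have hle2 : |A / w * Real.sin w| ≤ 1 := by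
    rw [abs_mul]
    exact mul_le_one₀ hle (abs_nonneg _) (Real.abs_sin_le_one w)
  have hsin : Real.sin θ = A / w * Real.sin w :=
    Real.sin_arcsin (abs_le.mp hle2).1 (abs_le.mp hle2).2
  set τ := B / w * Real.tan w with hτ
  have hcosθ : Real.cos θ = Real.cos w * Real.sqrt (1 + τ ^ 2) := by
    rw [Real.cos_arcsin]
    have : 1 - (A / w * Real.sin w) ^ 2 = (Real.cos w) ^ 2 * (1 + τ ^ 2) := by
      rw [hτ, Real.tan_eq_sin_div_cos]
      have h1 := Real.sin_sq_add_cos_sq w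
      field_simp
      have h2 : Real.sin w ^ 2 = 1 - Real.cos w ^ 2 := by linarith
      rw [h2]
      have h3 : A ^ 2 = w ^ 2 - B ^ 2 := by linarith
      rw [h3]; ring
    rw [this, Real.sqrt_mul (sq_nonneg _), Real.sqrt_sq hcos.le]
  have hsq : 0 < Real.sqrt (1 + τ ^ 2) := Real.sqrt_pos.mpr (by positivity)
  refine ⟨hsin, ?_, ?_⟩
  · rw [hcosθ, Real.cos_arctan, mul_assoc, mul_one_div_cancel hsq.ne', mul_one]
  · rw [hcosθ, Real.sin_arctan, mul_assoc, mul_div_cancel₀ _ hsq.ne',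
      Real.tan_eq_sin_div_cos]
    field_simp

/-- First column of the two-level propagator `exp(-i(A X + B Z))`, assembled from the eigenvectors
`(A, ±w - B)`; `c`, `s`, `u` stand for `cos w`, `sin w`, `i`, and `x`, `y` for a component of the
two basis vectors. -/
lemma block_identity_zero {w A B : ℂ} (hw : w ≠ 0) (hA : A ≠ 0) (h : w ^ 2 = A ^ 2 + B ^ 2)
    (c s u α x y : ℂ) :
    (w + B) / (2 * w * A) * (α * (c - s * u) * (A * x + (w - B) * y)) +
      (w - B) / (2 * w * A) * (α * (c + s * u) * (A * x + (-w - B) * y)) =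
    α * ((c - u * (B / w * s)) * x + -(u * (A / w * s)) * y) := by
  linear_combination (norm := (field_simp; ring)) (-(α * s * u * y) / (w * A)) * h

/-- Second column of the two-level propagator; see `block_identity_zero`. -/
lemma block_identity_one {w : ℂ} (hw : w ≠ 0) (A B c s u α x y : ℂ) :
    1 / (2 * w) * (α * (c - s * u) * (A * x + (w - B) * y)) +
      -(1 / (2 * w)) * (α * (c + s * u) * (A * x + (-w - B) * y)) =
    α * (-(u * (A / w * s)) * x + (c + u * (B / w * s)) * y) := by
  field_simp
  ring

/-- On an invariant subspace the evolution is, up to a phase, the logical gate with the true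
angles. -/
lemma actsAs_fullPropagator (S : SubspaceChoice n) (a : Fin n → ℝ) (c : Pair n → ℝ) {T : ℝ}
    (p : Pair n) (hA : a p.1.1 * T ≠ 0)
    (hw : Real.sqrt ((a p.1.1 * T) ^ 2 + (splitting S c p * T) ^ 2) < Real.pi / 2) :
    ∃ x : ℝ, ActsAs (propagator (fullHamiltonian a c p.1.1) T) (S.zero p)
      (flipBit p.1.1 (S.zero p)) (Complex.exp (-(Complex.I * x)))
      (gate (trueParam S a c T (p, 0)) (trueParam S a c T (p, 1)) (trueParam S a c T (p, 2))) := by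
  set v := S.zero p with hv
  set v' := flipBit p.1.1 v with hv'
  obtain ⟨g1, g2, g3⟩ := gate_angles hA hw
  set A := a p.1.1 * T with hAdef
  set B := splitting S c p * T with hBdef
  set w := Real.sqrt (A ^ 2 + B ^ 2) with hwdef
  set θ := Real.arcsin (A / w * Real.sin w) with hθ
  set ζ := Real.arctan (B / w * Real.tan w) with hζ
  have ht0 : trueParam S a c T (p, 0) = θ := rfl
  have ht1 : trueParam S a c T (p, 1) = ζ := rfl
  have ht2 : trueParam S a c T (p, 2) = 0 := rfl
  rw [ht0, ht1, ht2]
  have hpos : 0 < A ^ 2 + B ^ 2 := by positivity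
  have hw0 : 0 < w := Real.sqrt_pos.mpr hpos
  have hw2 : w ^ 2 = A ^ 2 + B ^ 2 := Real.sq_sqrt hpos.le
  set C : ℝ := (energy c v + energy c v') / 2 with hC
  have hdiff := energy_sub_energy_flipBit S c p
  rw [← hv, ← hv'] at hdiff
  have hEv : T * energy c v = T * C + B := by rw [hC, hBdef]; linear_combination (T / 2) * hdiff
  have hEv' : T * energy c v' = T * C - B := by rw [hC, hBdef]; linear_combination (-T / 2) * hdiff
  have hHv : (-(Complex.I * ((T : ℝ) : ℂ))) • fullHamiltonian a c p.1.1 *ᵥ Pi.single v 1 =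
      (-(Complex.I * (T * C + B : ℝ))) • (Pi.single v 1 : Bits n → ℂ) +
        (-(Complex.I * (A : ℝ))) • Pi.single v' 1 := by
    rw [fullHamiltonian, Matrix.add_mulVec, Matrix.smul_mulVec, opX_mulVec_single,
      interaction_mulVec_single, smul_add, smul_smul, smul_smul, add_comm, ← hv', ← hEv, hAdef]
    push_cast
    congr 2 <;> ring
  have hHv' : (-(Complex.I * ((T : ℝ) : ℂ))) • fullHamiltonian a c p.1.1 *ᵥ Pi.single v' 1 =
      (-(Complex.I * (T * C - B : ℝ))) • (Pi.single v' 1 : Bits n → ℂ) +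
        (-(Complex.I * (A : ℝ))) • Pi.single v 1 := by
    rw [fullHamiltonian, Matrix.add_mulVec, Matrix.smul_mulVec, opX_mulVec_single,
      interaction_mulVec_single, smul_add, smul_smul, smul_smul, add_comm, hv', flipBit_flipBit,
      ← hv', ← hEv', hAdef]
    push_cast
    congr 2 <;> ring
  -- eigenvectors of the two-dimensional block, for the two signs of `w`
  have heig : ∀ σ : ℝ, σ ^ 2 = w ^ 2 →
      propagator (fullHamiltonian a c p.1.1) T *ᵥ
        ((A : ℂ) • Pi.single v 1 + ((σ - B : ℝ) : ℂ) • Pi.single v' 1) =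
      Complex.exp (-(Complex.I * (T * C + σ : ℝ))) •
        ((A : ℂ) • (Pi.single v 1 : Bits n → ℂ) + ((σ - B : ℝ) : ℂ) • Pi.single v' 1) := by
    intro σ hσ
    refine exp_mulVec_of_eigenvector _ _ _ ?_
    rw [Matrix.smul_mulVec, Matrix.mulVec_add, Matrix.mulVec_smul, Matrix.mulVec_smul, smul_add,
      smul_comm _ (A : ℂ), smul_comm _ ((σ - B : ℝ) : ℂ), hHv, hHv']
    have hσ' : (σ : ℂ) ^ 2 = (A : ℂ) ^ 2 + (B : ℂ) ^ 2 := by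
      rw [hw2] at hσ; exact_mod_cast hσ
    ext b
    simp only [Pi.add_apply, Pi.smul_apply, smul_eq_mul]
    push_cast
    linear_combination (Complex.I * (Pi.single v' 1 : Bits n → ℂ) b) * hσ'
  have hplus := heig w rfl
  have hminus := heig (-w) (by ring)
  have hwc : (w : ℂ) ≠ 0 := by exact_mod_cast hw0.ne'
  have hAc : (A : ℂ) ≠ 0 := by exact_mod_cast hA
  have hwc2 : (w : ℂ) ^ 2 = (A : ℂ) ^ 2 + (B : ℂ) ^ 2 := by exact_mod_cast hw2
  have ev : (Pi.single v 1 : Bits n → ℂ) = ((w + B) / (2 * w * A) : ℂ) •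
        ((A : ℂ) • Pi.single v 1 + ((w - B : ℝ) : ℂ) • Pi.single v' 1) +
      ((w - B) / (2 * w * A) : ℂ) •
        ((A : ℂ) • Pi.single v 1 + ((-w - B : ℝ) : ℂ) • Pi.single v' 1) := by
    ext b
    simp only [Pi.add_apply, Pi.smul_apply, smul_eq_mul]
    push_cast
    field_simp
    ring
  have ev' : (Pi.single v' 1 : Bits n → ℂ) = (1 / (2 * w) : ℂ) •
        ((A : ℂ) • Pi.single v 1 + ((w - B : ℝ) : ℂ) • Pi.single v' 1) +
      (-(1 / (2 * w)) : ℂ) •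
        ((A : ℂ) • Pi.single v 1 + ((-w - B : ℝ) : ℂ) • Pi.single v' 1) := by
    ext b
    simp only [Pi.add_apply, Pi.smul_apply, smul_eq_mul]
    push_cast
    field_simp
    ring
  have hEp : Complex.exp (-(Complex.I * (T * C + w : ℝ))) =
      Complex.exp (-(Complex.I * (T * C : ℝ))) * (Complex.cos w - Complex.sin w * Complex.I) := by
    have := Complex.exp_mul_I (-(w : ℂ))
    rw [Complex.cos_neg, Complex.sin_neg] at this
    rw [show Complex.cos w - Complex.sin w * Complex.I = Complex.cos w + -Complex.sin w * Complex.I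
      by ring, ← this, ← Complex.exp_add]
    congr 1; push_cast; ring
  have hEm : Complex.exp (-(Complex.I * (T * C + -w : ℝ))) =
      Complex.exp (-(Complex.I * (T * C : ℝ))) * (Complex.cos w + Complex.sin w * Complex.I) := by
    rw [← Complex.exp_mul_I, ← Complex.exp_add]
    congr 1; push_cast; ring
  rw [hEp] at hplus
  rw [hEm] at hminus
  set α := Complex.exp (-(Complex.I * (T * C : ℝ)))
  -- entries of the gate
  have k2 : (Complex.cos θ) * Complex.cos ζ = Complex.cos w := by exact_mod_cast g2
  have k3 : (Complex.cos θ) * Complex.sin ζ = B / w * Complex.sin w := by exact_mod_cast g3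
  have k1 : Complex.sin θ = A / w * Complex.sin w := by exact_mod_cast g1
  have ze : Complex.exp (-(Complex.I * ζ)) = Complex.cos ζ - Complex.sin ζ * Complex.I := by
    have := Complex.exp_mul_I (-(ζ : ℂ))
    rw [Complex.cos_neg, Complex.sin_neg] at this
    rw [show Complex.cos ζ - Complex.sin ζ * Complex.I = Complex.cos ζ + -Complex.sin ζ * Complex.I
      by ring, ← this]
    congr 1; ring
  have ze' : Complex.exp (Complex.I * ζ) = Complex.cos ζ + Complex.sin ζ * Complex.I := by
    rw [← Complex.exp_mul_I, mul_comm]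
  have G00 : gate θ ζ 0 0 0 = Complex.cos w - Complex.I * (B / w * Complex.sin w) := by
    have : gate θ ζ 0 0 0 = (Real.cos θ : ℂ) * Complex.exp (-(Complex.I * ζ)) := rfl
    rw [this, ze, Complex.ofReal_cos]
    linear_combination k2 - Complex.I * k3
  have G11 : gate θ ζ 0 1 1 = Complex.cos w + Complex.I * (B / w * Complex.sin w) := by
    have : gate θ ζ 0 1 1 = (Real.cos θ : ℂ) * Complex.exp (Complex.I * ζ) := rfl
    rw [this, ze', Complex.ofReal_cos]
    linear_combination k2 + Complex.I * k3
  have G01 : gate θ ζ 0 0 1 = -(Complex.I * (A / w * Complex.sin w)) := by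
    have : gate θ ζ 0 0 1 = -(Complex.I * (Real.sin θ : ℂ) * Complex.exp (Complex.I * (0 : ℝ))) :=
      rfl
    rw [this, Complex.ofReal_sin, k1]; simp
  have G10 : gate θ ζ 0 1 0 = -(Complex.I * (A / w * Complex.sin w)) := by
    have : gate θ ζ 0 1 0 = -(Complex.I * (Real.sin θ : ℂ) *
      Complex.exp (-(Complex.I * (0 : ℝ)))) := rfl
    rw [this, Complex.ofReal_sin, k1]; simp
  refine ⟨T * C, actsAs_of_single ?_ ?_⟩
  · rw [G00, G10]
    conv_lhs => rw [ev]
    rw [Matrix.mulVec_add, Matrix.mulVec_smul, Matrix.mulVec_smul, hplus, hminus]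
    ext b
    simp only [Pi.add_apply, Pi.smul_apply, smul_eq_mul]
    simp only [Complex.ofReal_sub, Complex.ofReal_neg]
    exact block_identity_zero hwc hAc hwc2 _ _ _ _ _ _
  · rw [G01, G11]
    conv_lhs => rw [ev']
    rw [Matrix.mulVec_add, Matrix.mulVec_smul, Matrix.mulVec_smul, hplus, hminus]
    ext b
    simp only [Pi.add_apply, Pi.smul_apply, smul_eq_mul]
    simp only [Complex.ofReal_sub, Complex.ofReal_neg]
    exact block_identity_one hwc _ _ _ _ _ _ _ _

lemma actsAs_hybridRotation (S : SubspaceChoice n) (p : Pair n) (ω : ℝ) :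
    ActsAs (hybridRotation p.1.1 ω) (S.zero p) (flipBit p.1.1 (S.zero p)) 1 (zRot ω) := by
  have h0 := propagator_mulVec_single (opZ_mulVec_single p.1.1 (S.zero p)) ω
  have h1 := propagator_mulVec_single (opZ_mulVec_single p.1.1 (flipBit p.1.1 (S.zero p))) ω
  rw [flipBit_same, S.zero_bit] at h1
  rw [S.zero_bit] at h0
  refine actsAs_of_single ?_ ?_
  · rw [hybridRotation, h0]; simp [zRot, zSign]
  · rw [hybridRotation, h1]; simp [zRot, zSign]

/-- The field `b = ω - B / T` compensates the splitting due to the interaction, so the analog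
rotation is the ideal one up to a phase. -/
lemma actsAs_analogRotation (S : SubspaceChoice n) (c : Pair n → ℝ) (p : Pair n) (ω : ℝ) :
    ∃ x : ℝ, ActsAs (analogRotation S c p ω) (S.zero p) (flipBit p.1.1 (S.zero p))
      (Complex.exp (-(Complex.I * x))) (zRot ω) := by
  have hdiff := energy_sub_energy_flipBit S c p
  set v := S.zero p with hv
  set v' := flipBit p.1.1 v with hv'
  set C : ℝ := (energy c v + energy c v') / 2 with hC
  have e0 : (((ω - splitting S c p : ℝ) : ℂ) • opZ p.1.1 + interaction c) *ᵥ Pi.single v 1 =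
      ((C + ω : ℝ) : ℂ) • (Pi.single v 1 : Bits n → ℂ) := by
    rw [Matrix.add_mulVec, Matrix.smul_mulVec, opZ_mulVec_single, interaction_mulVec_single,
      hv, S.zero_bit, ← hv, smul_smul, ← add_smul]
    congr 1
    rw [← Complex.ofReal_mul, ← Complex.ofReal_add]
    congr 1
    simp only [zSign, hC]
    norm_num
    linarith
  have e1 : (((ω - splitting S c p : ℝ) : ℂ) • opZ p.1.1 + interaction c) *ᵥ Pi.single v' 1 =
      ((C - ω : ℝ) : ℂ) • (Pi.single v' 1 : Bits n → ℂ) := by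
    rw [Matrix.add_mulVec, Matrix.smul_mulVec, opZ_mulVec_single, interaction_mulVec_single,
      hv', flipBit_same, hv, S.zero_bit, ← hv, ← hv', smul_smul, ← add_smul]
    congr 1
    rw [← Complex.ofReal_mul, ← Complex.ofReal_add]
    congr 1
    simp only [zSign, hC]
    norm_num
    linarith
  refine ⟨C, actsAs_of_single ?_ ?_⟩
  · rw [analogRotation, propagator_mulVec_single e0]
    simp only [zRot, Matrix.of_apply, Matrix.cons_val', Matrix.cons_val_zero, Matrix.cons_val_one,
      Matrix.cons_val_fin_one, zero_smul, add_zero, smul_smul, ← Complex.exp_add]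
    congr 2
    push_cast; ring
  · rw [analogRotation, propagator_mulVec_single e1]
    simp only [zRot, Matrix.of_apply, Matrix.cons_val', Matrix.cons_val_zero, Matrix.cons_val_one,
      Matrix.cons_val_fin_one, zero_smul, zero_add, smul_smul, ← Complex.exp_add]
    congr 2
    push_cast; ring

/-! ### Outcome probabilities of the circuits -/

variable {n : ℕ}

lemma isHermitian_opZ (i : Fin n) : (opZ i).IsHermitian := by
  rw [opZ, Matrix.IsHermitian, Matrix.diagonal_conjTranspose]
  congr 1
  ext w
  simp

lemma isHermitian_opX (i : Fin n) : (opX i).IsHermitian := by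
  ext w w'
  have : (w' = flipBit i w) ↔ (w = flipBit i w') := by
    constructor <;> rintro rfl <;> rw [flipBit_flipBit]
  simp only [Matrix.conjTranspose_apply, opX, Matrix.of_apply, this]
  split_ifs <;> simp

lemma isHermitian_interaction (c : Pair n → ℝ) : (interaction c).IsHermitian := by
  have key : ∀ w w', interaction c w w' = if w = w' then ((energy c w : ℝ) : ℂ) else 0 := by
    intro w w'
    have h := congrFun (interaction_mulVec_single c w') w
    rw [Matrix.mulVec_single_one] at h
    simp only [Matrix.col_apply, Pi.smul_apply, Pi.single_apply, smul_eq_mul, mul_ite, mul_one,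
      mul_zero] at h
    rw [h]
    split_ifs with hw
    · rw [hw]
    · rfl
  ext w w'
  rw [Matrix.conjTranspose_apply, key, key]
  by_cases h : w = w'
  · subst h; simp
  · simp [h, Ne.symm h]

lemma isHermitian_ofReal_smul {ι : Type*} {H : Matrix ι ι ℂ} (hH : H.IsHermitian) (r : ℝ) :
    ((r : ℂ) • H).IsHermitian := by
  rw [Matrix.IsHermitian, Matrix.conjTranspose_smul, hH.eq]
  congr 1
  simp

lemma propagator_mem_unitaryGroup {H : Matrix (Bits n) (Bits n) ℂ} (hH : H.IsHermitian) (t : ℝ) :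
    propagator H t ∈ Matrix.unitaryGroup (Bits n) ℂ := exp_mem_unitaryGroup hH t

lemma sum_born (ψ : Bits n → ℂ) : ((∑ b, born ψ b : ℝ) : ℂ) = star ψ ⬝ᵥ ψ := by
  rw [dotProduct]
  push_cast
  refine Finset.sum_congr rfl fun b _ => ?_
  rw [born, Complex.normSq_eq_conj_mul_self]
  rfl

lemma sum_born_mulVec {U : Matrix (Bits n) (Bits n) ℂ} (hU : U ∈ Matrix.unitaryGroup (Bits n) ℂ)
    (ψ : Bits n → ℂ) : ∑ b, born (U *ᵥ ψ) b = ∑ b, born ψ b := by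
  have h : ((∑ b, born (U *ᵥ ψ) b : ℝ) : ℂ) = ((∑ b, born ψ b : ℝ) : ℂ) := by
    rw [sum_born, sum_born, Matrix.star_mulVec, Matrix.dotProduct_mulVec, Matrix.vecMul_vecMul,
      ← Matrix.star_eq_conjTranspose, Matrix.mem_unitaryGroup_iff'.mp hU, Matrix.vecMul_one]
  exact_mod_cast h

/-- The subspaces of one round are distinct: equal basis states would give the invertible matrix of
eigenvalues two equal rows. -/
lemma zero_toPair_injective (S : SubspaceChoice n) (i : Fin n) :
    Function.Injective fun k : Later i => S.zero (toPair i k) := by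
  intro k l h
  by_contra hne
  have hdet := S.solvable i
  rw [Matrix.det_zero_of_row_eq hne] at hdet
  · exact not_isUnit_zero hdet
  · ext j
    simp only at h
    simp only [coeffMatrix, Matrix.of_apply, h]

lemma zero_injective_of_fst (S : SubspaceChoice n) {p q : Pair n} (h1 : p.1.1 = q.1.1)
    (h2 : S.zero p = S.zero q) : p = q := by
  obtain ⟨⟨i, k⟩, hk⟩ := p
  obtain ⟨⟨i', l⟩, hl⟩ := q
  obtain rfl : i = i' := h1
  have := @zero_toPair_injective n S i ⟨k, hk⟩ ⟨l, hl⟩ h2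
  simp only [Subtype.mk.injEq] at this
  subst this
  rfl

lemma zero_ne_flipBit (S : SubspaceChoice n) {p q : Pair n} (h1 : p.1.1 = q.1.1) :
    S.zero p ≠ flipBit q.1.1 (S.zero q) := by
  intro h
  have h2 := congrFun h q.1.1
  rw [flipBit_same, S.zero_bit, ← h1, S.zero_bit] at h2
  simp at h2

lemma bellVector_eq_embed (S : SubspaceChoice n) (p : Pair n) (s : Bool) :
    bellVector S p s = embed (S.zero p) (flipBit p.1.1 (S.zero p)) ![1, prepPhase s] := by
  ext b
  simp [bellVector, embed, Pi.single_apply]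

lemma star_bellVector_dotProduct (S : SubspaceChoice n) {p q : Pair n} (h1 : p.1.1 = q.1.1)
    (s : Bool) : star (bellVector S p s) ⬝ᵥ bellVector S q s = if p = q then 2 else 0 := by
  have hφ : (starRingEnd ℂ) (prepPhase s) * prepPhase s = 1 := by
    cases s <;> simp [prepPhase]
  have e : star (bellVector S p s) = Pi.single (S.zero p) 1 +
      Pi.single (flipBit p.1.1 (S.zero p)) ((starRingEnd ℂ) (prepPhase s)) := by
    ext b
    simp only [bellVector, Pi.star_apply, Pi.add_apply, Pi.single_apply, star_add]
    congr 1 <;> split_ifs <;> simp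
  have hflip : flipBit p.1.1 (S.zero p) = flipBit q.1.1 (S.zero q) ↔ p = q := by
    constructor
    · intro h
      rw [h1] at h
      have := congrArg (flipBit q.1.1) h
      rw [flipBit_flipBit, flipBit_flipBit] at this
      exact zero_injective_of_fst S h1 this
    · rintro rfl; rfl
  have hzero : S.zero p = S.zero q ↔ p = q :=
    ⟨zero_injective_of_fst S h1, by rintro rfl; rfl⟩
  rw [e, bellVector, add_dotProduct, dotProduct_add, dotProduct_add, single_dotProduct,
    single_dotProduct, single_dotProduct, single_dotProduct]
  simp only [Pi.single_apply, hzero, hflip, zero_ne_flipBit S h1,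
    (zero_ne_flipBit S h1.symm).symm, if_false]
  by_cases h : p = q
  · simp only [h, if_true, hφ]; norm_num
  · simp [h]

lemma sum_born_bellVector (S : SubspaceChoice n) (p : Pair n) (s : Bool) :
    ∑ b, born (analogState S p s) b = 1 := by
  have h : ((∑ b, born (analogState S p s) b : ℝ) : ℂ) = 1 := by
    rw [sum_born, analogState, star_smul, smul_dotProduct, dotProduct_smul,
      star_bellVector_dotProduct S rfl, if_pos rfl, RCLike.star_def, Complex.conj_ofReal,
      smul_eq_mul, smul_eq_mul]
    have : (1 / Real.sqrt 2) * (1 / Real.sqrt 2 * 2) = 1 := by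
      have := Real.mul_self_sqrt (show (0 : ℝ) ≤ 2 by norm_num)
      field_simp
      nlinarith
    exact_mod_cast this
  exact_mod_cast h

lemma sum_born_hybridState (S : SubspaceChoice n) (i : Round n) (s : Bool) :
    ∑ b, born (hybridState S i.1 s) b = 1 := by
  obtain ⟨i, k0, hk0⟩ := i
  have hM : 0 < (Fintype.card (Later i) : ℝ) := by
    have : Nonempty (Later i) := ⟨⟨k0, hk0⟩⟩
    exact_mod_cast Fintype.card_pos
  have h : ((∑ b, born (hybridState S i s) b : ℝ) : ℂ) = 1 := by
    rw [sum_born, hybridState, star_smul, smul_dotProduct, dotProduct_smul, star_sum,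
      sum_dotProduct]
    have : ∀ k : Later i, star (bellVector S (toPair i k) s) ⬝ᵥ
        ∑ l : Later i, bellVector S (toPair i l) s = 2 := by
      intro k
      rw [dotProduct_sum, Finset.sum_eq_single k]
      · rw [star_bellVector_dotProduct S rfl, if_pos rfl]
      · intro l _ hl
        rw [star_bellVector_dotProduct S (by rfl), if_neg]
        intro hh
        apply hl
        have := congrArg (fun p : Pair n => p.1.2) hh
        exact Subtype.ext this.symm
      · simp
    simp only [this]
    rw [RCLike.star_def, Complex.conj_ofReal, smul_eq_mul, smul_eq_mul, Finset.sum_const,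
      Finset.card_univ, nsmul_eq_mul]
    have : (1 / Real.sqrt (2 * (Fintype.card (Later i) : ℝ))) *
        (1 / Real.sqrt (2 * (Fintype.card (Later i) : ℝ)) * ((Fintype.card (Later i) : ℝ) * 2)) = 1 := by
      have := Real.mul_self_sqrt (show (0 : ℝ) ≤ 2 * (Fintype.card (Later i) : ℝ) by positivity)
      have h0 : 0 < Real.sqrt (2 * (Fintype.card (Later i) : ℝ)) := Real.sqrt_pos.mpr (by positivity)
      field_simp
      nlinarith
    exact_mod_cast this
  exact_mod_cast h

lemma isHermitian_fullHamiltonian (a : Fin n → ℝ) (c : Pair n → ℝ) (i : Fin n) :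
    (fullHamiltonian a c i).IsHermitian :=
  (isHermitian_ofReal_smul (isHermitian_opX i) _).add (isHermitian_interaction c)

lemma hybridProb_nonneg (S : SubspaceChoice n) (a : Fin n → ℝ) (c : Pair n → ℝ) (T : ℝ) (d : ℕ)
    (x : HybridCircuit n d) (b : Bits n) : 0 ≤ hybridProb S a c T d x b := Complex.normSq_nonneg _

lemma analogProb_nonneg (S : SubspaceChoice n) (a : Fin n → ℝ) (c : Pair n → ℝ) (T : ℝ) (d : ℕ)
    (x : AnalogCircuit n d) (b : Bits n) : 0 ≤ analogProb S a c T d x b := Complex.normSq_nonneg _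

lemma sum_hybridProb (S : SubspaceChoice n) (a : Fin n → ℝ) (c : Pair n → ℝ) (T : ℝ) (d : ℕ)
    (x : HybridCircuit n d) : ∑ b, hybridProb S a c T d x b = 1 := by
  unfold hybridProb
  rw [sum_born_mulVec, sum_born_hybridState]
  exact pow_mem (mul_mem (propagator_mem_unitaryGroup (isHermitian_opZ _) _)
    (propagator_mem_unitaryGroup (isHermitian_fullHamiltonian a c _) _)) d

lemma sum_analogProb (S : SubspaceChoice n) (a : Fin n → ℝ) (c : Pair n → ℝ) (T : ℝ) (d : ℕ)
    (x : AnalogCircuit n d) : ∑ b, analogProb S a c T d x b = 1 := by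
  unfold analogProb
  rw [sum_born_mulVec, sum_born_bellVector]
  exact pow_mem (mul_mem (propagator_mem_unitaryGroup
    ((isHermitian_ofReal_smul (isHermitian_opZ _) _).add (isHermitian_interaction c)) _)
    (propagator_mem_unitaryGroup (isHermitian_fullHamiltonian a c _) _)) d

lemma bellProb_eq (d : ℕ) (s : Bool) (ω θ ζ χ : ℝ) : bellProb d s ω θ ζ χ =
    1 / 2 * Complex.normSq ((((zRot ω * gate θ ζ χ) ^ d) *ᵥ ![1, prepPhase s]) 0) := by
  have hsq : Complex.normSq (((1 / Real.sqrt 2 : ℝ)) : ℂ) = 1 / 2 := by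
    rw [Complex.normSq_ofReal, div_mul_div_comm, Real.mul_self_sqrt (by norm_num)]; norm_num
  rw [bellProb, Matrix.mulVec_smul, Pi.smul_apply, smul_eq_mul, Complex.normSq_mul, hsq]

lemma normSq_exp_neg_I_mul_pow (x : ℝ) (d : ℕ) :
    Complex.normSq (Complex.exp (-(Complex.I * x)) ^ d) = 1 := by
  have : ‖Complex.exp (-(Complex.I * x))‖ = 1 := by
    rw [show -(Complex.I * (x : ℂ)) = ((-x : ℝ) : ℂ) * Complex.I by push_cast; ring,
      Complex.norm_exp_ofReal_mul_I]
  rw [Complex.normSq_eq_norm_sq, norm_pow, this]; simp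

/-- The evolution angle on the invariant subspace `p`. -/
def evolutionAngle (S : SubspaceChoice n) (a : Fin n → ℝ) (c : Pair n → ℝ) (T : ℝ) (p : Pair n) :
    ℝ := Real.sqrt ((a p.1.1 * T) ^ 2 + (splitting S c p * T) ^ 2)

/-- In the analog mode the logical zero of the subspace has the probability of the two-level model. -/
lemma analogProb_zero (S : SubspaceChoice n) (a : Fin n → ℝ) (c : Pair n → ℝ) {T : ℝ} (d : ℕ)
    (p : Pair n) (hA : a p.1.1 * T ≠ 0) (hw : evolutionAngle S a c T p < Real.pi / 2)
    (s : Bool) (j : Fin (2 * d - 1)) :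
    analogProb S a c T d (p, s, j) (S.zero p) = bellProb d s (omega d j)
      (trueParam S a c T (p, 0)) (trueParam S a c T (p, 1)) (trueParam S a c T (p, 2)) := by
  obtain ⟨x, hx⟩ := actsAs_fullPropagator S a c p hA hw
  obtain ⟨y, hy⟩ := actsAs_analogRotation S c p (omega d j)
  have hcyc := (hy.mul hx).pow d
  have hα : Complex.exp (-(Complex.I * y)) * Complex.exp (-(Complex.I * x)) =
      Complex.exp (-(Complex.I * (y + x : ℝ))) := by
    rw [← Complex.exp_add]; congr 1; push_cast; ring
  rw [hα] at hcyc
  have hne : S.zero p ≠ flipBit p.1.1 (S.zero p) := zero_ne_flipBit S rfl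
  have hsq : Complex.normSq (((1 / Real.sqrt 2 : ℝ)) : ℂ) = 1 / 2 := by
    rw [Complex.normSq_ofReal, div_mul_div_comm, Real.mul_self_sqrt (by norm_num)]; norm_num
  rw [bellProb_eq, analogProb, born, analogState, bellVector_eq_embed, Matrix.mulVec_smul, hcyc,
    Pi.smul_apply, Pi.smul_apply, smul_eq_mul, smul_eq_mul, Complex.normSq_mul, Complex.normSq_mul,
    normSq_exp_neg_I_mul_pow, hsq, one_mul]
  congr 2
  simp [embed, hne]

/-- In the hybrid mode the subspaces of a round evolve independently and do not interfere, so each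
logical zero has the probability of the two-level model divided by the number of subspaces. -/
lemma hybridProb_zero (S : SubspaceChoice n) (a : Fin n → ℝ) (c : Pair n → ℝ) {T : ℝ} (d : ℕ)
    (p : Pair n) (hA : a p.1.1 * T ≠ 0)
    (hw : ∀ q : Pair n, evolutionAngle S a c T q < Real.pi / 2)
    (s : Bool) (j : Fin (2 * d - 1)) :
    hybridProb S a c T d (roundOf p, s, j) (S.zero p) = bellProb d s (omega d j)
      (trueParam S a c T (p, 0)) (trueParam S a c T (p, 1)) (trueParam S a c T (p, 2)) /
        Fintype.card (Later p.1.1) := by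
  obtain ⟨⟨i, k⟩, hk⟩ := p
  change hybridProb S a c T d (⟨i, _⟩, s, j) (S.zero (toPair i ⟨k, hk⟩)) = _
  set k' : Later i := ⟨k, hk⟩
  have hcyc : ∀ l : Later i, ∃ x : ℝ, ActsAs ((hybridRotation i (omega d j) *
      propagator (fullHamiltonian a c i) T) ^ d) (S.zero (toPair i l))
      (flipBit i (S.zero (toPair i l))) (Complex.exp (-(Complex.I * x)) ^ d)
      ((zRot (omega d j) * gate (trueParam S a c T (toPair i l, 0))
        (trueParam S a c T (toPair i l, 1)) (trueParam S a c T (toPair i l, 2))) ^ d) := by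
    intro l
    obtain ⟨x, hx⟩ := actsAs_fullPropagator S a c (toPair i l) hA (hw _)
    have := ((actsAs_hybridRotation S (toPair i l) (omega d j)).mul hx).pow d
    rw [one_mul] at this
    exact ⟨x, this⟩
  choose x hx using hcyc
  have hM : 0 < (Fintype.card (Later i) : ℝ) := by
    exact_mod_cast Fintype.card_pos_iff.mpr ⟨k'⟩
  have hsq : Complex.normSq (((1 / Real.sqrt (2 * (Fintype.card (Later i) : ℝ)) : ℝ)) : ℂ) =
      1 / 2 / Fintype.card (Later i) := by
    rw [Complex.normSq_ofReal, div_mul_div_comm, Real.mul_self_sqrt (by positivity)]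
    field_simp
  have hvec : ((hybridRotation i (omega d j) * propagator (fullHamiltonian a c i) T) ^ d) *ᵥ
      ∑ l : Later i, bellVector S (toPair i l) s = ∑ l : Later i,
        Complex.exp (-(Complex.I * x l)) ^ d • embed (S.zero (toPair i l))
          (flipBit i (S.zero (toPair i l))) (((zRot (omega d j) *
            gate (trueParam S a c T (toPair i l, 0)) (trueParam S a c T (toPair i l, 1))
              (trueParam S a c T (toPair i l, 2))) ^ d) *ᵥ ![1, prepPhase s]) := by
    rw [Matrix.mulVec_sum]
    refine Finset.sum_congr rfl fun l _ => ?_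
    rw [bellVector_eq_embed]
    exact hx l _
  rw [bellProb_eq, hybridProb, born, hybridState, Matrix.mulVec_smul, hvec, Pi.smul_apply,
    smul_eq_mul, Complex.normSq_mul, hsq, Finset.sum_apply, Finset.sum_eq_single k']
  · rw [Pi.smul_apply, smul_eq_mul, Complex.normSq_mul, normSq_exp_neg_I_mul_pow, one_mul]
    have hne : S.zero (toPair i k') ≠ flipBit i (S.zero (toPair i k')) :=
      zero_ne_flipBit S (q := toPair i k') rfl
    have e : ∀ y : Fin 2 → ℂ, embed (S.zero (toPair i k')) (flipBit i (S.zero (toPair i k'))) y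
        (S.zero (toPair i k')) = y 0 := by
      intro y; simp [embed, hne]
    rw [e]
    change _ = 1 / 2 * _ / (Fintype.card (Later i) : ℝ)
    rw [mul_div_right_comm]
    rfl
  · intro l _ hl
    have h1 : S.zero (toPair i k') ≠ S.zero (toPair i l) := fun h =>
      hl (zero_toPair_injective S i h).symm
    have h2 : S.zero (toPair i k') ≠ flipBit i (S.zero (toPair i l)) :=
      zero_ne_flipBit S (q := toPair i l) rfl
    simp [embed, h1, h2]
  · simp

/-! ### First-order expansion of the angle estimators -/

/-- The Laplacian is the negative second difference with zero boundary values. -/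
lemma laplacian_mulVec {m : ℕ} (g : ℕ → ℝ) (h0 : g 0 = 0) (hm : g (m + 1) = 0) (k : Fin m) :
    (laplacian m *ᵥ fun l : Fin m => g ((l : ℕ) + 1)) k =
      2 * g ((k : ℕ) + 1) - g k - g ((k : ℕ) + 2) := by
  obtain ⟨k, hk⟩ := k
  have hterm : ∀ l : Fin m, laplacian m ⟨k, hk⟩ l * g ((l : ℕ) + 1) =
      (if k = (l : ℕ) then 2 * g ((l : ℕ) + 1) else 0) - (if k + 1 = (l : ℕ) then g ((l : ℕ) + 1) else 0) -
        (if k = (l : ℕ) + 1 then g ((l : ℕ) + 1) else 0) := by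
    intro l
    simp only [laplacian, Matrix.of_apply, Fin.ext_iff]
    by_cases h1 : k = (l : ℕ)
    · have h2 : ¬ k + 1 = (l : ℕ) := by omega
      have h3 : ¬ k = (l : ℕ) + 1 := by omega
      rw [if_pos h1, if_pos h1, if_neg h2, if_neg h3]; ring
    · by_cases h2 : k + 1 = (l : ℕ)
      · have h3 : ¬ k = (l : ℕ) + 1 := by omega
        rw [if_neg h1, if_pos (Or.inl h2), if_neg h1, if_pos h2, if_neg h3]; ring
      · by_cases h3 : k = (l : ℕ) + 1
        · rw [if_neg h1, if_pos (Or.inr h3.symm), if_neg h1, if_neg h2, if_pos h3]; ring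
        · rw [if_neg h1, if_neg (by tauto), if_neg h1, if_neg h2, if_neg h3]; ring
  rw [Matrix.mulVec, dotProduct]
  simp_rw [hterm]
  rw [Finset.sum_sub_distrib, Finset.sum_sub_distrib,
    Fin.sum_univ_eq_sum_range (fun l => if k = l then 2 * g (l + 1) else 0),
    Fin.sum_univ_eq_sum_range (fun l => if k + 1 = l then g (l + 1) else 0),
    Fin.sum_univ_eq_sum_range (fun l => if k = l + 1 then g (l + 1) else 0),
    Finset.sum_ite_eq, Finset.sum_ite_eq, if_pos (Finset.mem_range.mpr hk)]
  have e2 : (if k + 1 ∈ Finset.range m then g (k + 1 + 1) else 0) = g (k + 2) := by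
    split_ifs with h
    · rfl
    · have : k + 2 = m + 1 := by have := Finset.mem_range.not.mp h; omega
      rw [this, hm]
  have e3 : ∑ l ∈ Finset.range m, (if k = l + 1 then g (l + 1) else 0) = g k := by
    cases k with
    | zero => rw [h0]; exact Finset.sum_eq_zero fun l _ => if_neg (by omega)
    | succ k =>
      rw [Finset.sum_eq_single_of_mem k (Finset.mem_range.mpr (by omega)), if_pos rfl]
      intro l _ hl
      exact if_neg (by omega)
  rw [e2, e3]
  ring

/-- A vector in the kernel is a discrete harmonic function that vanishes at both ends, hence zero. -/
lemma isUnit_det_laplacian (m : ℕ) : IsUnit (laplacian m).det := by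
  rw [isUnit_iff_ne_zero]
  intro hdet
  obtain ⟨v, hv, hLv⟩ := Matrix.exists_mulVec_eq_zero_iff.mpr hdet
  let g : ℕ → ℝ := fun k => if h : 1 ≤ k ∧ k ≤ m then v ⟨k - 1, by omega⟩ else 0
  have hg : v = fun l : Fin m => g ((l : ℕ) + 1) := by
    ext l
    have : 1 ≤ (l : ℕ) + 1 ∧ (l : ℕ) + 1 ≤ m := ⟨by omega, l.2⟩
    simp only [g, dif_pos this]
    rfl
  have h0 : g 0 = 0 := by simp [g]
  have hm : g (m + 1) = 0 := by simp [g]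
  have hrec : ∀ k, k < m → g (k + 2) = 2 * g (k + 1) - g k := by
    intro k hk
    have h := laplacian_mulVec g h0 hm ⟨k, hk⟩
    rw [← hg, hLv] at h
    simp only [Pi.zero_apply] at h
    linarith
  -- a discrete harmonic function is linear
  have hlin : ∀ k, k ≤ m → g k = k * g 1 ∧ g (k + 1) = (k + 1) * g 1 := by
    intro k
    induction k with
    | zero => intro _; simp [h0]
    | succ k ih =>
      intro hk
      obtain ⟨i1, i2⟩ := ih (by omega)
      refine ⟨by push_cast; exact i2, ?_⟩
      rw [hrec k (by omega), i1, i2]; push_cast; ring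
  have h1 : g 1 = 0 := by
    have := (hlin m le_rfl).2
    rw [hm] at this
    have hne : (m : ℝ) + 1 ≠ 0 := by positivity
    exact (mul_eq_zero.mp this.symm).resolve_left hne
  apply hv
  rw [hg]
  ext l
  rw [(hlin l l.2.le).2, h1]; simp

lemma laplacian_isSymm (m : ℕ) : (laplacian m)ᵀ = laplacian m := by
  ext k l
  simp only [laplacian, Matrix.transpose_apply, Matrix.of_apply, eq_comm (a := l), or_comm]

lemma sum_range_mul_sub (M : ℝ) (j : ℕ) : ∑ k ∈ Finset.range j, ((k : ℝ) + 1) * (M - k) / 2 =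
    j * (j + 1) * (3 * M - 2 * (j - 1)) / 12 := by
  induction j with
  | zero => simp
  | succ j ih => rw [Finset.sum_range_succ, ih]; push_cast; ring

/-- The weights of the estimator of `ζ` are those of the inverse Laplacian. -/
lemma ones_dotProduct_laplacian_inv (m : ℕ) (x : Fin m → ℝ) :
    (fun _ => (1 : ℝ)) ⬝ᵥ ((laplacian m)⁻¹ *ᵥ x) =
      ∑ k : Fin m, (((k : ℕ) : ℝ) + 1) * (m - ((k : ℕ) : ℝ)) / 2 * x k := by
  set y : Fin m → ℝ := fun k => (((k : ℕ) : ℝ) + 1) * (m - ((k : ℕ) : ℝ)) / 2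
  have hLy : laplacian m *ᵥ y = fun _ => 1 := by
    ext k
    have h := laplacian_mulVec (m := m) (fun k => (k : ℝ) * (m + 1 - k) / 2) (by simp)
      (by push_cast; ring) k
    have e : y = fun l : Fin m => ((((l : ℕ) + 1 : ℕ) : ℝ) * (m + 1 - ((l : ℕ) + 1 : ℕ)) / 2) := by
      ext l; simp only [y]; push_cast; ring
    rw [e, h]; push_cast; ring
  have hyL : y ᵥ* laplacian m = fun _ => 1 := by
    rw [← hLy, ← Matrix.vecMul_transpose, laplacian_isSymm]
  have : (fun _ => (1 : ℝ)) ᵥ* (laplacian m)⁻¹ = y := by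
    rw [← hyL, Matrix.vecMul_vecMul, Matrix.mul_nonsing_inv _ (isUnit_det_laplacian m),
      Matrix.vecMul_one]
  rw [Matrix.dotProduct_mulVec, this]
  rfl

/-- Closed form of the phase estimator: `D⁻¹` applied to the constant vector is a parabola. -/
lemma zetaHat_eq {d : ℕ} (hd : 2 ≤ d) (h : Fin (2 * d - 1) → ℂ) :
    zetaHat d h = 6 / (((d : ℝ) - 1) * d * (d + 1)) *
      ∑ k : Fin (d - 1), (((k : ℕ) : ℝ) + 1) * ((d : ℝ) - 1 - ((k : ℕ) : ℝ)) / 2 * phaseDiff d h k := by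
  obtain ⟨m, rfl⟩ := Nat.exists_eq_add_of_le' (show 1 ≤ d by omega)
  have hS : (fun _ => (1 : ℝ)) ⬝ᵥ ((laplacian (m + 1 - 1))⁻¹ *ᵥ fun _ => (1 : ℝ)) =
      (m : ℝ) * (m + 1) * (m + 2) / 12 := by
    rw [ones_dotProduct_laplacian_inv]
    simp only [mul_one, Nat.add_sub_cancel]
    refine (Fin.sum_univ_eq_sum_range (fun k => ((k : ℝ) + 1) * ((m : ℝ) - k) / 2) m).trans ?_
    rw [sum_range_mul_sub]
    ring
  have hm : (m : ℝ) ≠ 0 := by exact_mod_cast (show m ≠ 0 by omega)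
  rw [zetaHat, hS, ones_dotProduct_laplacian_inv]
  simp only [Nat.add_sub_cancel, Nat.cast_add, Nat.cast_one, add_sub_cancel_right]
  have e1 : (m : ℝ) + 1 + 1 ≠ 0 := by positivity
  have e2 : (m : ℝ) + 2 ≠ 0 := by positivity
  have e3 : (m : ℝ) + 1 ≠ 0 := by positivity
  field_simp
  ring

/-- The `k`-th discrete Fourier coefficient as a real-linear functional. -/
def fourierCLM (d k : ℕ) : (Fin (2 * d - 1) → ℂ) →L[ℝ] ℂ :=
  LinearMap.toContinuousLinearMap
    { toFun := fun h => fourier d h k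
      map_add' := fun h h' => by
        simp only [fourier, Pi.add_apply, mul_add, Finset.sum_add_distrib]
      map_smul' := fun r h => by
        simp only [fourier, Pi.smul_apply, Complex.real_smul, RingHom.id_apply, Finset.mul_sum]
        exact Finset.sum_congr rfl fun j _ => by ring }

@[simp] lemma fourierCLM_apply (d k : ℕ) (h : Fin (2 * d - 1) → ℂ) :
    fourierCLM d k h = fourier d h k := rfl

lemma hasFDerivAt_fourier (d k : ℕ) (h : Fin (2 * d - 1) → ℂ) :
    HasFDerivAt (fun h => fourier d h k) (fourierCLM d k) h := (fourierCLM d k).hasFDerivAt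

/-- Coefficient of `Im (dz_k / z_k)` in the differential of `ζ̂`. -/
def zetaWeight (d k : ℕ) : ℝ := 3 * ((d : ℝ) - 1 - 2 * k) / (((d : ℝ) - 1) * d * (d + 1))

/-- Summation by parts, from weights of the phase differences to weights of the phases. -/
lemma sum_by_parts (m : ℕ) (ℓ : ℕ → ℝ) :
    ∑ k ∈ Finset.range m, ((k : ℝ) + 1) * ((m : ℝ) - k) / 2 * (ℓ k - ℓ (k + 1)) =
      ∑ k ∈ Finset.range (m + 1), ((m : ℝ) - 2 * k) / 2 * ℓ k := by
  have e : ∀ k : ℕ, ((m : ℝ) - 2 * k) / 2 * ℓ k = ((k : ℝ) + 1) * ((m : ℝ) - k) / 2 * ℓ k -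
      (k : ℝ) * ((m : ℝ) + 1 - k) / 2 * ℓ k := fun k => by ring
  simp_rw [e, Finset.sum_sub_distrib]
  rw [Finset.sum_range_succ (fun k : ℕ => ((k : ℝ) + 1) * ((m : ℝ) - k) / 2 * ℓ k),
    Finset.sum_range_succ' (fun k : ℕ => (k : ℝ) * ((m : ℝ) + 1 - k) / 2 * ℓ k)]
  simp only [sub_self, mul_zero, zero_div, zero_mul, add_zero, Nat.cast_zero,
    ← Finset.sum_sub_distrib]
  refine Finset.sum_congr rfl fun k _ => ?_
  push_cast; ring

/-- At the exact reconstruction function the estimator of `ζ` is exact, and its differential is a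
weighted sum of the relative perturbations of the Fourier coefficients. -/
lemma exists_hasFDerivAt_zetaHat {d : ℕ} (hd : 2 ≤ d) {h₀ : Fin (2 * d - 1) → ℂ} {H : ℕ → ℝ}
    {ζ : ℝ} (hF : ∀ k, k < d → fourier d h₀ k =
      Complex.I * H k * Complex.exp (-(Complex.I * ((2 * (k : ℂ) + 1) * ζ))))
    (hH : ∀ k, k + 1 < d → 0 < H k * H (k + 1)) (hζ : |ζ| < Real.pi / 2) :
    zetaHat d h₀ = ζ ∧ ∃ L : (Fin (2 * d - 1) → ℂ) →L[ℝ] ℝ, HasFDerivAt (zetaHat d) L h₀ ∧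
      ∀ δ, L δ = ∑ k ∈ Finset.range d, zetaWeight d k * (fourier d δ k / fourier d h₀ k).im := by
  have hne : ∀ k, k < d → fourier d h₀ k ≠ 0 := by
    intro k hk
    have hHk : H k ≠ 0 := by
      by_cases h : k + 1 < d
      · exact left_ne_zero_of_mul (hH k h).ne'
      · obtain ⟨l, rfl⟩ := Nat.exists_eq_add_of_le' (show 1 ≤ k by omega)
        exact right_ne_zero_of_mul (hH l (by omega)).ne'
    rw [hF k hk]
    have : (H k : ℂ) ≠ 0 := by exact_mod_cast hHk
    simp [this, Complex.exp_ne_zero]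
  have hprod : ∀ k, k + 1 < d → fourier d h₀ k * star (fourier d h₀ (k + 1)) =
      ((H k * H (k + 1) : ℝ) : ℂ) * Complex.exp (((2 * ζ : ℝ) : ℂ) * Complex.I) := by
    intro k hk
    rw [hF k (by omega), hF (k + 1) hk]
    simp only [star_mul', RCLike.star_def, Complex.conj_I, Complex.conj_ofReal,
      ← Complex.exp_conj]
    have h2 : (starRingEnd ℂ) 2 = 2 := map_ofNat (starRingEnd ℂ) 2
    have : Complex.exp (-(Complex.I * ((2 * (k : ℂ) + 1) * ζ))) *
        Complex.exp ((starRingEnd ℂ) (-(Complex.I * ((2 * ((k + 1 : ℕ) : ℂ) + 1) * ζ)))) =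
        Complex.exp (((2 * ζ : ℝ) : ℂ) * Complex.I) := by
      rw [← Complex.exp_add]; congr 1; simp [h2]; ring
    rw [← this]; push_cast
    linear_combination (-(H k : ℂ) * H (k + 1) *
      Complex.exp (-(Complex.I * ((2 * (k : ℂ) + 1) * ζ))) *
        Complex.exp ((starRingEnd ℂ) (-(Complex.I * ((2 * ((k : ℂ) + 1) + 1) * ζ))))) * Complex.I_sq
  have hζ2 : (Complex.exp (((2 * ζ : ℝ) : ℂ) * Complex.I)).arg = 2 * ζ := by
    have := abs_lt.mp hζ
    rw [Complex.arg_exp_mul_I, (toIocMod_eq_self Real.two_pi_pos).mpr ⟨by linarith, by linarith⟩]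
  -- consecutive coefficients have phases that differ by `2ζ`; the sign condition on `H` excludes an
  -- extra `π`, and `|ζ| < π / 2` keeps the argument off the branch cut
  have harg : ∀ k : Fin (d - 1), phaseDiff d h₀ k = 2 * ζ := by
    intro k
    rw [phaseDiff, hprod k (by omega), Complex.arg_real_mul _ (hH k (by omega)), hζ2]
  obtain ⟨m, rfl⟩ := Nat.exists_eq_add_of_le' (show 1 ≤ d by omega)
  have hm : (m : ℝ) ≠ 0 := by exact_mod_cast (show m ≠ 0 by omega)
  have hm1 : (m : ℝ) + 1 + 1 ≠ 0 := by positivity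
  have hm2 : (m : ℝ) + 1 ≠ 0 := by positivity
  constructor
  · rw [zetaHat_eq hd]
    simp_rw [harg, ← Finset.sum_mul]
    simp only [Nat.cast_add, Nat.cast_one, add_sub_cancel_right]
    have e := (Fin.sum_univ_eq_sum_range (fun k => ((k : ℝ) + 1) * ((m : ℝ) - k) / 2) m).trans
      (sum_range_mul_sub m m)
    refine (congrArg (fun x => 6 / ((m : ℝ) * (m + 1) * (m + 1 + 1)) * (x * (2 * ζ))) e).trans ?_
    field_simp
    ring
  have hphase : ∀ k : Fin (m + 1 - 1), ∃ L : (Fin (2 * (m + 1) - 1) → ℂ) →L[ℝ] ℝ,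
      HasFDerivAt (fun h => phaseDiff (m + 1) h k) L h₀ ∧ ∀ δ, L δ =
        (fourier (m + 1) δ k / fourier (m + 1) h₀ k).im -
          (fourier (m + 1) δ (k + 1) / fourier (m + 1) h₀ (k + 1)).im := by
    intro k
    set z := fourier (m + 1) h₀ k with hz
    set z' := fourier (m + 1) h₀ (k + 1) with hz'
    have hz0 : z ≠ 0 := hne k (by omega)
    have hz0' : z' ≠ 0 := hne (k + 1) (by omega)
    have hslit : z * star z' ∈ Complex.slitPlane := by
      rw [hprod k (by omega), Complex.mem_slitPlane_iff_arg]
      refine ⟨?_, ?_⟩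
      · rw [Complex.arg_real_mul _ (hH k (by omega)), hζ2]
        have := abs_lt.mp hζ
        linarith
      · have : ((H k * H (k + 1) : ℝ) : ℂ) ≠ 0 := by exact_mod_cast (hH k (by omega)).ne'
        exact mul_ne_zero this (Complex.exp_ne_zero _)
    have h1 := (hasFDerivAt_fourier (m + 1) k h₀).mul (hasFDerivAt_fourier (m + 1) (k + 1) h₀).star
    have h2 : HasFDerivAt Complex.log _ (z * star z') :=
      (Complex.hasStrictDerivAt_log hslit).hasDerivAt.hasFDerivAt.restrictScalars ℝ
    have h3 := Complex.imCLM.hasFDerivAt.comp h₀ (h2.comp h₀ h1)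
    refine ⟨_, h3.congr_of_eventuallyEq (Eventually.of_forall fun h => (Complex.log_im _).symm),
      fun δ => ?_⟩
    have hstar : star z' ≠ 0 := star_ne_zero.mpr hz0'
    have e : (fourier (m + 1) δ (k + 1) / z').im = -(star (fourier (m + 1) δ (k + 1)) / star z').im := by
      rw [← star_div₀, RCLike.star_def, Complex.conj_im, neg_neg]
    rw [e, sub_neg_eq_add, ← Complex.add_im]
    have e2 : fourier (m + 1) δ k / z + star (fourier (m + 1) δ (k + 1)) / star z' =
        (z * star (fourier (m + 1) δ (k + 1)) + star z' * fourier (m + 1) δ k) * (z * star z')⁻¹ := by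
      field_simp
      ring
    rw [e2]
    simp only [ContinuousLinearMap.comp_apply, ContinuousLinearMap.coe_restrictScalars', _root_.add_apply, _root_.smul_apply, ContinuousLinearMap.toSpanSingleton_apply, fourierCLM_apply, smul_eq_mul, Complex.imCLM_apply]
    rfl
  choose Lk hLk hLk' using hphase
  refine ⟨(6 / ((((m + 1 : ℕ) : ℝ) - 1) * (m + 1 : ℕ) * ((m + 1 : ℕ) + 1))) •
    ∑ k : Fin (m + 1 - 1), (((((k : ℕ) : ℝ) + 1) * (((m + 1 : ℕ) : ℝ) - 1 - ((k : ℕ) : ℝ)) / 2) •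
      Lk k), ?_, fun δ => ?_⟩
  · have := (HasFDerivAt.fun_sum fun (k : Fin (m + 1 - 1)) (_ : k ∈ Finset.univ) =>
      (hLk k).const_mul ((((k : ℕ) : ℝ) + 1) * (((m + 1 : ℕ) : ℝ) - 1 - ((k : ℕ) : ℝ)) / 2)).const_mul
        (6 / ((((m + 1 : ℕ) : ℝ) - 1) * (m + 1 : ℕ) * ((m + 1 : ℕ) + 1)))
    refine this.congr_of_eventuallyEq (Eventually.of_forall fun h => ?_)
    exact zetaHat_eq hd h
  · simp only [_root_.smul_apply, _root_.sum_apply, smul_eq_mul, hLk',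
      Nat.cast_add, Nat.cast_one, add_sub_cancel_right]
    set ℓ : ℕ → ℝ := fun k => (fourier (m + 1) δ k / fourier (m + 1) h₀ k).im
    have e := Fin.sum_univ_eq_sum_range
      (fun k => ((k : ℝ) + 1) * ((m : ℝ) - k) / 2 * (ℓ k - ℓ (k + 1))) m
    refine (congrArg (fun x => 6 / ((m : ℝ) * (m + 1) * (m + 1 + 1)) * x)
      (e.trans (sum_by_parts m ℓ))).trans ?_
    rw [Finset.mul_sum]
    refine Finset.sum_congr rfl fun k _ => ?_
    rw [zetaWeight]
    push_cast
    simp only [add_sub_cancel_right]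
    change _ = _ * ℓ k
    field_simp
    ring

/-- The differential of the estimator of `θ` need not be known exactly, only that it is bounded by
the mean perturbation of the Fourier coefficients. -/
lemma exists_hasFDerivAt_thetaHat {d : ℕ} {h₀ : Fin (2 * d - 1) → ℂ}
    (hne : ∀ k, k < d → fourier d h₀ k ≠ 0) :
    ∃ L : (Fin (2 * d - 1) → ℂ) →L[ℝ] ℝ, HasFDerivAt (thetaHat d) L h₀ ∧
      ∀ δ, |L δ| ≤ (1 / (d : ℝ)) * ∑ k : Fin d, ‖fourier d δ k‖ := by
  have h1 : ∀ k : Fin d, ∃ L : (Fin (2 * d - 1) → ℂ) →L[ℝ] ℝ,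
      HasFDerivAt (fun h => ‖fourier d h k‖) L h₀ ∧ ∀ δ, |L δ| ≤ ‖fourier d δ k‖ := by
    intro k
    have hn : DifferentiableAt ℝ (fun z : ℂ => ‖z‖) (fourier d h₀ k) :=
      (contDiffAt_norm ℝ (hne k k.2)).differentiableAt one_ne_zero
    refine ⟨_, hn.hasFDerivAt.comp h₀ (hasFDerivAt_fourier d k h₀), fun δ => ?_⟩
    rw [ContinuousLinearMap.comp_apply, fourierCLM_apply, ← Real.norm_eq_abs]
    refine (ContinuousLinearMap.le_opNorm _ _).trans ?_
    have : ‖fderiv ℝ (fun z : ℂ => ‖z‖) (fourier d h₀ k)‖ ≤ 1 := by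
      simpa using norm_fderiv_le_of_lipschitz ℝ (lipschitzWith_one_norm (E := ℂ))
    exact mul_le_of_le_one_left (norm_nonneg _) this
  choose L hL hL' using h1
  refine ⟨(1 / (d : ℝ)) • ∑ k, L k, ?_, fun δ => ?_⟩
  · exact (HasFDerivAt.fun_sum fun k _ => hL k).const_mul (1 / (d : ℝ))
  · rw [_root_.smul_apply, _root_.sum_apply, smul_eq_mul, abs_mul,
      abs_of_nonneg (by positivity)]
    gcongr
    exact (Finset.abs_sum_le_sum_abs _ _).trans (Finset.sum_le_sum fun k _ => hL' k δ)

/-! ### The round-by-round solution of the linear systems -/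

/-- The coefficient of `B_p / T` in the coupling recovered in round `i` for the pair `(i, j)`. -/
def recoverCoeff {n : ℕ} (S : SubspaceChoice n) (i j : Fin n) (p : Pair n) : ℝ :=
  recover S 1 (Pi.single p 1) i j

/-- The recovered couplings are linear in the splittings. -/
lemma recover_eq_sum {n : ℕ} (S : SubspaceChoice n) (T : ℝ) (B : Pair n → ℝ) (i j : Fin n) :
    recover S T B i j = ∑ p, recoverCoeff S i j p / T * B p := by
  induction i using WellFoundedLT.induction generalizing j with
  | ind i ih =>
    simp only [recoverCoeff] at ih ⊢
    rw [recover]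
    simp_rw [recover.eq_1 S 1 _ i j]
    split_ifs with h
    · have key : ∀ k : Later i, B (toPair i k) / T -
          ∑ l : {l : Fin n // l < i}, zzSign (S.zero (toPair i k)) i l.1 * recover S T B l.1 i =
          ∑ p, ((Pi.single p (1 : ℝ) : Pair n → ℝ) (toPair i k) / 1 -
            ∑ l : {l : Fin n // l < i}, zzSign (S.zero (toPair i k)) i l.1 *
              recover S 1 (Pi.single p 1) l.1 i) / T * B p := by
        intro k
        have e1 : B (toPair i k) / T =
            ∑ p, (Pi.single p (1 : ℝ) : Pair n → ℝ) (toPair i k) / T * B p := by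
          rw [Finset.sum_eq_single (toPair i k)]
          · rw [Pi.single_eq_same]; ring
          · intro p _ hp
            rw [Pi.single_eq_of_ne hp.symm]; ring
          · simp
        rw [e1]
        have ih' : ∀ l : {l : Fin n // l < i}, recover S T B l.1 i =
            ∑ p, recover S 1 (Pi.single p 1) l.1 i / T * B p := fun l => ih l.1 l.2 i
        simp_rw [ih']
        simp_rw [Finset.mul_sum, div_one, sub_div, sub_mul, Finset.sum_sub_distrib]
        congr 1
        rw [Finset.sum_comm]
        refine Finset.sum_congr rfl fun p _ => ?_
        rw [Finset.sum_div, Finset.sum_mul]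
        refine Finset.sum_congr rfl fun l _ => ?_
        ring
      simp_rw [key, Finset.mul_sum]
      rw [Finset.sum_comm]
      refine Finset.sum_congr rfl fun p _ => ?_
      rw [Finset.sum_div, Finset.sum_mul]
      refine Finset.sum_congr rfl fun k _ => ?_
      ring
    · simp

/-- Round `i` only uses the data of the rounds up to `i`. -/
lemma recoverCoeff_eq_zero {n : ℕ} (S : SubspaceChoice n) {i : Fin n} (j : Fin n) {p : Pair n}
    (hp : i < p.1.1) : recoverCoeff S i j p = 0 := by
  induction i using WellFoundedLT.induction generalizing j with
  | ind i ih =>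
    simp only [recoverCoeff] at ih ⊢
    rw [recover]
    split_ifs with h
    · refine Finset.sum_eq_zero fun k _ => ?_
      rw [Pi.single_eq_of_ne, Finset.sum_eq_zero]
      · simp
      · intro l _
        rw [ih l.1 l.2 _ (l.2.trans hp), mul_zero]
      · intro e
        rw [← e] at hp
        exact lt_irrefl _ hp
    · rfl

/-- The data of round `i` itself enter through the inverse of the matrix of that round. -/
lemma recoverCoeff_toPair {n : ℕ} (S : SubspaceChoice n) {i j : Fin n} (h : i < j) (k : Later i) :
    recoverCoeff S i j (toPair i k) = (coeffMatrix S.zero i)⁻¹ ⟨j, h⟩ k := by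
  rw [recoverCoeff, recover, dif_pos h, Finset.sum_eq_single k]
  · rw [Pi.single_eq_same, Finset.sum_eq_zero]
    · simp
    · intro l _
      have : recoverCoeff S l.1 i (toPair i k) = 0 := recoverCoeff_eq_zero S i l.2
      rw [recoverCoeff] at this
      rw [this, mul_zero]
  · intro k' _ hk'
    rw [Pi.single_eq_of_ne, Finset.sum_eq_zero]
    · simp
    · intro l _
      have : recoverCoeff S l.1 i (toPair i k) = 0 := recoverCoeff_eq_zero S i l.2
      rw [recoverCoeff] at this
      rw [this, mul_zero]
    · intro e
      apply hk'
      have := congrArg (fun p : Pair n => p.1.2) e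
      exact Subtype.ext this
  · simp

/-- No row of an inverse matrix vanishes, so every recovered coupling depends on the data. This
makes the Cramér–Rao bound positive. -/
lemma exists_recoverCoeff_ne_zero {n : ℕ} (S : SubspaceChoice n) (q : Pair n) :
    ∃ p, recoverCoeff S q.1.1 q.1.2 p ≠ 0 := by
  by_contra! H
  have hrow : ∀ k, (coeffMatrix S.zero q.1.1)⁻¹ ⟨q.1.2, q.2⟩ k = 0 := fun k => by
    rw [← recoverCoeff_toPair S q.2 k]; exact H _
  have := Matrix.nonsing_inv_mul _ (S.solvable q.1.1)
  have e := congrFun (congrFun this ⟨q.1.2, q.2⟩) ⟨q.1.2, q.2⟩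
  rw [Matrix.mul_apply] at e
  simp [hrow] at e

instance finite_subspaceChoice (n : ℕ) : Finite (SubspaceChoice n) :=
  Finite.of_injective (fun S : SubspaceChoice n => S.zero) fun S S' h => by
    cases S; cases S'; cases h; rfl

/-- There are finitely many choices of subspaces, so the coefficients are bounded in terms of
`n` alone. -/
lemma exists_abs_recoverCoeff_le (n : ℕ) :
    ∃ K : ℝ, 0 < K ∧ ∀ (S : SubspaceChoice n) (i j : Fin n) (p : Pair n),
      |recoverCoeff S i j p| ≤ K := by
  obtain ⟨K, hK⟩ := (Set.finite_range fun x : SubspaceChoice n × Fin n × Fin n × Pair n =>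
    |recoverCoeff x.1 x.2.1 x.2.2.1 x.2.2.2|).bddAbove
  exact ⟨max K 1, lt_max_of_lt_right one_pos, fun S i j p =>
    (hK ⟨(S, i, j, p), rfl⟩).trans (le_max_left _ _)⟩

/-! ### Fisher information and covariance of multinomial records -/

section Multinomial

variable {P Γ X : Type} [Fintype P] [Fintype Γ] [DecidableEq Γ] [Fintype X]

/-- The subspaces that share a circuit. -/
def fib (grp : P → Γ) (γ : Γ) : Finset P := Finset.univ.filter fun p => grp p = γ

/-- Variance of the linear statistic with coefficients `g` in one shot of every circuit, where
`π p x` is the probability of the outcome `p` in the circuit `(grp p, x)`. -/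
def covForm (grp : P → Γ) (π g : P → X → ℝ) : ℝ :=
  ∑ γ, ∑ x, (∑ p ∈ fib grp γ, π p x * g p x ^ 2 - (∑ p ∈ fib grp γ, π p x * g p x) ^ 2)

/-- Fisher information of one shot of every circuit in the direction in which the outcome
probabilities change by `δ`. -/
def infoForm (grp : P → Γ) (π δ : P → X → ℝ) : ℝ :=
  ∑ γ, ∑ x, (∑ p ∈ fib grp γ, δ p x ^ 2 / π p x +
    (∑ p ∈ fib grp γ, δ p x) ^ 2 / (1 - ∑ p ∈ fib grp γ, π p x))

/-- The covariance operator of the outcome indicators. -/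
def covOp (grp : P → Γ) (π g : P → X → ℝ) (p : P) (x : X) : ℝ :=
  π p x * (g p x - ∑ q ∈ fib grp (grp p), π q x * g q x)

/-- The squared Euclidean norm. -/
def sqNorm (y : P → X → ℝ) : ℝ := ∑ p, ∑ x, y p x ^ 2

lemma sum_fib (grp : P → Γ) (f : P → ℝ) : ∑ γ, ∑ p ∈ fib grp γ, f p = ∑ p, f p :=
  Finset.sum_fiberwise Finset.univ grp f

lemma sum_fib_sum (grp : P → Γ) (f : P → X → ℝ) :
    ∑ γ, ∑ x, ∑ p ∈ fib grp γ, f p x = ∑ p, ∑ x, f p x := by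
  rw [← sum_fib grp fun p => ∑ x, f p x]
  refine Finset.sum_congr rfl fun γ _ => ?_
  rw [Finset.sum_comm]

/-- Completing the square for one multinomial record with outcomes `s` and one further outcome. -/
lemma multinomial_square {ι : Type} (s : Finset ι) {w g δ : ι → ℝ} (hw : ∀ p ∈ s, w p ≠ 0)
    (h1 : 1 - ∑ p ∈ s, w p ≠ 0) :
    ∑ p ∈ s, (δ p - w p * (g p - ∑ q ∈ s, w q * g q)) ^ 2 / w p +
        (∑ p ∈ s, (δ p - w p * (g p - ∑ q ∈ s, w q * g q))) ^ 2 / (1 - ∑ p ∈ s, w p) =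
      (∑ p ∈ s, δ p ^ 2 / w p + (∑ p ∈ s, δ p) ^ 2 / (1 - ∑ p ∈ s, w p)) -
        2 * ∑ p ∈ s, g p * δ p + (∑ p ∈ s, w p * g p ^ 2 - (∑ p ∈ s, w p * g p) ^ 2) := by
  set G := ∑ q ∈ s, w q * g q with hG
  have e1 : ∑ p ∈ s, (δ p - w p * (g p - G)) ^ 2 / w p =
      ∑ p ∈ s, δ p ^ 2 / w p - 2 * ∑ p ∈ s, g p * δ p + 2 * G * ∑ p ∈ s, δ p +
        ∑ p ∈ s, w p * g p ^ 2 - 2 * G * G + G ^ 2 * ∑ p ∈ s, w p := by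
    have e : ∀ p ∈ s, (δ p - w p * (g p - G)) ^ 2 / w p =
        δ p ^ 2 / w p - 2 * (g p * δ p) + 2 * G * δ p + w p * g p ^ 2 - 2 * G * (w p * g p) +
          G ^ 2 * w p := by
      intro p hp
      field_simp [hw p hp]
      ring
    rw [Finset.sum_congr rfl e]
    simp only [Finset.sum_add_distrib, Finset.sum_sub_distrib, ← Finset.mul_sum]
    rw [← hG]
  have e2 : ∑ p ∈ s, (δ p - w p * (g p - G)) = ∑ p ∈ s, δ p - G * (1 - ∑ p ∈ s, w p) := by
    have : ∑ p ∈ s, w p * (g p - G) = G - (∑ p ∈ s, w p) * G := by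
      simp only [mul_sub, Finset.sum_sub_distrib, Finset.sum_mul, hG]
    rw [Finset.sum_sub_distrib, this]; ring
  rw [e1, e2]
  field_simp
  ring

/-- Completing the square: the information form is the inverse of the covariance form. -/
lemma infoForm_sub_covOp (grp : P → Γ) {π : P → X → ℝ} (hπ : ∀ p x, π p x ≠ 0)
    (h1 : ∀ γ x, 1 - ∑ p ∈ fib grp γ, π p x ≠ 0) (g δ : P → X → ℝ) :
    infoForm grp π (fun p x => δ p x - covOp grp π g p x) =
      infoForm grp π δ - 2 * ∑ p, ∑ x, g p x * δ p x + covForm grp π g := by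
  rw [← sum_fib_sum grp, infoForm, infoForm, covForm, Finset.mul_sum, ← Finset.sum_sub_distrib,
    ← Finset.sum_add_distrib]
  refine Finset.sum_congr rfl fun γ _ => ?_
  rw [Finset.mul_sum, ← Finset.sum_sub_distrib, ← Finset.sum_add_distrib]
  refine Finset.sum_congr rfl fun x _ => ?_
  rw [← multinomial_square (fib grp γ) (w := fun p => π p x) (g := fun p => g p x)
    (δ := fun p => δ p x) (fun p _ => hπ p x) (h1 γ x)]
  have : ∀ p ∈ fib grp γ, covOp grp π g p x =
      π p x * (g p x - ∑ q ∈ fib grp γ, π q x * g q x) := by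
    intro p hp
    rw [covOp, (Finset.mem_filter.mp hp).2]
  congr 1
  · exact Finset.sum_congr rfl fun p hp => by rw [this p hp]
  · rw [Finset.sum_congr rfl fun p hp => by rw [this p hp]]

lemma sqNorm_nonneg (y : P → X → ℝ) : 0 ≤ sqNorm y :=
  Finset.sum_nonneg fun _ _ => Finset.sum_nonneg fun _ _ => sq_nonneg _

lemma sqNorm_add_le (y z : P → X → ℝ) : sqNorm (y + z) ≤ 2 * sqNorm y + 2 * sqNorm z := by
  simp only [sqNorm, Finset.mul_sum, ← Finset.sum_add_distrib]
  refine Finset.sum_le_sum fun p _ => Finset.sum_le_sum fun x _ => ?_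
  simp only [Pi.add_apply]
  nlinarith [sq_nonneg (y p x - z p x)]

lemma sqNorm_neg (y : P → X → ℝ) : sqNorm (-y) = sqNorm y := by
  simp [sqNorm]

/-- A pointwise bound by a sum over the subspaces becomes a bound of Euclidean norms. -/
lemma sqNorm_le_of_abs_le {y z : P → X → ℝ} {C : ℝ}
    (h : ∀ p x, |y p x| ≤ C * ∑ q, |z q x|) :
    sqNorm y ≤ C ^ 2 * (Fintype.card P : ℝ) ^ 2 * sqNorm z := by
  have h1 : ∀ p x, y p x ^ 2 ≤ C ^ 2 * ((Fintype.card P : ℝ) * ∑ q, z q x ^ 2) := by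
    intro p x
    have e := sq_sum_le_card_mul_sum_sq (s := Finset.univ) (f := fun q => |z q x|)
    simp only [sq_abs, Finset.card_univ] at e
    calc y p x ^ 2 = |y p x| ^ 2 := (sq_abs _).symm
      _ ≤ (C * ∑ q, |z q x|) ^ 2 := pow_le_pow_left₀ (abs_nonneg _) (h p x) 2
      _ = C ^ 2 * (∑ q, |z q x|) ^ 2 := mul_pow _ _ _
      _ ≤ _ := by gcongr
  calc sqNorm y ≤ ∑ _p : P, ∑ x, C ^ 2 * ((Fintype.card P : ℝ) * ∑ q, z q x ^ 2) :=
        Finset.sum_le_sum fun p _ => Finset.sum_le_sum fun x _ => h1 p x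
    _ = _ := by
        simp only [sqNorm, Finset.sum_const, Finset.card_univ, nsmul_eq_mul, ← Finset.mul_sum]
        rw [Finset.sum_comm]; ring

lemma sq_sum_weight_le {ι : Type} (s : Finset ι) {w : ι → ℝ} (hw : ∀ p ∈ s, 0 ≤ w p) (g : ι → ℝ) :
    (∑ p ∈ s, w p * g p) ^ 2 ≤ (∑ p ∈ s, w p) * ∑ p ∈ s, w p * g p ^ 2 := by
  refine Finset.sum_sq_le_sum_mul_sum_of_sq_le_mul s hw
    (fun p hp => mul_nonneg (hw p hp) (sq_nonneg _)) fun p hp => ?_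
  exact le_of_eq (by ring)

lemma covForm_nonneg (grp : P → Γ) {π : P → X → ℝ} (h0 : ∀ p x, 0 ≤ π p x)
    (h1 : ∀ γ x, ∑ p ∈ fib grp γ, π p x ≤ 1) (g : P → X → ℝ) : 0 ≤ covForm grp π g := by
  refine Finset.sum_nonneg fun γ _ => Finset.sum_nonneg fun x _ => ?_
  have := sq_sum_weight_le (fib grp γ) (w := fun p => π p x) (fun p _ => h0 p x) fun p => g p x
  have h2 : 0 ≤ ∑ p ∈ fib grp γ, π p x * g p x ^ 2 :=
    Finset.sum_nonneg fun p _ => mul_nonneg (h0 p x) (sq_nonneg _)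
  nlinarith [h1 γ x]

lemma covForm_le (grp : P → Γ) {π : P → X → ℝ} (h1 : ∀ p x, π p x ≤ 1) (g : P → X → ℝ) :
    covForm grp π g ≤ sqNorm g := by
  rw [sqNorm, ← sum_fib_sum grp]
  refine Finset.sum_le_sum fun γ _ => Finset.sum_le_sum fun x _ => ?_
  refine (sub_le_self _ (sq_nonneg _)).trans (Finset.sum_le_sum fun p _ => ?_)
  nlinarith [h1 p x, sq_nonneg (g p x)]

lemma le_covForm (grp : P → Γ) {π : P → X → ℝ} {l t : ℝ} (hl : 0 ≤ l) (ht : t ≤ 1)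
    (h0 : ∀ p x, l ≤ π p x) (h1 : ∀ γ x, ∑ p ∈ fib grp γ, π p x ≤ t) (g : P → X → ℝ) :
    (1 - t) * l * sqNorm g ≤ covForm grp π g := by
  rw [sqNorm, ← sum_fib_sum grp, covForm, Finset.mul_sum]
  refine Finset.sum_le_sum fun γ _ => ?_
  rw [Finset.mul_sum]
  refine Finset.sum_le_sum fun x _ => ?_
  have := sq_sum_weight_le (fib grp γ) (w := fun p => π p x) (fun p _ => hl.trans (h0 p x))
    fun p => g p x
  have h2 : l * ∑ p ∈ fib grp γ, g p x ^ 2 ≤ ∑ p ∈ fib grp γ, π p x * g p x ^ 2 := by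
    rw [Finset.mul_sum]
    exact Finset.sum_le_sum fun p _ => by gcongr; exact h0 p x
  have h3 : 0 ≤ ∑ p ∈ fib grp γ, g p x ^ 2 := Finset.sum_nonneg fun p _ => sq_nonneg _
  have h4 : (∑ p ∈ fib grp γ, π p x) * ∑ p ∈ fib grp γ, π p x * g p x ^ 2 ≤
      t * ∑ p ∈ fib grp γ, π p x * g p x ^ 2 := by
    gcongr
    · exact (mul_nonneg hl h3).trans h2
    · exact h1 γ x
  nlinarith

lemma infoForm_nonneg (grp : P → Γ) {π : P → X → ℝ} (h0 : ∀ p x, 0 ≤ π p x)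
    (h1 : ∀ γ x, ∑ p ∈ fib grp γ, π p x ≤ 1) (δ : P → X → ℝ) : 0 ≤ infoForm grp π δ :=
  Finset.sum_nonneg fun γ _ => Finset.sum_nonneg fun x _ => add_nonneg
    (Finset.sum_nonneg fun p _ => div_nonneg (sq_nonneg _) (h0 p x))
    (div_nonneg (sq_nonneg _) (sub_nonneg.mpr (h1 γ x)))

lemma infoForm_le (grp : P → Γ) {π : P → X → ℝ} {l t : ℝ} (hl : 0 < l) (ht : t < 1)
    (h0 : ∀ p x, l ≤ π p x) (h1 : ∀ γ x, ∑ p ∈ fib grp γ, π p x ≤ t) (δ : P → X → ℝ) :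
    infoForm grp π δ ≤ (1 / l + Fintype.card P / (1 - t)) * sqNorm δ := by
  rw [sqNorm, ← sum_fib_sum grp, infoForm, Finset.mul_sum]
  refine Finset.sum_le_sum fun γ _ => ?_
  rw [Finset.mul_sum]
  refine Finset.sum_le_sum fun x _ => ?_
  rw [add_mul]
  refine add_le_add ?_ ?_
  · rw [Finset.mul_sum]
    refine Finset.sum_le_sum fun p _ => ?_
    rw [div_eq_mul_one_div, mul_comm]
    exact mul_le_mul_of_nonneg_right (one_div_le_one_div_of_le hl (h0 p x)) (sq_nonneg _)
  · have e := sq_sum_le_card_mul_sum_sq (s := fib grp γ) (f := fun p => δ p x)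
    have h3 : 0 ≤ ∑ p ∈ fib grp γ, δ p x ^ 2 := Finset.sum_nonneg fun p _ => sq_nonneg _
    have hc : ((fib grp γ).card : ℝ) ≤ Fintype.card P := by exact_mod_cast Finset.card_le_univ _
    rw [div_mul_eq_mul_div]
    have : 0 < 1 - t := by linarith
    gcongr
    · exact e.trans (by gcongr)
    · exact h1 γ x

lemma sqNorm_le_infoForm (grp : P → Γ) {π : P → X → ℝ} (h0 : ∀ p x, 0 < π p x)
    (h1 : ∀ γ x, ∑ p ∈ fib grp γ, π p x ≤ 1) (h2 : ∀ p x, π p x ≤ 1) (δ : P → X → ℝ) :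
    sqNorm δ ≤ infoForm grp π δ := by
  rw [sqNorm, ← sum_fib_sum grp]
  refine Finset.sum_le_sum fun γ _ => Finset.sum_le_sum fun x _ => ?_
  refine le_add_of_le_of_nonneg (Finset.sum_le_sum fun p _ => ?_)
    (div_nonneg (sq_nonneg _) (sub_nonneg.mpr (h1 γ x)))
  rw [le_div_iff₀ (h0 p x)]
  nlinarith [h2 p x, sq_nonneg (δ p x)]

/-- Polarization identity of the covariance form. -/
lemma covForm_add_mul (grp : P → Γ) (π g y : P → X → ℝ) (t : ℝ) :
    t * covForm grp π (g + y) + covForm grp π (t • g - y) =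
      (t + t ^ 2) * covForm grp π g + (1 + t) * covForm grp π y := by
  simp only [covForm, Finset.mul_sum, ← Finset.sum_add_distrib]
  refine Finset.sum_congr rfl fun γ _ => Finset.sum_congr rfl fun x _ => ?_
  simp only [Pi.add_apply, Pi.sub_apply, Pi.smul_apply, smul_eq_mul, mul_add, mul_sub,
    Finset.sum_add_distrib, Finset.sum_sub_distrib]
  have e1 : ∑ p ∈ fib grp γ, π p x * (g p x + y p x) ^ 2 = ∑ p ∈ fib grp γ, π p x * g p x ^ 2 +
      2 * ∑ p ∈ fib grp γ, π p x * g p x * y p x + ∑ p ∈ fib grp γ, π p x * y p x ^ 2 := by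
    rw [Finset.mul_sum, ← Finset.sum_add_distrib, ← Finset.sum_add_distrib]
    exact Finset.sum_congr rfl fun p _ => by ring
  have e2 : ∑ p ∈ fib grp γ, π p x * (t * g p x - y p x) ^ 2 =
      t ^ 2 * ∑ p ∈ fib grp γ, π p x * g p x ^ 2 -
      2 * t * ∑ p ∈ fib grp γ, π p x * g p x * y p x + ∑ p ∈ fib grp γ, π p x * y p x ^ 2 := by
    rw [Finset.mul_sum, Finset.mul_sum, ← Finset.sum_sub_distrib, ← Finset.sum_add_distrib]
    exact Finset.sum_congr rfl fun p _ => by ring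
  have e3 : ∑ p ∈ fib grp γ, π p x * (t * g p x) = t * ∑ p ∈ fib grp γ, π p x * g p x := by
    rw [Finset.mul_sum]
    exact Finset.sum_congr rfl fun p _ => by ring
  rw [e1, e2, e3]
  ring

/-- A small change of the statistic changes its variance little. -/
lemma abs_covForm_sub_le (grp : P → Γ) {π : P → X → ℝ} (h0 : ∀ p x, 0 ≤ π p x)
    (h1 : ∀ γ x, ∑ p ∈ fib grp γ, π p x ≤ 1) (g y : P → X → ℝ) {t : ℝ} (ht : 0 < t) :
    |covForm grp π (g + y) - covForm grp π g| ≤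
      t * covForm grp π g + (1 + 1 / t) * covForm grp π y := by
  have a1 := covForm_add_mul grp π g y t
  have a2 := covForm_add_mul grp π g y (-t)
  have n1 := covForm_nonneg grp h0 h1 (t • g - y)
  have n2 := covForm_nonneg grp h0 h1 (-t • g - y)
  have n3 := covForm_nonneg grp h0 h1 y
  set a := covForm grp π (g + y)
  set b := covForm grp π g
  set c := covForm grp π y
  have e : t * (t * b + (1 + 1 / t) * c) = t ^ 2 * b + (t + 1) * c := by field_simp
  rw [abs_le]
  constructor
  · refine le_of_mul_le_mul_left ?_ ht
    nlinarith
  · refine le_of_mul_le_mul_left ?_ ht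
    nlinarith

end Multinomial

/-! ### The Cramér–Rao quadratic form -/

/-- Variational lower bound for `u J⁻¹ u`; it needs a single direction `v`, not the inverse. -/
lemma two_mul_dotProduct_sub_le {P : Type} [Fintype P] [DecidableEq P] {J : Matrix P P ℝ}
    (hJ : J.PosDef) (u v : P → ℝ) : 2 * (u ⬝ᵥ v) - v ⬝ᵥ (J *ᵥ v) ≤ u ⬝ᵥ (J⁻¹ *ᵥ u) := by
  have hdet := (Matrix.isUnit_iff_isUnit_det J).mp hJ.isUnit
  have h := hJ.posSemidef.dotProduct_mulVec_nonneg (v - J⁻¹ *ᵥ u)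
  have hT : Jᵀ = J := by simpa using hJ.isHermitian.eq
  have e1 : J *ᵥ (J⁻¹ *ᵥ u) = u := by
    rw [Matrix.mulVec_mulVec, Matrix.mul_nonsing_inv _ hdet, Matrix.one_mulVec]
  have e2 : (J⁻¹ *ᵥ u) ⬝ᵥ (J *ᵥ v) = u ⬝ᵥ v := by
    rw [Matrix.dotProduct_mulVec, ← Matrix.mulVec_transpose, hT, e1]
  simp only [star_trivial, Matrix.mulVec_sub, e1, dotProduct_sub, sub_dotProduct, e2] at h
  rw [dotProduct_comm v u, dotProduct_comm (J⁻¹ *ᵥ u) u] at h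
  linarith

/-- At `v = J⁻¹ u` the information form takes the value of the Cramér–Rao form. -/
lemma inv_mulVec_form {P : Type} [Fintype P] [DecidableEq P] {J : Matrix P P ℝ}
    (hJ : J.PosDef) (u : P → ℝ) :
    (J⁻¹ *ᵥ u) ⬝ᵥ (J *ᵥ (J⁻¹ *ᵥ u)) = u ⬝ᵥ (J⁻¹ *ᵥ u) := by
  have hdet := (Matrix.isUnit_iff_isUnit_det J).mp hJ.isUnit
  rw [Matrix.mulVec_mulVec, Matrix.mul_nonsing_inv _ hdet, Matrix.one_mulVec, dotProduct_comm]

lemma cramerRao_smul {P : Type} [Fintype P] [DecidableEq P] {J : Matrix P P ℝ}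
    (hJ : J.PosDef) (ψ : (P → ℝ) → ℝ) (ξ : P → ℝ) {N : ℝ} (hN : N ≠ 0) :
    cramerRao (N • J) ψ ξ = cramerRao J ψ ξ / N := by
  have hdet := (Matrix.isUnit_iff_isUnit_det J).mp hJ.isUnit
  have : (N • J)⁻¹ = N⁻¹ • J⁻¹ := by
    refine Matrix.inv_eq_left_inv ?_
    rw [Matrix.smul_mul, Matrix.mul_smul, smul_smul, inv_mul_cancel₀ hN, one_smul,
      Matrix.nonsing_inv_mul _ hdet]
  rw [cramerRao, this, Matrix.smul_mulVec, dotProduct_smul, cramerRao, smul_eq_mul, inv_mul_eq_div]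

/-! ### Records that are close to ideal -/

section Compare

variable {P Γ X : Type} [Fintype P] [Fintype Γ] [DecidableEq Γ] [Fintype X]

/-- The number of subspaces that share the circuits of `p`. -/
def mult (grp : P → Γ) (p : P) : ℝ := (fib grp (grp p)).card

/-- The covariance operator when each of the `mult grp p` outcomes has probability
`1 / (2 * mult grp p)`. -/
def idealCov (grp : P → Γ) (g : P → X → ℝ) (p : P) (x : X) : ℝ :=
  1 / (2 * mult grp p) * (g p x - 1 / (2 * mult grp p) * ∑ q ∈ fib grp (grp p), g q x)

lemma one_le_mult (grp : P → Γ) (p : P) : 1 ≤ mult grp p := by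
  have : 0 < (fib grp (grp p)).card := Finset.card_pos.mpr ⟨p, by simp [fib]⟩
  rw [mult]
  exact_mod_cast this

lemma mult_le (grp : P → Γ) (p : P) : mult grp p ≤ Fintype.card P := by
  rw [mult]
  exact_mod_cast Finset.card_le_univ _

lemma mult_congr (grp : P → Γ) {p q : P} (h : grp p = grp q) : mult grp p = mult grp q := by
  rw [mult, mult, h]

/-- The outcome probabilities are close to those of the ideal record. -/
def NearIdeal (grp : P → Γ) (η : ℝ) (π : P → X → ℝ) : Prop :=
  ∀ p x, |π p x - 1 / (2 * mult grp p)| ≤ 4 * η / mult grp p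

variable {grp : P → Γ} {η : ℝ} {π : P → X → ℝ}

lemma NearIdeal.bounds (h : NearIdeal grp η π) (hη : η ≤ 1 / 100) (p : P) (x : X) :
    46 / 100 / mult grp p ≤ π p x ∧ π p x ≤ 54 / 100 / mult grp p := by
  have hM := one_le_mult grp p
  have hM0 : 0 < mult grp p := by linarith
  have h1 := abs_le.mp (h p x)
  have h2 : 4 * η / mult grp p ≤ 4 / 100 / mult grp p := by gcongr; linarith
  have h3 : 1 / (2 * mult grp p) = 50 / 100 / mult grp p := by field_simp; norm_num
  rw [h3] at h1
  have h4 : 46 / 100 / mult grp p = 50 / 100 / mult grp p - 4 / 100 / mult grp p := by ring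
  have h5 : 54 / 100 / mult grp p = 50 / 100 / mult grp p + 4 / 100 / mult grp p := by ring
  rw [h4, h5]
  constructor <;> linarith [h1.1, h1.2]

lemma NearIdeal.pos (h : NearIdeal grp η π) (hη : η ≤ 1 / 100) (p : P) (x : X) : 0 < π p x :=
  lt_of_lt_of_le (div_pos (by norm_num) (by linarith [one_le_mult grp p])) (h.bounds hη p x).1

lemma NearIdeal.le_one (h : NearIdeal grp η π) (hη : η ≤ 1 / 100) (p : P) (x : X) :
    π p x ≤ 1 := by
  refine (h.bounds hη p x).2.trans ?_
  have := one_le_mult grp p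
  rw [div_le_one (by linarith)]
  linarith

lemma NearIdeal.sum_le (h : NearIdeal grp η π) (hη : η ≤ 1 / 100) (γ : Γ) (x : X) :
    ∑ p ∈ fib grp γ, π p x ≤ 54 / 100 := by
  rcases Finset.eq_empty_or_nonempty (fib grp γ) with h0 | ⟨q, hq⟩
  · rw [h0]; norm_num
  have hq' : grp q = γ := (Finset.mem_filter.mp hq).2
  have hM := one_le_mult grp q
  calc ∑ p ∈ fib grp γ, π p x ≤ ∑ _p ∈ fib grp γ, 54 / 100 / mult grp q := by
        refine Finset.sum_le_sum fun p hp => ?_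
        rw [mult_congr grp (hq'.trans (Finset.mem_filter.mp hp).2.symm)]
        exact (h.bounds hη p x).2
    _ = mult grp q * (54 / 100 / mult grp q) := by
        rw [Finset.sum_const, nsmul_eq_mul, mult, hq']
    _ = 54 / 100 := by field_simp

lemma NearIdeal.inv_le (h : NearIdeal grp η π) (hη : η ≤ 1 / 100) (p : P) (x : X) :
    46 / 100 / (Fintype.card P : ℝ) ≤ π p x := by
  have h1 := one_le_mult grp p
  have h2 := mult_le grp p
  refine le_trans ?_ (h.bounds hη p x).1
  gcongr

lemma NearIdeal.le_covForm [Nonempty P] (h : NearIdeal grp η π) (hη : η ≤ 1 / 100)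
    (g : P → X → ℝ) : sqNorm g ≤ 5 * Fintype.card P * covForm grp π g := by
  have hK : 0 < (Fintype.card P : ℝ) := by exact_mod_cast Fintype.card_pos
  have := HamLearn.le_covForm grp (l := 46 / 100 / (Fintype.card P : ℝ)) (t := 54 / 100)
    (by positivity) (by norm_num) (h.inv_le hη) (h.sum_le hη) g
  have e : (1 - 54 / 100) * (46 / 100 / (Fintype.card P : ℝ)) * sqNorm g =
      2116 / 10000 * sqNorm g / Fintype.card P := by ring
  rw [e, div_le_iff₀ hK] at this
  nlinarith [sqNorm_nonneg g]

lemma NearIdeal.infoForm_le [Nonempty P] (h : NearIdeal grp η π) (hη : η ≤ 1 / 100)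
    (δ : P → X → ℝ) : infoForm grp π δ ≤ 6 * Fintype.card P * sqNorm δ := by
  have hK : 0 < (Fintype.card P : ℝ) := by exact_mod_cast Fintype.card_pos
  refine (HamLearn.infoForm_le grp (l := 46 / 100 / (Fintype.card P : ℝ)) (t := 54 / 100)
    (by positivity) (by norm_num) (h.inv_le hη) (h.sum_le hη) δ).trans ?_
  refine mul_le_mul_of_nonneg_right ?_ (sqNorm_nonneg δ)
  have : 1 / (46 / 100 / (Fintype.card P : ℝ)) + (Fintype.card P : ℝ) / (1 - 54 / 100) =
      (Fintype.card P : ℝ) * (200 / 46) := by field_simp; norm_num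
  rw [this]
  nlinarith

lemma NearIdeal.sqNorm_covOp_le (h : NearIdeal grp η π) (hη : η ≤ 1 / 100)
    (y : P → X → ℝ) :
    sqNorm (covOp grp π y) ≤ 4 * (Fintype.card P : ℝ) ^ 2 * sqNorm y := by
  have := sqNorm_le_of_abs_le (y := covOp grp π y) (z := y) (C := 2) ?_
  · norm_num at this; exact this
  intro p x
  have h1 : |∑ q ∈ fib grp (grp p), π q x * y q x| ≤ ∑ q, |y q x| := by
    refine (Finset.abs_sum_le_sum_abs _ _).trans
      ((Finset.sum_le_sum fun q _ => ?_).trans (Finset.sum_le_sum_of_subset_of_nonneg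
        (Finset.subset_univ _) fun _ _ _ => abs_nonneg _))
    rw [abs_mul, abs_of_pos (h.pos hη q x)]
    exact mul_le_of_le_one_left (abs_nonneg _) (h.le_one hη q x)
  have h2 : |y p x| ≤ ∑ q, |y q x| :=
    Finset.single_le_sum (f := fun q => |y q x|) (fun _ _ => abs_nonneg _) (Finset.mem_univ p)
  rw [covOp, abs_mul, abs_of_pos (h.pos hη p x)]
  refine (mul_le_of_le_one_left (abs_nonneg _) (h.le_one hη p x)).trans ?_
  refine (abs_sub _ _).trans ?_
  linarith

lemma NearIdeal.sqNorm_covOp_sub_le (h : NearIdeal grp η π) (hη : η ≤ 1 / 100) (hη0 : 0 ≤ η)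
    (y : P → X → ℝ) : sqNorm (covOp grp π y - idealCov grp y) ≤
      144 * η ^ 2 * (Fintype.card P : ℝ) ^ 2 * sqNorm y := by
  have := sqNorm_le_of_abs_le (y := covOp grp π y - idealCov grp y) (z := y) (C := 12 * η) ?_
  · rw [mul_pow] at this; norm_num at this; exact this
  intro p x
  have hdev : ∀ q, |π q x - 1 / (2 * mult grp q)| ≤ 4 * η := fun q => by
    refine (h q x).trans (div_le_self (by positivity) (one_le_mult grp q))
  have hm : ∀ q, |1 / (2 * mult grp q)| ≤ 1 := fun q => by
    have := one_le_mult grp q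
    rw [abs_of_nonneg (by positivity), div_le_one (by positivity)]
    linarith
  have hpos := h.pos hη
  have h1 : |∑ q ∈ fib grp (grp p),
      (π p x * π q x - 1 / (2 * mult grp p) * (1 / (2 * mult grp p))) * y q x| ≤
      8 * η * ∑ q, |y q x| := by
    rw [Finset.mul_sum]
    refine (Finset.abs_sum_le_sum_abs _ _).trans
      ((Finset.sum_le_sum fun q hq => ?_).trans (Finset.sum_le_sum_of_subset_of_nonneg
        (Finset.subset_univ _) fun _ _ _ => by positivity))
    rw [abs_mul]
    refine mul_le_mul_of_nonneg_right ?_ (abs_nonneg _)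
    have e : π p x * π q x - 1 / (2 * mult grp p) * (1 / (2 * mult grp p)) =
        (π p x - 1 / (2 * mult grp p)) * π q x +
          1 / (2 * mult grp p) * (π q x - 1 / (2 * mult grp p)) := by ring
    rw [e]
    refine (abs_add_le _ _).trans ?_
    rw [abs_mul, abs_mul, abs_of_pos (hpos q x)]
    have hq' := hdev q
    rw [mult_congr grp (Finset.mem_filter.mp hq).2] at hq'
    have a1 := mul_le_mul (hdev p) (h.le_one hη q x) (hpos q x).le (by positivity)
    have a2 := mul_le_mul (hm p) hq' (abs_nonneg _) zero_le_one
    linarith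
  have h2 : |y p x| ≤ ∑ q, |y q x| :=
    Finset.single_le_sum (f := fun q => |y q x|) (fun _ _ => abs_nonneg _) (Finset.mem_univ p)
  have e : (covOp grp π y - idealCov grp y) p x = (π p x - 1 / (2 * mult grp p)) * y p x -
      ∑ q ∈ fib grp (grp p),
        (π p x * π q x - 1 / (2 * mult grp p) * (1 / (2 * mult grp p))) * y q x := by
    simp only [Pi.sub_apply, covOp, idealCov, sub_mul, Finset.sum_sub_distrib, mul_assoc,
      ← Finset.mul_sum]
    ring
  rw [e]
  refine (abs_sub _ _).trans ?_
  rw [abs_mul]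
  have a3 := mul_le_mul (hdev p) h2 (abs_nonneg _) (by positivity)
  linarith

/-- If the linear statistic `g`, its competitor `g'`, and the response `δ` are all close to the
reference `g₀`, then `g` and `g'` have nearly the same variance, and `δ` nearly attains equality
in the Cramér–Rao inequality for `g`. -/
theorem NearIdeal.compare [Nonempty P] (h : NearIdeal grp η π) (hη : η ≤ 1 / 100) (hη0 : 0 < η)
    {C : ℝ} (hC : 1 ≤ C) (hCη : C * η ^ 2 ≤ 1 / 8) {g g' g₀ δ : P → X → ℝ}
    (hg : sqNorm (g - g₀) ≤ C * η ^ 2 * sqNorm g₀) (hg' : sqNorm (g' - g₀) ≤ C * η ^ 2 * sqNorm g₀)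
    (hδ : sqNorm (δ - idealCov grp g₀) ≤ C * η ^ 2 * sqNorm g₀) :
    covForm grp π g' ≤ 3 * sqNorm g₀ ∧
    sqNorm g₀ ≤ 20 * Fintype.card P * covForm grp π g ∧
    |covForm grp π g' - covForm grp π g| ≤
      60000 * (Fintype.card P : ℝ) ^ 4 * C * η * covForm grp π g ∧
    infoForm grp π (fun p x => δ p x - covOp grp π g p x) ≤
      60000 * (Fintype.card P : ℝ) ^ 4 * C * η * covForm grp π g := by
  set K : ℝ := (Fintype.card P : ℝ) with hK
  have hK1 : 1 ≤ K := by rw [hK]; exact_mod_cast Fintype.card_pos (α := P)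
  set R := sqNorm g₀ with hR
  have hR0 : 0 ≤ R := sqNorm_nonneg _
  have hpos : ∀ p x, 0 ≤ π p x := fun p x => (h.pos hη p x).le
  have hsum : ∀ γ x, ∑ p ∈ fib grp γ, π p x ≤ 1 := fun γ x => (h.sum_le hη γ x).trans (by norm_num)
  have hsmall : C * η ^ 2 * R ≤ 1 / 8 * R := by gcongr
  have hRW : R ≤ 20 * K * covForm grp π g := by
    have a1 := sqNorm_add_le g (-(g - g₀))
    rw [sqNorm_neg, ← sub_eq_add_neg, sub_sub_cancel] at a1
    have a2 := h.le_covForm hη g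
    rw [← hR] at a1
    rw [← hK] at a2
    nlinarith
  set W := covForm grp π g with hW
  have hW0 : 0 ≤ W := covForm_nonneg grp hpos hsum g
  have hK4 : K ≤ K ^ 4 := le_self_pow₀ hK1 (by norm_num)
  refine ⟨?_, hRW, ?_, ?_⟩
  · have a1 := sqNorm_add_le g₀ (g' - g₀)
    rw [add_sub_cancel] at a1
    have a2 := covForm_le grp (h.le_one hη) g'
    rw [← hR] at a1
    linarith
  · have a1 := abs_covForm_sub_le grp hpos hsum g (g' - g) hη0
    rw [add_sub_cancel, ← hW] at a1
    refine a1.trans ?_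
    have a2 : sqNorm (g' - g) ≤ 4 * (C * η ^ 2 * R) := by
      have := sqNorm_add_le (g' - g₀) (-(g - g₀))
      rw [sqNorm_neg, ← sub_eq_add_neg, sub_sub_sub_cancel_right] at this
      linarith
    have a3 := covForm_le grp (h.le_one hη) (g' - g)
    have a4 : (1 + 1 / η) * covForm grp π (g' - g) ≤ 8 * C * η * R := by
      calc (1 + 1 / η) * covForm grp π (g' - g) ≤ (1 + 1 / η) * (4 * (C * η ^ 2 * R)) := by
            gcongr; linarith
        _ = 4 * C * η * R * (η + 1) := by field_simp
        _ ≤ 4 * C * η * R * 2 := by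
            gcongr; linarith
        _ = _ := by ring
    have a5 : 8 * C * η * R ≤ 160 * (K * C * η * W) := by
      calc 8 * C * η * R ≤ 8 * C * η * (20 * K * W) := by gcongr
        _ = _ := by ring
    have a6 : K * C * η * W ≤ K ^ 4 * C * η * W := by gcongr
    have a7 : 1 * 1 * η * W ≤ K ^ 4 * C * η * W := by
      gcongr
      exact one_le_pow₀ hK1
    nlinarith
  · have a1 := sqNorm_add_le ((δ - idealCov grp g₀) + -(covOp grp π g₀ - idealCov grp g₀))
      (-(covOp grp π (g - g₀)))
    have a2 := sqNorm_add_le (δ - idealCov grp g₀) (-(covOp grp π g₀ - idealCov grp g₀))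
    rw [sqNorm_neg] at a1 a2
    have a3 := h.sqNorm_covOp_sub_le hη hη0.le g₀
    have a4 := h.sqNorm_covOp_le hη (g - g₀)
    -- `δ - Σ g` is the sum of three errors: of `δ` against the ideal covariance of `g₀`, of the
    -- covariance operator against the ideal one, and of `g` against `g₀`
    have e : (δ - idealCov grp g₀) + -(covOp grp π g₀ - idealCov grp g₀) +
        -(covOp grp π (g - g₀)) = fun p x => δ p x - covOp grp π g p x := by
      funext p x
      simp only [Pi.add_apply, Pi.sub_apply, Pi.neg_apply, covOp, mul_sub,
        Finset.sum_sub_distrib]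
      ring
    rw [e] at a1
    rw [← hR, ← hK] at a3
    rw [← hK] at a4
    have a5 := h.infoForm_le hη (fun p x => δ p x - covOp grp π g p x)
    rw [← hK] at a5
    set Q := η ^ 2 * R with hQ
    have hQ0 : 0 ≤ Q := by positivity
    have hKC : K ^ 2 * Q ≤ K ^ 2 * C * Q := by
      have : K ^ 2 * 1 * Q ≤ K ^ 2 * C * Q := by gcongr
      linarith
    have hKC2 : 1 * C * Q ≤ K ^ 2 * C * Q := by
      gcongr; exact one_le_pow₀ hK1
    have b1 : 4 * K ^ 2 * sqNorm (g - g₀) ≤ 4 * K ^ 2 * (C * Q) := by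
      gcongr; rw [hQ]; linarith
    have b2 : sqNorm (fun p x => δ p x - covOp grp π g p x) ≤ 588 * (K ^ 2 * C * Q) := by
      have : sqNorm (δ - idealCov grp g₀) ≤ C * Q := by rw [hQ]; linarith
      have : 144 * η ^ 2 * K ^ 2 * R = 144 * (K ^ 2 * Q) := by rw [hQ]; ring
      nlinarith
    have b3 : Q ≤ 1 / 100 * η * (20 * K * W) := by
      rw [hQ, sq]; gcongr
    calc _ ≤ 6 * K * (588 * (K ^ 2 * C * (1 / 100 * η * (20 * K * W)))) := by
          refine a5.trans ?_
          gcongr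
          refine b2.trans ?_
          gcongr
      _ = 705.6 * (K ^ 4 * C * η * W) := by ring
      _ ≤ _ := by nlinarith [show 0 ≤ K ^ 4 * C * η * W by positivity]

end Compare

/-! ### The record of one subspace -/

/-- Real part for the initial state `|+⟩`, imaginary part for `|i⟩`. -/
def comp (s : Bool) (z : ℂ) : ℝ := if s then z.im else z.re

lemma comp_add (s : Bool) (z w : ℂ) : comp s (z + w) = comp s z + comp s w := by
  cases s <;> simp [comp]

lemma comp_sub (s : Bool) (z w : ℂ) : comp s (z - w) = comp s z - comp s w := by
  cases s <;> simp [comp]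

lemma comp_smul (s : Bool) (r : ℝ) (z : ℂ) : comp s ((r : ℂ) * z) = r * comp s z := by
  cases s <;> simp [comp]

lemma abs_comp_le (s : Bool) (z : ℂ) : |comp s z| ≤ ‖z‖ := by
  cases s
  · exact Complex.abs_re_le_norm z
  · exact Complex.abs_im_le_norm z

lemma synth_sub (d : ℕ) (a b : ℤ → ℂ) (j : Fin (2 * d - 1)) :
    synth d (fun m => a m - b m) j = synth d a j - synth d b j := by
  simp only [synth, sub_mul, Finset.sum_sub_distrib]

lemma synth_smul (d : ℕ) (r : ℂ) (a : ℤ → ℂ) (j : Fin (2 * d - 1)) :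
    synth d (fun m => r * a m) j = r * synth d a j := by
  simp only [synth, Finset.mul_sum, mul_assoc]

/-- Parseval's identity for the two-component record. -/
lemma sum_comp_synth_mul {d : ℕ} (hd : 1 ≤ d) (a b : ℤ → ℂ) :
    ∑ x : Bool × Fin (2 * d - 1), comp x.1 (synth d a x.2) * comp x.1 (synth d b x.2) =
      (2 * (d : ℝ) - 1) * ∑ m ∈ band d, (star (a m) * b m).re := by
  have h := congrArg Complex.re (sum_star_synth_mul hd a b)
  have e : (2 * (d : ℂ) - 1) = ((2 * (d : ℝ) - 1 : ℝ) : ℂ) := by push_cast; rfl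
  rw [e, Complex.re_ofReal_mul, Complex.re_sum, Complex.re_sum] at h
  rw [← h, Fintype.sum_prod_type, Fintype.sum_bool, ← Finset.sum_add_distrib]
  refine Finset.sum_congr rfl fun j _ => ?_
  simp [comp]
  ring

lemma sum_comp_synth_sq {d : ℕ} (hd : 1 ≤ d) (a : ℤ → ℂ) :
    ∑ x : Bool × Fin (2 * d - 1), comp x.1 (synth d a x.2) ^ 2 =
      (2 * (d : ℝ) - 1) * ∑ m ∈ band d, ‖a m‖ ^ 2 := by
  simp_rw [sq (comp _ _)]
  rw [sum_comp_synth_mul hd]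
  congr 1
  refine Finset.sum_congr rfl fun m _ => ?_
  rw [← Complex.normSq_eq_norm_sq, RCLike.star_def, ← Complex.normSq_eq_conj_mul_self,
    Complex.ofReal_re]

lemma sum_band_ite (d : ℕ) (f : ℤ → ℝ) :
    ∑ m ∈ band d, (if 0 ≤ m then f m else 0) = ∑ k ∈ Finset.range d, f k := by
  rw [← Finset.sum_filter]
  refine (Finset.sum_bij (fun (k : ℕ) _ => (k : ℤ)) ?_ ?_ ?_ ?_).symm
  · intro k hk
    have := Finset.mem_range.mp hk
    simp only [Finset.mem_filter, Finset.mem_Ioo]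
    omega
  · intro k _ l _ h
    exact_mod_cast h
  · intro m hm
    simp only [Finset.mem_filter, Finset.mem_Ioo] at hm
    exact ⟨m.toNat, Finset.mem_range.mpr (by omega), by omega⟩
  · intro k _; rfl

/-- The antisymmetric weights `2m + 1 - d` on `0, …, d - 1`. -/
def wt (d : ℕ) (m : ℤ) : ℝ := 2 * m + 1 - d

/-- The inverse of the sum of the squares of the weights. -/
def kap (d : ℕ) : ℝ := 3 / (((d : ℝ) - 1) * d * (d + 1))

lemma kap_pos {d : ℕ} (hd : 2 ≤ d) : 0 < kap d := by
  have : (2 : ℝ) ≤ d := by exact_mod_cast hd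
  have : 0 < (d : ℝ) - 1 := by linarith
  unfold kap; positivity

lemma sum_wt (d : ℕ) : ∑ k ∈ Finset.range d, wt d k = 0 := by
  have : ∀ m : ℕ, ∑ k ∈ Finset.range m, (2 * (k : ℝ) + 1 - d) = m ^ 2 - d * m := by
    intro m
    induction m with
    | zero => simp
    | succ m ih => rw [Finset.sum_range_succ, ih]; push_cast; ring
  simp only [wt, Int.cast_natCast]
  rw [this]; ring

lemma sum_wt_sq {d : ℕ} (hd : 2 ≤ d) : ∑ k ∈ Finset.range d, wt d k ^ 2 = 1 / kap d := by
  have hsum : ∀ m : ℕ, ∑ k ∈ Finset.range m, (2 * (k : ℝ) + 1 - d) ^ 2 =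
      (m : ℝ) * (4 * (m : ℝ) ^ 2 - 1) / 3 - 2 * d * (m : ℝ) ^ 2 + (d : ℝ) ^ 2 * m := by
    intro m
    induction m with
    | zero => simp
    | succ m ih => rw [Finset.sum_range_succ, ih]; push_cast; ring
  simp only [wt, Int.cast_natCast, kap]
  have : (2 : ℝ) ≤ d := by exact_mod_cast hd
  have : (d : ℝ) - 1 ≠ 0 := by linarith
  rw [hsum d]
  field_simp
  ring

/-- The phase of the Fourier coefficients. -/
def ph (ζ : ℝ) (m : ℤ) : ℂ := Complex.exp (-(Complex.I * ((2 * (m : ℂ) + 1) * ζ)))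

lemma norm_ph (ζ : ℝ) (m : ℤ) : ‖ph ζ m‖ = 1 := by
  have : ph ζ m = Complex.exp (((-((2 * m + 1) * ζ) : ℝ) : ℂ) * Complex.I) := by
    rw [ph]; congr 1; push_cast; ring
  rw [this, Complex.norm_exp_ofReal_mul_I]

lemma star_ph_mul (ζ : ℝ) (m : ℤ) : star (ph ζ m) * ph ζ m = 1 := by
  rw [RCLike.star_def, ← Complex.normSq_eq_conj_mul_self, Complex.normSq_eq_norm_sq, norm_ph]
  simp

lemma norm_ph_sub_one_le (ζ : ℝ) (m : ℤ) : ‖ph ζ m - 1‖ ≤ |2 * (m : ℝ) + 1| * |ζ| := by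
  have : ph ζ m = Complex.exp (Complex.I * ((-((2 * m + 1) * ζ) : ℝ) : ℂ)) := by
    rw [ph]; congr 1; push_cast; ring
  rw [this]
  refine (Real.norm_exp_I_mul_ofReal_sub_one_le).trans ?_
  rw [Real.norm_eq_abs, abs_neg, abs_mul]

lemma reconCoeff_zero (d : ℕ) (θ ζ : ℝ) (m : ℤ) :
    reconCoeff d θ ζ 0 m = Complex.I * (amp d θ m : ℂ) * ph ζ m := by
  rw [reconCoeff, ph, Complex.ofReal_zero, add_zero]

lemma fourier_recon {d k : ℕ} (hk : k < d) (θ ζ : ℝ) :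
    fourier d (recon d θ ζ 0) k = Complex.I * (amp d θ k : ℂ) * ph ζ k := by
  rw [recon_eq_synth (by omega), fourier_synth _ hk, reconCoeff_zero]

/-- Quantitative smallness of the angles of one subspace: `A` is the tunnelling angle `a_i T`, `θ`
the swap angle, which may be negative, and `ζ` the phase. The number `η` bounds the relative error of
every leading-order approximation. -/
structure Regime (d : ℕ) (η A θ ζ : ℝ) : Prop where
  two_le : 2 ≤ d
  le_eta : η ≤ 1 / 100
  A_ne : A ≠ 0
  near : |θ - A| ≤ η * |A|
  dA : d * |A| ≤ η
  dz : d * |ζ| ≤ η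

namespace Regime

variable {d : ℕ} {η A θ ζ : ℝ}

lemma d_ge (h : Regime d η A θ ζ) : (2 : ℝ) ≤ d := by exact_mod_cast h.two_le

lemma A_pos (h : Regime d η A θ ζ) : 0 < |A| := abs_pos.mpr h.A_ne

lemma eta_pos (h : Regime d η A θ ζ) : 0 < η :=
  lt_of_lt_of_le (mul_pos (by linarith [h.d_ge]) h.A_pos) h.dA

lemma theta_le (h : Regime d η A θ ζ) : |θ| ≤ 101 / 100 * |A| := by
  have h1 := h.near
  have h2 : |θ| ≤ |A| + |θ - A| := by
    have := abs_add_le A (θ - A)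
    rwa [add_sub_cancel] at this
  nlinarith [h.A_pos, h.le_eta]

lemma theta_ne (h : Regime d η A θ ζ) : θ ≠ 0 := by
  rintro rfl
  have := h.near
  rw [zero_sub, abs_neg] at this
  nlinarith [h.A_pos, h.le_eta]

lemma zeta_le (h : Regime d η A θ ζ) : |ζ| ≤ η := by
  have := h.dz
  nlinarith [abs_nonneg ζ, h.d_ge]

lemma dtheta (h : Regime d η A θ ζ) : d * |θ| ≤ 101 / 100 * η := by
  have h1 := mul_le_mul_of_nonneg_left h.theta_le (show (0 : ℝ) ≤ d by positivity)
  linarith [h.dA]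

lemma abs_amp_sub (h : Regime d η A θ ζ) {m : ℤ} (hm : m ∈ band d) :
    |amp d θ m - if 0 ≤ m then A else 0| ≤ 2 * η * |A| := by
  have hη := h.le_eta
  have h1 := abs_amp_sub_le (θ := θ) (by linarith [h.dtheta]) hm
  have h2 : 7 * (d : ℝ) ^ 2 * |θ| ^ 3 ≤ η * |A| := by
    calc 7 * (d : ℝ) ^ 2 * |θ| ^ 3 = 7 * (d * |θ|) ^ 2 * |θ| := by ring
      _ ≤ 7 * (101 / 100 * η) ^ 2 * (101 / 100 * |A|) := by
          exact mul_le_mul (mul_le_mul_of_nonneg_left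
            (pow_le_pow_left₀ (by positivity) h.dtheta 2) (by norm_num)) h.theta_le
            (abs_nonneg _) (by positivity)
      _ = 7 * (101 / 100) ^ 3 * η * (η * |A|) := by ring
      _ ≤ 1 * (η * |A|) := by
          have := mul_nonneg h.eta_pos.le h.A_pos.le
          gcongr
          linarith
      _ = _ := one_mul _
  have h3 : |(if 0 ≤ m then θ else 0) - if 0 ≤ m then A else 0| ≤ η * |A| := by
    split_ifs
    · exact h.near
    · simpa using mul_nonneg h.eta_pos.le h.A_pos.le
  calc _ ≤ |amp d θ m - if 0 ≤ m then θ else 0| + |(if 0 ≤ m then θ else 0) - if 0 ≤ m then A else 0| :=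
        abs_sub_le _ _ _
    _ ≤ _ := by linarith

lemma abs_amp_sub' (h : Regime d η A θ ζ) {m : ℤ} (hm : m ∈ band d) (h0 : 0 ≤ m) :
    |amp d θ m - A| ≤ 2 * η * |A| := by
  have := h.abs_amp_sub hm
  rwa [if_pos h0] at this

lemma abs_amp_neg (h : Regime d η A θ ζ) {m : ℤ} (hm : m ∈ band d) (h0 : ¬ 0 ≤ m) :
    |amp d θ m| ≤ 2 * η * |A| := by
  have := h.abs_amp_sub hm
  rwa [if_neg h0, sub_zero] at this

lemma abs_amp_le (h : Regime d η A θ ζ) {m : ℤ} (hm : m ∈ band d) :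
    |amp d θ m| ≤ 102 / 100 * |A| := by
  have hA := h.A_pos
  have hη := h.le_eta
  have hη0 := h.eta_pos
  by_cases h0 : 0 ≤ m
  · have h1 := h.abs_amp_sub' hm h0
    have h2 : |amp d θ m| ≤ |A| + |amp d θ m - A| := by
      have := abs_add_le A (amp d θ m - A)
      rwa [add_sub_cancel] at this
    nlinarith
  · have := h.abs_amp_neg hm h0
    nlinarith

lemma le_abs_amp (h : Regime d η A θ ζ) {m : ℤ} (hm : m ∈ band d) (h0 : 0 ≤ m) :
    98 / 100 * |A| ≤ |amp d θ m| := by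
  have hA := h.A_pos
  have hη := h.le_eta
  have h1 := h.abs_amp_sub' hm h0
  have h2 : |A| ≤ |amp d θ m| + |amp d θ m - A| := by
    have := abs_add_le (amp d θ m) (A - amp d θ m)
    rwa [add_sub_cancel, abs_sub_comm A] at this
  nlinarith

lemma amp_ne (h : Regime d η A θ ζ) {m : ℤ} (hm : m ∈ band d) (h0 : 0 ≤ m) : amp d θ m ≠ 0 := by
  have := h.le_abs_amp hm h0
  rw [← abs_pos]
  linarith [h.A_pos]

lemma mem_band {k : ℕ} (hk : k < d) : (k : ℤ) ∈ band d := by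
  rw [Finset.mem_Ioo]; omega

/-- The amplitudes on `0, …, d - 1` have the sign of `A`, so their products carry no phase. -/
lemma amp_mul_pos (h : Regime d η A θ ζ) {k l : ℕ} (hk : k < d) (hl : l < d) :
    0 < amp d θ k * amp d θ l := by
  have hA := h.A_pos
  have key : ∀ k : ℕ, k < d → 0 < amp d θ k * A := by
    intro k hk
    have h1 := h.abs_amp_sub' (mem_band hk) (by positivity)
    have h2 : |A - amp d θ k| * |A| ≤ 2 / 100 * |A| * |A| := by
      rw [abs_sub_comm]
      gcongr
      nlinarith [h.le_eta]
    rw [← abs_mul] at h2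
    have h3 := (abs_le.mp h2).2
    have h4 : |A| * |A| = A * A := abs_mul_abs_self A
    nlinarith [mul_pos hA hA]
  have h1 := mul_pos (key k hk) (key l hl)
  have h2 : amp d θ k * A * (amp d θ l * A) = amp d θ k * amp d θ l * A ^ 2 := by ring
  rw [h2] at h1
  exact pos_of_mul_pos_left h1 (sq_nonneg A)

lemma norm_ph_sub (h : Regime d η A θ ζ) {m : ℤ} (hm : m ∈ band d) : ‖ph ζ m - 1‖ ≤ 2 * η := by
  refine (norm_ph_sub_one_le ζ m).trans ?_
  obtain ⟨h1, h2⟩ := Finset.mem_Ioo.mp hm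
  have h3 : |2 * (m : ℝ) + 1| ≤ 2 * d := by
    have a1 : ((-(d : ℤ) : ℤ) : ℝ) + 1 ≤ m := by exact_mod_cast h1
    have a2 : (m : ℝ) + 1 ≤ ((d : ℤ) : ℝ) := by exact_mod_cast h2
    push_cast at a1 a2
    rw [abs_le]; constructor <;> linarith
  calc |2 * (m : ℝ) + 1| * |ζ| ≤ 2 * d * |ζ| := by gcongr
    _ ≤ _ := by linarith [h.dz]

lemma norm_amp_ph_sub (h : Regime d η A θ ζ) {m : ℤ} (hm : m ∈ band d) :
    ‖(amp d θ m : ℂ) * ph ζ m - if 0 ≤ m then (A : ℂ) else 0‖ ≤ 4 * η * |A| := by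
  have hA := mul_nonneg h.eta_pos.le h.A_pos.le
  split_ifs with h0
  · have e : (amp d θ m : ℂ) * ph ζ m - A = ((amp d θ m - A : ℝ) : ℂ) * ph ζ m + A * (ph ζ m - 1) := by
      push_cast; ring
    rw [e]
    refine (norm_add_le _ _).trans ?_
    rw [norm_mul, norm_mul, norm_ph, Complex.norm_real, Complex.norm_real, Real.norm_eq_abs,
      Real.norm_eq_abs]
    have := mul_le_mul_of_nonneg_left (h.norm_ph_sub hm) h.A_pos.le
    linarith [h.abs_amp_sub' hm h0]
  · rw [sub_zero, norm_mul, norm_ph, Complex.norm_real, Real.norm_eq_abs]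
    linarith [h.abs_amp_neg hm h0]

lemma norm_div_amp_sub (h : Regime d η A θ ζ) {b : ℝ} (hb : |b - 1| ≤ η) {m : ℤ}
    (hm : m ∈ band d) (h0 : 0 ≤ m) :
    ‖(b / amp d θ m : ℝ) * ph ζ m - ((1 / A : ℝ) : ℂ)‖ ≤ 10 * η / |A| := by
  have hA := h.A_pos
  have hH := h.le_abs_amp hm h0
  have hne := h.amp_ne hm h0
  have hneC : (amp d θ m : ℂ) ≠ 0 := by exact_mod_cast hne
  have hAC : (A : ℂ) ≠ 0 := by exact_mod_cast h.A_ne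
  have e : (b / amp d θ m : ℝ) * ph ζ m - ((1 / A : ℝ) : ℂ) =
      (((b - 1 : ℝ) : ℂ) * A * ph ζ m + A * (ph ζ m - 1) - ((amp d θ m - A : ℝ) : ℂ)) /
        (amp d θ m * A) := by
    push_cast
    field_simp
    ring
  rw [e, norm_div, norm_mul, Complex.norm_real, Complex.norm_real, Real.norm_eq_abs,
    Real.norm_eq_abs, div_le_div_iff₀ (by positivity) hA]
  have h1 : ‖((b - 1 : ℝ) : ℂ) * A * ph ζ m + A * (ph ζ m - 1) - ((amp d θ m - A : ℝ) : ℂ)‖ ≤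
      5 * η * |A| := by
    refine (norm_sub_le _ _).trans ?_
    have a1 := norm_add_le (((b - 1 : ℝ) : ℂ) * A * ph ζ m) (A * (ph ζ m - 1))
    rw [norm_mul, norm_mul, norm_mul, norm_ph, Complex.norm_real, Complex.norm_real,
      Real.norm_eq_abs, Real.norm_eq_abs] at a1
    rw [Complex.norm_real, Real.norm_eq_abs]
    have a2 := mul_le_mul_of_nonneg_left (h.norm_ph_sub hm) h.A_pos.le
    have a3 := mul_le_mul_of_nonneg_right hb h.A_pos.le
    linarith [h.abs_amp_sub' hm h0]
  have h2 : 5 * η * |A| * |A| ≤ 10 * η * (98 / 100 * |A| * |A|) := by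
    nlinarith [mul_nonneg h.eta_pos.le (mul_nonneg hA.le hA.le)]
  calc _ ≤ 5 * η * |A| * |A| := by gcongr
    _ ≤ _ := h2
    _ ≤ _ := by
      have := h.eta_pos.le
      gcongr

lemma abs_comp_recon_le (h : Regime d η A θ ζ) (s : Bool) (j : Fin (2 * d - 1)) :
    |comp s (recon d θ ζ 0 j)| ≤ 4 * η := by
  refine (abs_comp_le _ _).trans ?_
  rw [recon_eq_synth (by linarith [h.two_le]), synth]
  refine (norm_sum_le _ _).trans ?_
  have h1 : ∀ m ∈ band d, ‖reconCoeff d θ ζ 0 m * mode d j m‖ ≤ 102 / 100 * |A| := by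
    intro m hm
    rw [reconCoeff_zero, norm_mul, norm_mul, norm_mul, norm_mode, norm_ph, Complex.norm_I,
      Complex.norm_real, Real.norm_eq_abs]
    linarith [h.abs_amp_le hm]
  refine (Finset.sum_le_sum h1).trans ?_
  rw [Finset.sum_const, nsmul_eq_mul]
  have hc : ((band d).card : ℝ) ≤ 2 * d := by
    rw [Int.card_Ioo]
    have : ((d : ℤ) - -(d : ℤ) - 1).toNat ≤ 2 * d := by omega
    exact_mod_cast this
  calc ((band d).card : ℝ) * (102 / 100 * |A|) ≤ 2 * d * (102 / 100 * |A|) := by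
        have := h.A_pos; gcongr
    _ = 204 / 100 * (d * |A|) := by ring
    _ ≤ _ := by nlinarith [h.dA, h.eta_pos]

end Regime

/-! ### Statistics of one record and their responses -/

/-- The reference statistic: to leading order, the optimal statistic for `ζ`. -/
def refStat (d : ℕ) (x : Bool × Fin (2 * d - 1)) : ℝ :=
  comp x.1 (synth d (fun m => if 0 ≤ m then (wt d m : ℂ) else 0) x.2)

/-- The differential of the phase estimator, up to a factor; `b` is the sensitivity of the
splitting to the phase. -/
def phaseStat (d : ℕ) (θ ζ b : ℝ) (x : Bool × Fin (2 * d - 1)) : ℝ :=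
  comp x.1 (synth d (fun m => if 0 ≤ m then (wt d m : ℂ) * ((b / amp d θ m : ℝ) * ph ζ m) else 0) x.2)

/-- Fourier coefficients of the response of the record to the change `v` of `(θ, ζ, χ)`. -/
def respCoeff (d : ℕ) (θ ζ : ℝ) (v : Fin 3 → ℝ) (m : ℤ) : ℂ :=
  (Complex.I * ((deriv (fun t => amp d t m) θ * v 0 : ℝ) : ℂ) +
    ((amp d θ m * ((2 * m + 1) * v 1 + v 2) : ℝ) : ℂ)) * ph ζ m

/-- Response of the record to the change `v` of `(θ, ζ, χ)`. -/
def resp (d : ℕ) (θ ζ : ℝ) (v : Fin 3 → ℝ) (x : Bool × Fin (2 * d - 1)) : ℝ :=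
  comp x.1 (synth d (respCoeff d θ ζ v) x.2)

lemma two_mul_sub_one_pos {d : ℕ} (hd : 2 ≤ d) : 0 < 2 * (d : ℝ) - 1 := by
  have : (2 : ℝ) ≤ d := by exact_mod_cast hd
  linarith

lemma sum_band_norm_wt {d : ℕ} (hd : 2 ≤ d) {z : ℤ → ℂ} {t : ℝ}
    (hz : ∀ m ∈ band d, 0 ≤ m → ‖z m‖ ≤ t) :
    ∑ m ∈ band d, ‖if 0 ≤ m then (wt d m : ℂ) * z m else 0‖ ^ 2 ≤ t ^ 2 / kap d := by
  have h1 : ∀ m ∈ band d, ‖if 0 ≤ m then (wt d m : ℂ) * z m else 0‖ ^ 2 ≤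
      if 0 ≤ m then t ^ 2 * wt d m ^ 2 else 0 := by
    intro m hm
    split_ifs with h0
    · rw [norm_mul, mul_pow, Complex.norm_real, Real.norm_eq_abs, sq_abs, mul_comm]
      have := hz m hm h0
      gcongr
    · simp
  refine (Finset.sum_le_sum h1).trans (le_of_eq ?_)
  rw [sum_band_ite d fun m => t ^ 2 * wt d m ^ 2, ← Finset.mul_sum, sum_wt_sq hd]
  ring

lemma sum_refStat_sq {d : ℕ} (hd : 2 ≤ d) :
    ∑ x, refStat d x ^ 2 = (2 * (d : ℝ) - 1) / kap d := by
  simp only [refStat]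
  rw [sum_comp_synth_sq (by omega), div_eq_mul_one_div, ← sum_wt_sq hd,
    ← sum_band_ite d fun m => wt d m ^ 2]
  congr 1
  refine Finset.sum_congr rfl fun m _ => ?_
  split_ifs
  · rw [Complex.norm_real, Real.norm_eq_abs, sq_abs]
  · simp

namespace Regime

variable {d : ℕ} {η A θ ζ : ℝ}

lemma sum_phaseStat_sub_sq_le (h : Regime d η A θ ζ) {b : ℝ} (hb : |b - 1| ≤ η) :
    ∑ x, (phaseStat d θ ζ b x - 1 / A * refStat d x) ^ 2 ≤
      (2 * d - 1) * ((10 * η / |A|) ^ 2 / kap d) := by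
  have hd := h.two_le
  have e : ∀ x, phaseStat d θ ζ b x - 1 / A * refStat d x = comp x.1 (synth d (fun m =>
      if 0 ≤ m then (wt d m : ℂ) * ((b / amp d θ m : ℝ) * ph ζ m - ((1 / A : ℝ) : ℂ)) else 0) x.2) := by
    intro x
    rw [phaseStat, refStat, ← comp_smul, ← synth_smul, ← comp_sub, ← synth_sub]
    congr 2
    funext m
    split_ifs
    · ring
    · simp
  simp_rw [e]
  rw [sum_comp_synth_sq (by omega)]
  refine mul_le_mul_of_nonneg_left ?_ (two_mul_sub_one_pos hd).le
  exact sum_band_norm_wt hd fun m hm h0 => h.norm_div_amp_sub hb hm h0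

/-- The sensitivity to `θ` contributes `A⁴`, relative to `kap d`, to the squared norm of a
statistic. This is negligible because it is at most `(dA)⁴`. -/
lemma pow_four_le (h : Regime d η A θ ζ) : A ^ 4 ≤ η ^ 2 * kap d := by
  have hd := h.d_ge
  have hη := h.eta_pos
  have h1 : (d : ℝ) ^ 4 * A ^ 4 ≤ η ^ 4 := by
    have := pow_le_pow_left₀ (by positivity) h.dA 4
    rwa [mul_pow, show |A| ^ 4 = A ^ 4 from by rw [← abs_pow, abs_of_nonneg (by positivity)]] at this
  have h2 : 1 ≤ kap d * d ^ 4 := by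
    have : 0 < (d : ℝ) - 1 := by linarith
    have e : kap d * d ^ 4 = 3 * (d : ℝ) ^ 3 / ((d - 1) * (d + 1)) := by
      rw [kap]; field_simp
    rw [e, le_div_iff₀ (by positivity)]
    nlinarith [mul_nonneg (sq_nonneg (d : ℝ)) (show (0 : ℝ) ≤ d by positivity), sq_nonneg (d : ℝ)]
  have hk := kap_pos h.two_le
  have h3 : η ^ 4 ≤ η ^ 2 := by
    have : η ≤ 1 := by linarith [h.le_eta]
    calc η ^ 4 = η ^ 2 * η ^ 2 := by ring
      _ ≤ η ^ 2 * 1 := by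
        gcongr
        exact pow_le_one₀ hη.le this
      _ = _ := mul_one _
  have hd4 : 0 < (d : ℝ) ^ 4 := by positivity
  refine le_of_mul_le_mul_left ?_ hd4
  nlinarith [sq_nonneg η]

/-- A statistic made of the phase statistic and a small remainder is close to the reference. -/
lemma sum_stat_sub_sq_le (h : Regime d η A θ ζ) {b : ℝ} (hb : |b - 1| ≤ η)
    {r : Bool × Fin (2 * d - 1) → ℝ} (hr : ∀ x, |r x| ≤ 4 * |A| / (2 * d - 1)) :
    ∑ x, (kap d / (2 * d - 1) * phaseStat d θ ζ b x + r x -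
      kap d / ((2 * d - 1) * A) * refStat d x) ^ 2 ≤
      264 * η ^ 2 * (kap d / ((2 * d - 1) * A ^ 2)) := by
  have hd := h.two_le
  have hn := two_mul_sub_one_pos hd
  have hk := kap_pos hd
  have hA := h.A_pos
  have hA2 : 0 < A ^ 2 := by rw [← sq_abs]; positivity
  have hA0 := h.A_ne
  have hrs : ∑ x, r x ^ 2 ≤ 2 * (2 * d - 1) * (4 * |A| / (2 * d - 1)) ^ 2 := by
    calc ∑ x, r x ^ 2 ≤ ∑ _x : Bool × Fin (2 * d - 1), (4 * |A| / (2 * d - 1)) ^ 2 := by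
          refine Finset.sum_le_sum fun x _ => ?_
          rw [← sq_abs]
          exact pow_le_pow_left₀ (abs_nonneg _) (hr x) 2
      _ = _ := by
          rw [Finset.sum_const, Finset.card_univ, Fintype.card_prod, Fintype.card_bool,
            Fintype.card_fin, nsmul_eq_mul, Nat.cast_mul, cast_two_mul_sub_one (by omega)]
          push_cast; ring
  have hp := h.sum_phaseStat_sub_sq_le hb
  have hpt : ∀ x, (kap d / (2 * d - 1) * phaseStat d θ ζ b x + r x -
      kap d / ((2 * d - 1) * A) * refStat d x) ^ 2 ≤
      2 * (kap d / (2 * d - 1)) ^ 2 * (phaseStat d θ ζ b x - 1 / A * refStat d x) ^ 2 +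
        2 * r x ^ 2 := by
    intro x
    have e : kap d / (2 * d - 1) * phaseStat d θ ζ b x + r x -
        kap d / ((2 * d - 1) * A) * refStat d x =
        kap d / (2 * d - 1) * (phaseStat d θ ζ b x - 1 / A * refStat d x) + r x := by
      field_simp; ring
    rw [e]
    nlinarith [sq_nonneg (kap d / (2 * d - 1) * (phaseStat d θ ζ b x - 1 / A * refStat d x) - r x)]
  refine (Finset.sum_le_sum fun x _ => hpt x).trans ?_
  rw [Finset.sum_add_distrib, ← Finset.mul_sum, ← Finset.mul_sum]
  have h4 := h.pow_four_le
  calc _ ≤ 2 * (kap d / (2 * d - 1)) ^ 2 * ((2 * d - 1) * ((10 * η / |A|) ^ 2 / kap d)) +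
        2 * (2 * (2 * d - 1) * (4 * |A| / (2 * d - 1)) ^ 2) := by gcongr
    _ = 200 * η ^ 2 * (kap d / ((2 * d - 1) * A ^ 2)) + 64 * A ^ 4 / ((2 * d - 1) * A ^ 2) := by
        simp only [div_pow, mul_pow, sq_abs]
        field_simp
        ring
    _ ≤ 200 * η ^ 2 * (kap d / ((2 * d - 1) * A ^ 2)) +
        64 * (η ^ 2 * kap d) / ((2 * d - 1) * A ^ 2) := by gcongr
    _ = _ := by ring

/-- In the direction `(0, 1, -d)` the response is nearly proportional to the reference. -/
lemma sum_resp_sub_sq_le (h : Regime d η A θ ζ) (β : ℝ) :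
    ∑ x, (resp d θ ζ ![0, β, -d * β] x - β * A * refStat d x) ^ 2 ≤
      124 * η ^ 2 * β ^ 2 * A ^ 2 * ((2 * d - 1) / kap d) := by
  have hd := h.two_le
  have hd2 := h.d_ge
  have hn := two_mul_sub_one_pos hd
  have hk := kap_pos hd
  have hA := h.A_pos
  have hη := h.eta_pos
  have e : ∀ x, resp d θ ζ ![0, β, -d * β] x - β * A * refStat d x = comp x.1 (synth d (fun m =>
      ((β * wt d m : ℝ) : ℂ) * ((amp d θ m : ℂ) * ph ζ m - if 0 ≤ m then (A : ℂ) else 0)) x.2) := by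
    intro x
    rw [resp, refStat, ← comp_smul, ← synth_smul, ← comp_sub, ← synth_sub]
    congr 2
    funext m
    simp only [respCoeff, wt, Matrix.cons_val_zero, Matrix.cons_val_one, Matrix.cons_val]
    split_ifs <;> push_cast <;> ring
  simp_rw [e]
  rw [sum_comp_synth_sq (by omega)]
  have hpt : ∀ m ∈ band d, ‖((β * wt d m : ℝ) : ℂ) *
      ((amp d θ m : ℂ) * ph ζ m - if 0 ≤ m then (A : ℂ) else 0)‖ ^ 2 ≤
      16 * η ^ 2 * β ^ 2 * A ^ 2 * (if 0 ≤ m then wt d m ^ 2 else 0) +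
        36 * η ^ 2 * β ^ 2 * A ^ 2 * (if 0 ≤ m then 0 else (d : ℝ) ^ 2) := by
    intro m hm
    rw [norm_mul, mul_pow, Complex.norm_real, Real.norm_eq_abs, sq_abs]
    split_ifs with h0
    · have h1 := h.norm_amp_ph_sub hm
      rw [if_pos h0] at h1
      have h2 := pow_le_pow_left₀ (norm_nonneg _) h1 2
      rw [mul_pow, sq_abs] at h2
      nlinarith [mul_le_mul_of_nonneg_left h2 (sq_nonneg (β * wt d m))]
    · rw [sub_zero, norm_mul, norm_ph, mul_one, Complex.norm_real, Real.norm_eq_abs, sq_abs]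
      have h1 := pow_le_pow_left₀ (abs_nonneg _) (h.abs_amp_neg hm h0) 2
      rw [sq_abs, mul_pow, sq_abs] at h1
      have h2 : wt d m ^ 2 ≤ 9 * (d : ℝ) ^ 2 := by
        obtain ⟨hm1, hm2⟩ := Finset.mem_Ioo.mp hm
        have a1 : ((-(d : ℤ) : ℤ) : ℝ) + 1 ≤ m := by exact_mod_cast hm1
        have a2 : (m : ℝ) + 1 ≤ 0 := by
          have : m + 1 ≤ 0 := by omega
          exact_mod_cast this
        push_cast at a1
        have a3 : |wt d m| ≤ 3 * d := by
          rw [wt, abs_le]; constructor <;> linarith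
        have := pow_le_pow_left₀ (abs_nonneg _) a3 2
        rw [sq_abs] at this
        linarith
      have h3 := mul_le_mul h2 h1 (sq_nonneg _) (by positivity)
      nlinarith [mul_le_mul_of_nonneg_left h3 (sq_nonneg β)]
  -- the modes `m < 0` carry no signal, and their number times `d ^ 2` is of the order of `1 / kap d`
  have hneg : ∑ m ∈ band d, (if 0 ≤ m then 0 else (d : ℝ) ^ 2) ≤ 3 / kap d := by
    have e1 : ∑ m ∈ band d, (if 0 ≤ m then 0 else (d : ℝ) ^ 2) =
        ((band d).card : ℝ) * d ^ 2 - d * d ^ 2 := by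
      have e2 : ∀ m : ℤ, (if 0 ≤ m then 0 else (d : ℝ) ^ 2) =
          d ^ 2 - if 0 ≤ m then (d : ℝ) ^ 2 else 0 := fun m => by split_ifs <;> simp
      simp_rw [e2]
      rw [Finset.sum_sub_distrib, sum_band_ite d fun _ => (d : ℝ) ^ 2]
      simp
    have e3 : ((band d).card : ℝ) = 2 * d - 1 := by
      rw [← cast_two_mul_sub_one (by omega), Int.card_Ioo]
      congr 1
      omega
    have e4 : 3 / kap d = ((d : ℝ) - 1) * d * (d + 1) := by
      have : (d : ℝ) - 1 ≠ 0 := by linarith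
      rw [kap]; field_simp
    rw [e1, e3, e4]
    nlinarith
  have hpos : ∑ m ∈ band d, (if 0 ≤ m then wt d m ^ 2 else 0) = 1 / kap d := by
    rw [sum_band_ite d fun m => wt d m ^ 2, sum_wt_sq hd]
  calc _ ≤ (2 * (d : ℝ) - 1) * (16 * η ^ 2 * β ^ 2 * A ^ 2 * (1 / kap d) +
        36 * η ^ 2 * β ^ 2 * A ^ 2 * (3 / kap d)) := by
        refine mul_le_mul_of_nonneg_left ((Finset.sum_le_sum hpt).trans ?_) hn.le
        rw [Finset.sum_add_distrib, ← Finset.mul_sum, ← Finset.mul_sum, hpos]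
        gcongr
    _ = _ := by ring

/-- The highest mode alone already determines `θ`, and its amplitude is explicit, so no bound for
the derivatives of the other amplitudes is needed. -/
lemma deriv_amp_last (h : Regime d η A θ ζ) :
    1 / 2 ≤ deriv (fun t => amp d t ((d : ℤ) - 1)) θ := by
  have hd := h.two_le
  have hη := h.le_eta
  have hη0 := h.eta_pos
  have e : (fun t => amp d t ((d : ℤ) - 1)) = fun t => Real.sin t * Real.cos t ^ (2 * d - 1) :=
    funext fun t => amp_last (by omega) t
  have hder := ((Real.hasDerivAt_sin θ).mul ((Real.hasDerivAt_cos θ).pow (2 * d - 1)))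
  have e2 : deriv (fun t => amp d t ((d : ℤ) - 1)) θ =
      Real.cos θ * Real.cos θ ^ (2 * d - 1) +
        Real.sin θ * (((2 * d - 1 : ℕ) : ℝ) * Real.cos θ ^ (2 * d - 1 - 1) * -Real.sin θ) := by
    rw [e]; exact hder.deriv
  have e3 : Real.cos θ * Real.cos θ ^ (2 * d - 1) = Real.cos θ ^ (2 * d) := by
    rw [← pow_succ']; congr 1; omega
  rw [e2, e3, cast_two_mul_sub_one (by omega)]
  have hdt : (d : ℝ) * θ ^ 2 ≤ 1 / 100 := by
    have h1 := h.dtheta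
    have h2 : |θ| ≤ d * |θ| := le_mul_of_one_le_left (abs_nonneg _) (by linarith [h.d_ge])
    calc (d : ℝ) * θ ^ 2 = (d * |θ|) * |θ| := by rw [← sq_abs]; ring
      _ ≤ (101 / 100 * (1 / 100)) * (101 / 100 * (1 / 100)) := by
          refine mul_le_mul ?_ ?_ (abs_nonneg _) (by norm_num) <;> linarith
      _ ≤ _ := by norm_num
  have h1 := (abs_le.mp (abs_cos_pow_sub_one_le θ (2 * d))).1
  push_cast at h1
  have h2 : Real.sin θ ^ 2 ≤ θ ^ 2 := Real.sin_sq_le_sq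
  have h3 : |Real.cos θ ^ (2 * d - 1 - 1)| ≤ 1 := by
    rw [abs_pow]; exact pow_le_one₀ (abs_nonneg _) (Real.abs_cos_le_one θ)
  have h4 := (abs_le.mp h3).2
  have hn := two_mul_sub_one_pos hd
  have h5 : (2 * (d : ℝ) - 1) * Real.sin θ ^ 2 * Real.cos θ ^ (2 * d - 1 - 1) ≤
      (2 * d - 1) * θ ^ 2 := by
    calc _ ≤ (2 * (d : ℝ) - 1) * Real.sin θ ^ 2 * 1 := by gcongr
      _ ≤ _ := by rw [mul_one]; gcongr
  nlinarith [sq_nonneg θ]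

end Regime

/-- Fourier coefficients of an exactly unbiased statistic for the combination `bθ dθ + bζ dζ`. -/
def exactCoeff (d : ℕ) (θ ζ bθ bζ : ℝ) (m : ℤ) : ℂ :=
  (if 0 ≤ m then (wt d m : ℂ) * ((kap d * bζ / amp d θ m : ℝ) * ph ζ m) else 0) +
    if m = (d : ℤ) - 1 then
      Complex.I * ((bθ / deriv (fun t => amp d t m) θ : ℝ) : ℂ) * ph ζ m else 0

/-- An exactly unbiased statistic for the combination `bθ dθ + bζ dζ`. -/
def exactStat (d : ℕ) (θ ζ bθ bζ : ℝ) (x : Bool × Fin (2 * d - 1)) : ℝ :=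
  1 / (2 * d - 1) * comp x.1 (synth d (exactCoeff d θ ζ bθ bζ) x.2)

namespace Regime

variable {d : ℕ} {η A θ ζ : ℝ}

/-- The statistic is unbiased to first order: on the modes `0 ≤ m < d` it pairs only with the phase
response `(2m + 1) dζ + dχ = wt m dζ + (d dζ + dχ)`, whose constant part is annihilated by the
antisymmetric weights; the extra term on the highest mode picks up `dθ`. -/
lemma sum_exactStat_mul_resp (h : Regime d η A θ ζ) (bθ bζ : ℝ) (v : Fin 3 → ℝ) :
    ∑ x, exactStat d θ ζ bθ bζ x * resp d θ ζ v x = bθ * v 0 + bζ * v 1 := by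
  have hd := h.two_le
  have hn := two_mul_sub_one_pos hd
  have hk := kap_pos hd
  simp only [exactStat, resp, mul_assoc]
  rw [← Finset.mul_sum, sum_comp_synth_mul (by omega), ← mul_assoc, one_div_mul_cancel hn.ne',
    one_mul]
  have hterm : ∀ m ∈ band d, (star (exactCoeff d θ ζ bθ bζ m) * respCoeff d θ ζ v m).re =
      (if 0 ≤ m then kap d * bζ * v 1 * wt d m ^ 2 + kap d * bζ * (d * v 1 + v 2) * wt d m else 0) +
        if m = (d : ℤ) - 1 then bθ * v 0 else 0 := by
    intro m hm
    have e : star (exactCoeff d θ ζ bθ bζ m) * respCoeff d θ ζ v m =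
        ((if 0 ≤ m then ((wt d m * (kap d * bζ / amp d θ m) : ℝ) : ℂ) else 0) -
          if m = (d : ℤ) - 1 then Complex.I * ((bθ / deriv (fun t => amp d t m) θ : ℝ) : ℂ) else 0) *
        (Complex.I * ((deriv (fun t => amp d t m) θ * v 0 : ℝ) : ℂ) +
          ((amp d θ m * ((2 * m + 1) * v 1 + v 2) : ℝ) : ℂ)) := by
      have e1 : star (exactCoeff d θ ζ bθ bζ m) =
          ((if 0 ≤ m then ((wt d m * (kap d * bζ / amp d θ m) : ℝ) : ℂ) else 0) -
            if m = (d : ℤ) - 1 then Complex.I * ((bθ / deriv (fun t => amp d t m) θ : ℝ) : ℂ)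
              else 0) * star (ph ζ m) := by
        rw [exactCoeff]
        split_ifs <;>
        simp only [star_add, star_mul', star_zero, RCLike.star_def, Complex.conj_ofReal,
          Complex.conj_I, Complex.ofReal_mul] <;> ring
      rw [e1, respCoeff]
      linear_combination (((if 0 ≤ m then ((wt d m * (kap d * bζ / amp d θ m) : ℝ) : ℂ) else 0) -
          if m = (d : ℤ) - 1 then Complex.I * ((bθ / deriv (fun t => amp d t m) θ : ℝ) : ℂ) else 0) *
        (Complex.I * ((deriv (fun t => amp d t m) θ * v 0 : ℝ) : ℂ) +
          ((amp d θ m * ((2 * m + 1) * v 1 + v 2) : ℝ) : ℂ))) * star_ph_mul ζ m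
    rw [e]
    have hre : ∀ x y z w : ℝ, (((x : ℂ) - Complex.I * (y : ℂ)) * (Complex.I * (z : ℂ) + (w : ℂ))).re =
        x * w + y * z := by
      intro x y z w
      simp
    by_cases h0 : 0 ≤ m
    · have hne := h.amp_ne hm h0
      rw [if_pos h0, if_pos h0]
      by_cases h1 : m = (d : ℤ) - 1
      · rw [if_pos h1, if_pos h1, hre]
        have hD : deriv (fun t => amp d t m) θ ≠ 0 := by
          rw [h1]; linarith [h.deriv_amp_last]
        rw [wt]
        field_simp
        ring
      · rw [if_neg h1, if_neg h1]
        have := hre (wt d m * (kap d * bζ / amp d θ m)) 0 (deriv (fun t => amp d t m) θ * v 0)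
          (amp d θ m * ((2 * m + 1) * v 1 + v 2))
        rw [Complex.ofReal_zero, mul_zero] at this
        rw [this, wt]
        field_simp
        ring
    · have h1 : m ≠ (d : ℤ) - 1 := by omega
      rw [if_neg h0, if_neg h1, if_neg h0, if_neg h1]
      simp
  rw [Finset.sum_congr rfl hterm, Finset.sum_add_distrib, sum_band_ite d fun m =>
    kap d * bζ * v 1 * wt d m ^ 2 + kap d * bζ * (d * v 1 + v 2) * wt d m,
    Finset.sum_add_distrib, ← Finset.mul_sum, ← Finset.mul_sum, sum_wt, sum_wt_sq hd,
    Finset.sum_ite_eq', if_pos]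
  · field_simp
    ring
  · rw [Finset.mem_Ioo]; omega

/-- The exactly unbiased statistic has the shape of the differential of the estimator, with another
small remainder. -/
lemma exists_exactStat_eq (h : Regime d η A θ ζ) {bθ : ℝ} (hb : |bθ| ≤ |θ|) (bζ : ℝ) :
    ∃ r : Bool × Fin (2 * d - 1) → ℝ, (∀ x, |r x| ≤ 4 * |A| / (2 * d - 1)) ∧
      ∀ x, exactStat d θ ζ bθ bζ x = kap d / (2 * d - 1) * phaseStat d θ ζ bζ x + r x := by
  have hd := h.two_le
  have hn := two_mul_sub_one_pos hd
  have hD := h.deriv_amp_last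
  have hD0 : 0 < deriv (fun t => amp d t ((d : ℤ) - 1)) θ := by linarith
  refine ⟨fun x => 1 / (2 * d - 1) * comp x.1 (Complex.I *
    ((bθ / deriv (fun t => amp d t ((d : ℤ) - 1)) θ : ℝ) : ℂ) * ph ζ ((d : ℤ) - 1) *
      mode d x.2 ((d : ℤ) - 1)), fun x => ?_, fun x => ?_⟩
  · rw [abs_mul, abs_of_pos (by positivity), one_div_mul_eq_div]
    gcongr
    refine (abs_comp_le _ _).trans ?_
    rw [norm_mul, norm_mul, norm_mul, Complex.norm_I, norm_ph, norm_mode, Complex.norm_real,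
      Real.norm_eq_abs, abs_div, abs_of_pos hD0, one_mul, mul_one, mul_one,
      div_le_iff₀ hD0]
    have h1 := h.theta_le
    have h2 := h.A_pos
    nlinarith
  · have e : synth d (exactCoeff d θ ζ bθ bζ) x.2 = (kap d : ℂ) * synth d (fun m => if 0 ≤ m then
        (wt d m : ℂ) * ((bζ / amp d θ m : ℝ) * ph ζ m) else 0) x.2 +
        Complex.I * ((bθ / deriv (fun t => amp d t ((d : ℤ) - 1)) θ : ℝ) : ℂ) *
          ph ζ ((d : ℤ) - 1) * mode d x.2 ((d : ℤ) - 1) := by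
      rw [← synth_smul]
      simp only [synth, exactCoeff, add_mul, Finset.sum_add_distrib]
      congr 1
      · refine Finset.sum_congr rfl fun m _ => ?_
        split_ifs
        · push_cast; ring
        · simp
      · simp only [ite_mul, zero_mul]
        rw [Finset.sum_ite_eq', if_pos]
        rw [Finset.mem_Ioo]; omega
    rw [exactStat, e, comp_add, comp_smul, phaseStat]
    ring

end Regime

/-! ### Comparison of the estimator with the Cramér–Rao bound -/

lemma bellProb_omega (d : ℕ) (s : Bool) (j : Fin (2 * d - 1)) (θ ζ χ : ℝ) :
    bellProb d s (omega d j) θ ζ χ = 1 / 2 + comp s (recon d θ ζ χ j) := by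
  cases s <;> simp [comp, recon]

/-- The three parameters of a subspace are locally identifiable: unbiased statistics detect `dθ` and
`dζ`, and then the mode `m = 0` detects `dχ`. -/
lemma Regime.eq_zero_of_resp {d : ℕ} {η A θ ζ : ℝ} (h : Regime d η A θ ζ) {v : Fin 3 → ℝ}
    (hv : ∀ x, resp d θ ζ v x = 0) : v = 0 := by
  have hd := h.two_le
  have h0 := h.sum_exactStat_mul_resp 1 0 v
  have h1 := h.sum_exactStat_mul_resp 0 1 v
  simp only [hv, mul_zero, Finset.sum_const_zero] at h0 h1
  have hv0 : v 0 = 0 := by linarith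
  have hv1 : v 1 = 0 := by linarith
  have h2 := sum_comp_synth_sq (d := d) (by omega) (respCoeff d θ ζ v)
  have hz : ∑ x : Bool × Fin (2 * d - 1), comp x.1 (synth d (respCoeff d θ ζ v) x.2) ^ 2 = 0 :=
    Finset.sum_eq_zero fun x _ => by
      have := hv x
      rw [resp] at this
      rw [this]; ring
  rw [hz] at h2
  have h3 := (mul_eq_zero.mp h2.symm).resolve_left (two_mul_sub_one_pos hd).ne'
  have hb : (0 : ℤ) ∈ band d := by rw [Finset.mem_Ioo]; omega
  have h4 := (Finset.sum_eq_zero_iff_of_nonneg fun m _ => sq_nonneg _).mp h3 0 hb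
  rw [sq_eq_zero_iff, norm_eq_zero, respCoeff, hv0, hv1] at h4
  have hph : ph ζ 0 ≠ 0 := by
    intro e
    have := norm_ph ζ 0
    rw [e, norm_zero] at this
    exact zero_ne_one this
  have h5 := (mul_eq_zero.mp h4).resolve_right hph
  rw [mul_zero, Complex.ofReal_zero, mul_zero, zero_add, mul_zero, zero_add] at h5
  have h6 := (mul_eq_zero.mp (Complex.ofReal_eq_zero.mp h5)).resolve_left (h.amp_ne hb le_rfl)
  funext i
  fin_cases i
  · exact hv0
  · exact hv1
  · exact h6

section Core

variable {P Γ : Type} [Fintype P] [Fintype Γ] [DecidableEq Γ]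

/-- Probabilities of the logical zeros when `mult grp p` subspaces share a circuit. -/
def zeroProb (grp : P → Γ) (d : ℕ) (θ ζ : P → ℝ) (p : P) (x : Bool × Fin (2 * d - 1)) : ℝ :=
  bellProb d x.1 (omega d x.2) (θ p) (ζ p) 0 / mult grp p

/-- Response of the probabilities of the logical zeros to a change of all parameters. -/
def zeroResp (grp : P → Γ) (d : ℕ) (θ ζ : P → ℝ) (v : P × Fin 3 → ℝ) (p : P)
    (x : Bool × Fin (2 * d - 1)) : ℝ :=
  resp d (θ p) (ζ p) (fun i => v (p, i)) x / mult grp p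

variable {grp : P → Γ} {d : ℕ} {η : ℝ} {A θ ζ : P → ℝ}

lemma nearIdeal_zeroProb (hreg : ∀ p, Regime d η (A p) (θ p) (ζ p)) :
    NearIdeal grp η (zeroProb grp d θ ζ) := by
  intro p x
  have hM := one_le_mult grp p
  have e : zeroProb grp d θ ζ p x - 1 / (2 * mult grp p) =
      comp x.1 (recon d (θ p) (ζ p) 0 x.2) / mult grp p := by
    rw [zeroProb, bellProb_omega]
    field_simp
    ring
  rw [e, abs_div, abs_of_pos (by linarith : 0 < mult grp p)]
  gcongr
  exact (hreg p).abs_comp_recon_le x.1 x.2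

/-- Identifiability: the information form is positive definite. -/
lemma posDef_of_form [DecidableEq P] (hreg : ∀ p, Regime d η (A p) (θ p) (ζ p))
    {J : Matrix (P × Fin 3) (P × Fin 3) ℝ} (hJ : J.IsHermitian)
    (hq : ∀ v, v ⬝ᵥ (J *ᵥ v) = infoForm grp (zeroProb grp d θ ζ) (zeroResp grp d θ ζ v)) :
    J.PosDef := by
  refine Matrix.PosDef.of_dotProduct_mulVec_pos hJ fun v hv => ?_
  rw [star_trivial, hq]
  have hP : ∃ p : P, True := by
    by_contra hne
    push Not at hne
    exact hv (funext fun x => (hne x.1).elim)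
  obtain ⟨p₀, -⟩ := hP
  have hη := (hreg p₀).le_eta
  have hn : NearIdeal grp η (zeroProb grp d θ ζ) := nearIdeal_zeroProb hreg
  refine lt_of_lt_of_le ?_ (sqNorm_le_infoForm grp (hn.pos hη)
    (fun γ x => (hn.sum_le hη γ x).trans (by norm_num)) (hn.le_one hη) _)
  refine lt_of_le_of_ne (sqNorm_nonneg _) fun h0 => hv ?_
  funext x
  obtain ⟨p, i⟩ := x
  have h1 := (Finset.sum_eq_zero_iff_of_nonneg fun p _ => Finset.sum_nonneg fun x _ =>
    sq_nonneg _).mp h0.symm p (Finset.mem_univ p)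
  have h2 := (Finset.sum_eq_zero_iff_of_nonneg fun x _ => sq_nonneg _).mp h1
  have h3 : (fun i => v (p, i)) = 0 := (hreg p).eq_zero_of_resp fun x => by
    have := pow_eq_zero_iff two_ne_zero |>.mp (h2 x (Finset.mem_univ x))
    rw [zeroResp, div_eq_zero_iff] at this
    exact this.resolve_right (by linarith [one_le_mult grp p])
  exact congrFun h3 i

/-- The common scale of the variance of the estimator and of the Cramér–Rao bound. -/
def scale (grp : P → Γ) (d : ℕ) (A α : P → ℝ) : ℝ :=
  kap d / (2 * d - 1) * ∑ p, (α p * mult grp p / A p) ^ 2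

/-- The reference statistic of the whole experiment. -/
def refAll (grp : P → Γ) (d : ℕ) (A α : P → ℝ) (p : P) (x : Bool × Fin (2 * d - 1)) : ℝ :=
  α p * mult grp p * (kap d / ((2 * d - 1) * A p) * refStat d x)

lemma sqNorm_refAll (hd : 2 ≤ d) (hA : ∀ p, A p ≠ 0) (α : P → ℝ) :
    sqNorm (refAll grp d A α) = scale grp d A α := by
  have hk := kap_pos hd
  have hn := two_mul_sub_one_pos hd
  rw [sqNorm, scale, Finset.mul_sum]
  refine Finset.sum_congr rfl fun p _ => ?_
  have h1 := hA p
  simp only [refAll, mul_pow]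
  rw [← Finset.mul_sum, ← Finset.mul_sum, sum_refStat_sq hd]
  field_simp

/-- Statistics that consist of the phase statistic and a small remainder are close to the reference.
This covers the gradient of the estimator and the exactly unbiased statistic. -/
lemma sqNorm_stat_sub_le (hreg : ∀ p, Regime d η (A p) (θ p) (ζ p)) {α b : P → ℝ}
    (hb : ∀ p, |b p - 1| ≤ η) {r : P → Bool × Fin (2 * d - 1) → ℝ}
    (hr : ∀ p x, |r p x| ≤ 4 * |A p| / (2 * d - 1)) :
    sqNorm ((fun p x => α p * mult grp p *
      (kap d / (2 * d - 1) * phaseStat d (θ p) (ζ p) (b p) x + r p x)) - refAll grp d A α) ≤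
      264 * η ^ 2 * scale grp d A α := by
  rw [sqNorm, scale, Finset.mul_sum, Finset.mul_sum]
  refine Finset.sum_le_sum fun p _ => ?_
  have h1 := (hreg p).sum_stat_sub_sq_le (hb p) (hr p)
  have hA := (hreg p).A_ne
  calc _ = (α p * mult grp p) ^ 2 * ∑ x, (kap d / (2 * d - 1) * phaseStat d (θ p) (ζ p) (b p) x +
        r p x - kap d / ((2 * d - 1) * A p) * refStat d x) ^ 2 := by
        rw [Finset.mul_sum]
        refine Finset.sum_congr rfl fun x _ => ?_
        simp only [Pi.sub_apply, refAll]
        ring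
    _ ≤ (α p * mult grp p) ^ 2 * (264 * η ^ 2 * (kap d / ((2 * d - 1) * A p ^ 2))) := by gcongr
    _ = _ := by
        have := (two_mul_sub_one_pos (hreg p).two_le).ne'
        field_simp

/-- The direction in parameter space in which the response is nearly the covariance operator
applied to the reference statistic. -/
def refDir (grp : P → Γ) (d : ℕ) (A α : P → ℝ) (p : P) : ℝ :=
  1 / 2 * (α p - 1 / (2 * mult grp p) * ∑ q ∈ fib grp (grp p), α q) * mult grp p * kap d /
    ((2 * d - 1) * A p ^ 2)

/-- The response to `refDir` is close to the ideal covariance operator applied to the reference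
statistic, so the reference nearly attains equality in the Cramér–Rao inequality. -/
lemma sqNorm_zeroResp_sub_le (hreg : ∀ p, Regime d η (A p) (θ p) (ζ p))
    (hA : ∀ p q, grp p = grp q → A p = A q) (α : P → ℝ) :
    sqNorm (zeroResp grp d θ ζ (fun x => ![0, refDir grp d A α x.1, -d * refDir grp d A α x.1] x.2) -
      idealCov grp (refAll grp d A α)) ≤
      124 * (Fintype.card P : ℝ) ^ 2 * η ^ 2 * scale grp d A α := by
  set μ : P → ℝ := fun p => 1 / 2 * (α p - 1 / (2 * mult grp p) * ∑ q ∈ fib grp (grp p), α q) with hμ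
  have hpt : ∀ p x, (zeroResp grp d θ ζ
      (fun x => ![0, refDir grp d A α x.1, -d * refDir grp d A α x.1] x.2) -
      idealCov grp (refAll grp d A α)) p x = 1 / mult grp p *
        (resp d (θ p) (ζ p) ![0, refDir grp d A α p, -d * refDir grp d A α p] x -
          refDir grp d A α p * A p * refStat d x) := by
    intro p x
    have hM := one_le_mult grp p
    have hAp := (hreg p).A_ne
    have hn := (two_mul_sub_one_pos (hreg p).two_le).ne'
    have e1 : ∑ q ∈ fib grp (grp p), refAll grp d A α q x =
        (∑ q ∈ fib grp (grp p), α q) *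
          (mult grp p * (kap d / ((2 * d - 1) * A p) * refStat d x)) := by
      rw [Finset.sum_mul]
      refine Finset.sum_congr rfl fun q hq => ?_
      have hq' := (Finset.mem_filter.mp hq).2
      rw [refAll, mult_congr grp hq', hA q p hq', mul_assoc]
    simp only [Pi.sub_apply, zeroResp, idealCov]
    rw [e1, refAll, refDir]
    have hM0 : mult grp p ≠ 0 := by linarith
    rw [mul_sub, div_eq_inv_mul, one_div]
    field_simp
  have hp : ∀ p, ∑ x, (zeroResp grp d θ ζ
      (fun x => ![0, refDir grp d A α x.1, -d * refDir grp d A α x.1] x.2) -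
      idealCov grp (refAll grp d A α)) p x ^ 2 ≤
      124 * η ^ 2 * (kap d / (2 * d - 1)) * (μ p / A p) ^ 2 := by
    intro p
    have hM := one_le_mult grp p
    have hAp := (hreg p).A_ne
    have hn := two_mul_sub_one_pos (hreg p).two_le
    have hk := kap_pos (hreg p).two_le
    simp_rw [hpt, mul_pow]
    rw [← Finset.mul_sum]
    refine (mul_le_mul_of_nonneg_left ((hreg p).sum_resp_sub_sq_le _) (sq_nonneg _)).trans
      (le_of_eq ?_)
    have e : refDir grp d A α p = μ p * mult grp p * kap d / ((2 * d - 1) * A p ^ 2) := rfl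
    rw [e]
    have hM0 : mult grp p ≠ 0 := by linarith
    field_simp
  have hμle := sqNorm_le_of_abs_le (X := Unit) (y := fun p _ => μ p / A p)
    (z := fun p _ => α p * mult grp p / A p) (C := 1) (by
      intro p _
      have hM := one_le_mult grp p
      have hAp := (hreg p).A_pos
      have hle : ∀ q, |α q / A q| ≤ |α q * mult grp q / A q| := fun q => by
        rw [abs_div, abs_div, abs_mul, abs_of_pos (by linarith [one_le_mult grp q] : 0 < mult grp q)]
        have := one_le_mult grp q
        gcongr
        exact le_mul_of_one_le_right (abs_nonneg _) this
      have h1 : |α p / A p| ≤ ∑ q, |α q * mult grp q / A q| := (hle p).trans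
        (Finset.single_le_sum (f := fun q => |α q * mult grp q / A q|)
          (fun _ _ => abs_nonneg _) (Finset.mem_univ p))
      have h2 : |∑ q ∈ fib grp (grp p), α q / A q| ≤ ∑ q, |α q * mult grp q / A q| :=
        (Finset.abs_sum_le_sum_abs _ _).trans ((Finset.sum_le_sum fun q _ => hle q).trans
          (Finset.sum_le_sum_of_subset_of_nonneg (Finset.subset_univ _) fun _ _ _ => abs_nonneg _))
      have h3 : (∑ q ∈ fib grp (grp p), α q) / A p = ∑ q ∈ fib grp (grp p), α q / A q := by
        rw [Finset.sum_div]
        exact Finset.sum_congr rfl fun q hq => by rw [hA q p (Finset.mem_filter.mp hq).2]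
      have h4 : μ p / A p = 1 / 2 * (α p / A p) -
          1 / (4 * mult grp p) * ∑ q ∈ fib grp (grp p), α q / A q := by
        rw [← h3, hμ]; field_simp; ring
      rw [h4, one_mul]
      refine (abs_sub _ _).trans ?_
      rw [abs_mul, abs_mul, abs_of_pos (by norm_num : (0 : ℝ) < 1 / 2),
        abs_of_pos (by positivity : 0 < 1 / (4 * mult grp p))]
      have h5 : 1 / (4 * mult grp p) ≤ 1 / 2 := by
        apply one_div_le_one_div_of_le <;> linarith
      have h6 := mul_le_mul h5 h2 (abs_nonneg _) (by norm_num)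
      linarith)
  simp only [sqNorm, Finset.univ_unique, Finset.sum_singleton, one_pow, one_mul] at hμle
  refine (Finset.sum_le_sum fun p _ => hp p).trans ?_
  rw [← Finset.mul_sum]
  rcases isEmpty_or_nonempty P with hP | ⟨⟨p₀⟩⟩
  · simp [scale]
  have hn := two_mul_sub_one_pos (hreg p₀).two_le
  have hk := kap_pos (hreg p₀).two_le
  calc _ ≤ 124 * η ^ 2 * (kap d / (2 * d - 1)) *
        ((Fintype.card P : ℝ) ^ 2 * ∑ p, (α p * mult grp p / A p) ^ 2) := by gcongr
    _ = _ := by rw [scale]; ring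

/-- The relative error, as a multiple of `η`, in the comparison with the Cramér–Rao bound. -/
def errConst (P : Type) [Fintype P] : ℝ :=
  60000 * (Fintype.card P : ℝ) ^ 4 * (264 * (Fintype.card P : ℝ) ^ 2)

/-- The variance of the gradient `g'` of the estimator is of the order of `scale` and agrees with the
Cramér–Rao form `u J⁻¹ u` up to a relative error of order `η`. Both are compared with the variance
of the exactly unbiased statistic. -/
theorem compare_cramerRao [Nonempty P] [DecidableEq P]
    (hreg : ∀ p, Regime d η (A p) (θ p) (ζ p)) (hA : ∀ p q, grp p = grp q → A p = A q)
    (hη : errConst P * η ≤ 1 / 2) {α bθ bζ b : P → ℝ} (hbθ : ∀ p, |bθ p| ≤ |θ p|)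
    (hbζ : ∀ p, |bζ p - 1| ≤ η) (hb : ∀ p, |b p - 1| ≤ η)
    {r : P → Bool × Fin (2 * d - 1) → ℝ} (hr : ∀ p x, |r p x| ≤ 4 * |A p| / (2 * d - 1))
    {g' : P → Bool × Fin (2 * d - 1) → ℝ} (hg' : ∀ p x, g' p x = α p * mult grp p *
      (kap d / (2 * d - 1) * phaseStat d (θ p) (ζ p) (b p) x + r p x))
    {J : Matrix (P × Fin 3) (P × Fin 3) ℝ} (hJ : J.PosDef)
    (hq : ∀ v, v ⬝ᵥ (J *ᵥ v) = infoForm grp (zeroProb grp d θ ζ) (zeroResp grp d θ ζ v))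
    {u : P × Fin 3 → ℝ} (hu : ∀ p i, u (p, i) = ![α p * bθ p, α p * bζ p, 0] i) :
    covForm grp (zeroProb grp d θ ζ) g' ≤ 3 * scale grp d A α ∧
    (0 < scale grp d A α → 0 < u ⬝ᵥ (J⁻¹ *ᵥ u)) ∧
    |covForm grp (zeroProb grp d θ ζ) g' - u ⬝ᵥ (J⁻¹ *ᵥ u)| ≤
      4 * errConst P * η * (u ⬝ᵥ (J⁻¹ *ᵥ u)) := by
  obtain ⟨p₀⟩ := ‹Nonempty P›
  have : Nonempty P := ⟨p₀⟩
  have hη1 := (hreg p₀).le_eta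
  have hη0 := (hreg p₀).eta_pos
  have hd := (hreg p₀).two_le
  set K : ℝ := (Fintype.card P : ℝ) with hK
  have hK1 : 1 ≤ K := by rw [hK]; exact_mod_cast Fintype.card_pos (α := P)
  have hK2 : 1 ≤ K ^ 2 := one_le_pow₀ hK1
  have hK4 : 1 ≤ K ^ 4 := one_le_pow₀ hK1
  set π := zeroProb grp d θ ζ with hπ
  have hn : NearIdeal grp η π := nearIdeal_zeroProb hreg
  set R := scale grp d A α with hR
  have hsq : sqNorm (refAll grp d A α) = R := sqNorm_refAll hd (fun p => (hreg p).A_ne) α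
  have hR0 : 0 ≤ R := hsq ▸ sqNorm_nonneg _
  set g : P → Bool × Fin (2 * d - 1) → ℝ := fun p x =>
    α p * mult grp p * exactStat d (θ p) (ζ p) (bθ p) (bζ p) x with hg
  set v₀ : P × Fin 3 → ℝ := fun x => ![0, refDir grp d A α x.1, -d * refDir grp d A α x.1] x.2
    with hv₀
  have hC : 264 * η ^ 2 * R ≤ 264 * K ^ 2 * η ^ 2 * R := by
    have : 264 * 1 * η ^ 2 * R ≤ 264 * K ^ 2 * η ^ 2 * R := by gcongr
    linarith
  have b1 : sqNorm (g - refAll grp d A α) ≤ 264 * K ^ 2 * η ^ 2 * R := by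
    choose r₁ hr₁ hr₁' using fun p => (hreg p).exists_exactStat_eq (hbθ p) (bζ p)
    have e : g = fun p x => α p * mult grp p *
        (kap d / (2 * d - 1) * phaseStat d (θ p) (ζ p) (bζ p) x + r₁ p x) := by
      funext p x
      rw [hg]; simp only [hr₁']
    rw [e]
    exact (sqNorm_stat_sub_le hreg hbζ hr₁).trans hC
  have b2 : sqNorm (g' - refAll grp d A α) ≤ 264 * K ^ 2 * η ^ 2 * R := by
    rw [show g' = _ from funext fun p => funext fun x => hg' p x]
    exact (sqNorm_stat_sub_le hreg hb hr).trans hC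
  have b3 : sqNorm (zeroResp grp d θ ζ v₀ - idealCov grp (refAll grp d A α)) ≤
      264 * K ^ 2 * η ^ 2 * R := by
    refine (sqNorm_zeroResp_sub_le hreg hA α).trans ?_
    rw [← hK, ← hR]
    gcongr
    norm_num
  have hCη : 264 * K ^ 2 * η ^ 2 ≤ 1 / 8 := by
    have h1 : 60000 * 1 * (264 * K ^ 2) * η ≤ errConst P * η := by
      rw [errConst, ← hK]; gcongr
    have h2 : 264 * K ^ 2 * η * η ≤ 264 * K ^ 2 * η * (1 / 100) := by gcongr
    nlinarith
  obtain ⟨c1, c2, c3, c4⟩ := hn.compare hη1 hη0 (C := 264 * K ^ 2) (by linarith) hCη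
    (hsq ▸ b1) (hsq ▸ b2) (hsq ▸ b3)
  rw [hsq] at c1 c2
  rw [← hK] at c2 c3 c4
  have hE : 60000 * K ^ 4 * (264 * K ^ 2) = errConst P := rfl
  rw [hE] at c3 c4
  set W := covForm grp π g with hW
  set B := u ⬝ᵥ (J⁻¹ *ᵥ u) with hB
  -- the statistic `g` is exactly unbiased
  have hunb : ∀ v, ∑ p, ∑ x, g p x * zeroResp grp d θ ζ v p x = u ⬝ᵥ v := by
    intro v
    rw [dotProduct, Fintype.sum_prod_type]
    refine Finset.sum_congr rfl fun p _ => ?_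
    have hM : mult grp p ≠ 0 := by linarith [one_le_mult grp p]
    have e : ∀ x, g p x * zeroResp grp d θ ζ v p x = α p *
        (exactStat d (θ p) (ζ p) (bθ p) (bζ p) x * resp d (θ p) (ζ p) (fun i => v (p, i)) x) := by
      intro x
      rw [hg, zeroResp]; field_simp
    simp_rw [e]
    rw [← Finset.mul_sum, (hreg p).sum_exactStat_mul_resp, Fin.sum_univ_three]
    simp only [hu, Matrix.cons_val_zero, Matrix.cons_val_one, Matrix.cons_val]
    ring
  have hne : ∀ p x, π p x ≠ 0 := fun p x => (hn.pos hη1 p x).ne'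
  have hne1 : ∀ γ x, 1 - ∑ p ∈ fib grp γ, π p x ≠ 0 := fun γ x => by
    have := hn.sum_le hη1 γ x
    linarith
  have hid : ∀ v, infoForm grp π (fun p x => zeroResp grp d θ ζ v p x - covOp grp π g p x) =
      v ⬝ᵥ (J *ᵥ v) - 2 * (u ⬝ᵥ v) + W := by
    intro v
    rw [infoForm_sub_covOp grp hne hne1, hunb, hq]
  -- the information in the direction `v₀` bounds the Cramér–Rao form from below
  have lower : W - errConst P * η * W ≤ B := by
    have h1 := two_mul_dotProduct_sub_le hJ u v₀
    rw [hid v₀] at c4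
    linarith
  -- an unbiased statistic cannot beat the Cramér–Rao form
  have upper : B ≤ W := by
    have h1 := hid (J⁻¹ *ᵥ u)
    rw [inv_mulVec_form hJ u, ← hB] at h1
    have h2 := infoForm_nonneg grp (fun p x => (hn.pos hη1 p x).le)
      (fun γ x => (hn.sum_le hη1 γ x).trans (by norm_num))
      (fun p x => zeroResp grp d θ ζ (J⁻¹ *ᵥ u) p x - covOp grp π g p x)
    rw [h1] at h2
    linarith
  have hW0 : 0 ≤ W := covForm_nonneg grp (fun p x => (hn.pos hη1 p x).le)
    (fun γ x => (hn.sum_le hη1 γ x).trans (by norm_num)) g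
  have hWB : W ≤ 2 * B := by nlinarith
  refine ⟨c1, fun h => ?_, ?_⟩
  · have : 0 < W := by
      by_contra hW'
      have : W = 0 := le_antisymm (not_lt.mp hW') hW0
      rw [this, mul_zero] at c2
      linarith
    linarith
  · have hEη : 0 ≤ errConst P * η := by rw [← hE]; positivity
    have h1 : errConst P * η * W ≤ errConst P * η * (2 * B) := by gcongr
    calc _ ≤ |covForm grp π g' - W| + |W - B| := abs_sub_le _ _ _
      _ ≤ errConst P * η * W + errConst P * η * W := by
          refine add_le_add c3 ?_
          rw [abs_of_nonneg (by linarith)]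
          linarith
      _ ≤ _ := by linarith

end Core

/-! ### Fisher information of the two modes -/

/-- The derivative is taken at `χ = 0`, the true value. -/
lemma hasDerivAt_reconCoeff (d : ℕ) (θ ζ : ℝ) (v : Fin 3 → ℝ) (m : ℤ) :
    HasDerivAt (fun t : ℝ => reconCoeff d (θ + t * v 0) (ζ + t * v 1) (0 + t * v 2) m)
      (respCoeff d θ ζ v m) 0 := by
  have hlin : ∀ x y : ℝ, HasDerivAt (fun t : ℝ => x + t * y) y 0 := fun x y => by
    simpa using ((hasDerivAt_id (0 : ℝ)).mul_const y).const_add x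
  have h0 : HasDerivAt (fun t : ℝ => amp d (θ + t * v 0) m)
      (deriv (fun t => amp d t m) θ * v 0) 0 := by
    have h1 : HasDerivAt (fun t => amp d t m) (deriv (fun t => amp d t m) (θ + 0 * v 0))
        (θ + 0 * v 0) := (differentiable_amp d m _).hasDerivAt
    have := h1.comp (0 : ℝ) (hlin θ (v 0))
    rw [zero_mul, add_zero] at this
    exact this
  have hA : HasDerivAt (fun t : ℝ => ((amp d (θ + t * v 0) m : ℝ) : ℂ)) _ 0 := h0.ofReal_comp
  have hz : HasDerivAt (fun t : ℝ => ((ζ + t * v 1 : ℝ) : ℂ)) _ 0 := (hlin ζ (v 1)).ofReal_comp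
  have hx : HasDerivAt (fun t : ℝ => ((0 + t * v 2 : ℝ) : ℂ)) _ 0 := (hlin 0 (v 2)).ofReal_comp
  have hE := ((((hz.const_mul (2 * (m : ℂ) + 1)).add hx).const_mul Complex.I).neg).cexp
  have := (hA.const_mul Complex.I).mul hE
  refine this.congr_deriv ?_
  simp only [Pi.neg_apply, Pi.add_apply, zero_mul, add_zero, Complex.ofReal_zero]
  rw [respCoeff, ph]
  push_cast
  linear_combination (-(amp d θ m : ℂ) * ((2 * m + 1) * v 1 + v 2) *
    Complex.exp (-(Complex.I * ((2 * (m : ℂ) + 1) * ζ)))) * Complex.I_sq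

/-- `comp` as a continuous linear map. -/
def compCLM (s : Bool) : ℂ →L[ℝ] ℝ := if s then Complex.imCLM else Complex.reCLM

lemma compCLM_apply (s : Bool) (z : ℂ) : compCLM s z = comp s z := by
  cases s <;> simp [comp, compCLM]

lemma differentiable_subspaceProb {n d : ℕ} (hd : 1 ≤ d) (p : Pair n) (s : Bool)
    (j : Fin (2 * d - 1)) : Differentiable ℝ (subspaceProb d p s j) := by
  have e : subspaceProb d p s j = fun ξ : Param n → ℝ => 1 / 2 + compCLM s
      (∑ m ∈ band d, reconCoeff d (ξ (p, 0)) (ξ (p, 1)) (ξ (p, 2)) m * mode d j m) := by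
    funext ξ
    rw [subspaceProb, bellProb_omega, recon_eq_synth hd, compCLM_apply, synth]
  rw [e]
  have hc : ∀ i, Differentiable ℝ fun ξ : Param n → ℝ => ((ξ (p, i) : ℝ) : ℂ) := fun i =>
    Complex.ofRealCLM.differentiable.comp (differentiable_apply (p, i))
  have ha : ∀ m, Differentiable ℝ fun ξ : Param n → ℝ => ((amp d (ξ (p, 0)) m : ℝ) : ℂ) := fun m =>
    Complex.ofRealCLM.differentiable.comp ((differentiable_amp d m).comp (differentiable_apply (p, 0)))
  refine ((compCLM s).differentiable.comp (Differentiable.fun_sum fun m _ => ?_)).const_add _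
  exact ((((ha m).const_mul _).mul ((((hc 1).const_mul _).add (hc 2)).const_mul _).neg.cexp)).mul_const _

/-- The derivative of the logical-zero probability is the response of the record. -/
lemma fderiv_subspaceProb {n d : ℕ} (hd : 1 ≤ d) (p : Pair n) (s : Bool) (j : Fin (2 * d - 1))
    {ξ : Param n → ℝ} (hξ : ξ (p, 2) = 0) (v : Param n → ℝ) :
    fderiv ℝ (subspaceProb d p s j) ξ v =
      resp d (ξ (p, 0)) (ξ (p, 1)) (fun i => v (p, i)) (s, j) := by
  have h1 := (differentiable_subspaceProb hd p s j ξ).hasFDerivAt.hasLineDerivAt v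
  refine h1.unique ?_
  have h2 : HasDerivAt (fun t : ℝ => synth d (reconCoeff d (ξ (p, 0) + t * v (p, 0))
      (ξ (p, 1) + t * v (p, 1)) (0 + t * v (p, 2))) j)
      (synth d (respCoeff d (ξ (p, 0)) (ξ (p, 1)) (fun i => v (p, i))) j) 0 :=
    HasDerivAt.fun_sum fun m _ =>
      (hasDerivAt_reconCoeff d (ξ (p, 0)) (ξ (p, 1)) (fun i => v (p, i)) m).mul_const (mode d j m)
  have h3 := ((compCLM s).hasFDerivAt.comp_hasDerivAt (0 : ℝ) h2).const_add (1 / 2)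
  rw [compCLM_apply] at h3
  refine h3.congr_of_eventuallyEq (Eventually.of_forall fun t => ?_)
  simp only [Function.comp_apply, compCLM_apply]
  rw [subspaceProb, bellProb_omega, recon_eq_synth hd]
  simp only [Pi.add_apply, Pi.smul_apply, smul_eq_mul, hξ]

section Fisher

variable {P R : Type} [Fintype P] [DecidableEq P] [Fintype R]

lemma isHermitian_fisher (f : (P → ℝ) → R → ℝ) (ξ : P → ℝ) : (fisher f ξ).IsHermitian := by
  ext k l
  simp only [fisher, Matrix.conjTranspose_apply, Matrix.of_apply, star_trivial]
  exact Finset.sum_congr rfl fun r _ => by ring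

/-- The Fisher information as a quadratic form in the directional derivatives of the probabilities. -/
lemma dotProduct_fisher (f : (P → ℝ) → R → ℝ) (ξ v : P → ℝ) :
    v ⬝ᵥ (fisher f ξ *ᵥ v) = ∑ r, (fderiv ℝ (fun y => f y r) ξ v) ^ 2 / f ξ r := by
  have h : ∀ r, fderiv ℝ (fun y => f y r) ξ v =
      ∑ k, v k * fderiv ℝ (fun y => f y r) ξ (Pi.single k 1) := by
    intro r
    conv_lhs => rw [← Finset.univ_sum_single v]
    rw [map_sum]
    refine Finset.sum_congr rfl fun k _ => ?_
    have : (Pi.single k (v k) : P → ℝ) = v k • Pi.single k 1 := by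
      rw [← Pi.single_smul, smul_eq_mul, mul_one]
    rw [this, map_smul, smul_eq_mul]
  simp only [dotProduct, Matrix.mulVec, fisher, Matrix.of_apply, Finset.mul_sum, Finset.sum_mul]
  calc _ = ∑ k, ∑ r, ∑ l, v k * (fderiv ℝ (fun y => f y r) ξ (Pi.single k 1) *
        fderiv ℝ (fun y => f y r) ξ (Pi.single l 1) / f ξ r * v l) :=
        Finset.sum_congr rfl fun k _ => Finset.sum_comm
    _ = ∑ r, ∑ k, ∑ l, v k * (fderiv ℝ (fun y => f y r) ξ (Pi.single k 1) *
        fderiv ℝ (fun y => f y r) ξ (Pi.single l 1) / f ξ r * v l) := Finset.sum_comm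
    _ = _ := by
        refine Finset.sum_congr rfl fun r _ => ?_
        rw [h r, sq, Finset.sum_mul_sum, Finset.sum_div]
        refine Finset.sum_congr rfl fun k _ => ?_
        rw [Finset.sum_div]
        exact Finset.sum_congr rfl fun l _ => by ring

end Fisher

lemma sum_fib_roundOf {n : ℕ} (i : Round n) (f : Pair n → ℝ) :
    ∑ p ∈ fib roundOf i, f p = ∑ k : Later i.1, f (toPair i.1 k) := by
  refine (Finset.sum_bij (fun k _ => toPair i.1 k) ?_ ?_ ?_ ?_).symm
  · intro k _
    simp only [fib, Finset.mem_filter, Finset.mem_univ, true_and]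
    rfl
  · intro k _ l _ h
    exact Subtype.ext (congrArg (fun p : Pair n => p.1.2) h)
  · intro p hp
    have : roundOf p = i := (Finset.mem_filter.mp hp).2
    subst this
    exact ⟨⟨p.1.2, p.2⟩, Finset.mem_univ _, rfl⟩
  · intro k _; rfl

lemma mult_roundOf {n : ℕ} (p : Pair n) : mult roundOf p = Fintype.card (Later p.1.1) := by
  have h := sum_fib_roundOf (roundOf p) fun _ => (1 : ℝ)
  simp only [Finset.sum_const, nsmul_eq_mul, mul_one, Finset.card_univ] at h
  exact h

lemma fib_id {P : Type} [Fintype P] [DecidableEq P] (p : P) : fib id p = {p} := by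
  ext q; simp [fib]

lemma mult_id {P : Type} [Fintype P] [DecidableEq P] (p : P) : mult id p = 1 := by
  simp [mult, fib_id]

/-- One hybrid circuit records which of the logical zeros of its round occurred, if any. -/
lemma dotProduct_sum_fisher_hybrid {n d : ℕ} (hd : 1 ≤ d) {ξ : Param n → ℝ}
    (hξ : ∀ p, ξ (p, 2) = 0) (v : Param n → ℝ) :
    v ⬝ᵥ ((∑ x : HybridCircuit n d, fisher (hybridModel x) ξ) *ᵥ v) =
      infoForm roundOf (zeroProb roundOf d (fun p => ξ (p, 0)) fun p => ξ (p, 1))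
        (zeroResp roundOf d (fun p => ξ (p, 0)) (fun p => ξ (p, 1)) v) := by
  rw [Matrix.sum_mulVec, dotProduct_sum, Fintype.sum_prod_type, infoForm]
  refine Finset.sum_congr rfl fun i _ => Finset.sum_congr rfl fun x _ => ?_
  obtain ⟨s, j⟩ := x
  have hM : ∀ k : Later i.1, mult roundOf (toPair i.1 k) = Fintype.card (Later i.1) :=
    fun k => mult_roundOf _
  have hpr : ∀ k : Later i.1, subspaceProb d (toPair i.1 k) s j ξ / Fintype.card (Later i.1) =
      zeroProb roundOf d (fun p => ξ (p, 0)) (fun p => ξ (p, 1)) (toPair i.1 k) (s, j) := by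
    intro k
    rw [zeroProb, hM, subspaceProb, hξ]
  have hdiff : ∀ k : Later i.1, HasFDerivAt (fun y : Param n → ℝ =>
      subspaceProb d (toPair i.1 k) s j y / Fintype.card (Later i.1))
      ((Fintype.card (Later i.1) : ℝ)⁻¹ • fderiv ℝ (subspaceProb d (toPair i.1 k) s j) ξ) ξ := by
    intro k
    have := (differentiable_subspaceProb hd (toPair i.1 k) s j ξ).hasFDerivAt.const_mul
      ((Fintype.card (Later i.1) : ℝ)⁻¹)
    simpa only [div_eq_inv_mul] using this
  have hval : ∀ k : Later i.1, ((Fintype.card (Later i.1) : ℝ)⁻¹ •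
      fderiv ℝ (subspaceProb d (toPair i.1 k) s j) ξ) v =
      zeroResp roundOf d (fun p => ξ (p, 0)) (fun p => ξ (p, 1)) v (toPair i.1 k) (s, j) := by
    intro k
    rw [_root_.smul_apply, fderiv_subspaceProb hd _ s j (hξ _), zeroResp, hM, smul_eq_mul,
      inv_mul_eq_div]
  rw [dotProduct_fisher, Fintype.sum_option, sum_fib_roundOf, sum_fib_roundOf, sum_fib_roundOf,
    add_comm]
  congr 1
  · refine Finset.sum_congr rfl fun k _ => ?_
    simp only [hybridModel]
    rw [(hdiff k).fderiv, hval, hpr]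
  · simp only [hybridModel]
    have h1 := (HasFDerivAt.fun_sum fun (k : Later i.1) (_ : k ∈ Finset.univ) => hdiff k).const_sub 1
    rw [h1.fderiv, _root_.neg_apply, _root_.sum_apply, neg_sq]
    simp_rw [hval, hpr]

/-- One analog circuit records whether its single logical zero occurred. -/
lemma dotProduct_sum_fisher_analog {n d : ℕ} (hd : 1 ≤ d) {ξ : Param n → ℝ}
    (hξ : ∀ p, ξ (p, 2) = 0) (v : Param n → ℝ) :
    v ⬝ᵥ ((∑ x : AnalogCircuit n d, fisher (analogModel x) ξ) *ᵥ v) =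
      infoForm id (zeroProb id d (fun p => ξ (p, 0)) fun p => ξ (p, 1))
        (zeroResp id d (fun p => ξ (p, 0)) (fun p => ξ (p, 1)) v) := by
  rw [Matrix.sum_mulVec, dotProduct_sum, Fintype.sum_prod_type, infoForm]
  refine Finset.sum_congr rfl fun p _ => Finset.sum_congr rfl fun x _ => ?_
  obtain ⟨s, j⟩ := x
  have hpr : subspaceProb d p s j ξ =
      zeroProb id d (fun p => ξ (p, 0)) (fun p => ξ (p, 1)) p (s, j) := by
    rw [zeroProb, mult_id, subspaceProb, hξ, div_one]
  have hdiff := (differentiable_subspaceProb hd p s j ξ).hasFDerivAt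
  have hval : fderiv ℝ (subspaceProb d p s j) ξ v =
      zeroResp id d (fun p => ξ (p, 0)) (fun p => ξ (p, 1)) v p (s, j) := by
    rw [fderiv_subspaceProb hd _ s j (hξ _), zeroResp, mult_id, div_one]
  rw [dotProduct_fisher, Fintype.sum_bool, fib_id, Finset.sum_singleton, Finset.sum_singleton,
    Finset.sum_singleton]
  simp only [analogModel]
  rw [(hdiff.const_sub 1).fderiv, _root_.neg_apply, neg_sq, ← hpr, ← hval]

lemma isHermitian_sum {P X : Type} (s : Finset X) {f : X → Matrix P P ℝ}
    (h : ∀ x, (f x).IsHermitian) : (∑ x ∈ s, f x).IsHermitian := by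
  rw [Matrix.IsHermitian, Matrix.conjTranspose_sum]
  exact Finset.sum_congr rfl fun x _ => h x

/-! ### Differential and asymptotic variance of the estimator -/

/-- The change of the reconstruction function when the rescaled frequency of the circuit `x`
increases. -/
def unitRec (d : ℕ) (x : Bool × Fin (2 * d - 1)) (j : Fin (2 * d - 1)) : ℂ :=
  if j = x.2 then prepPhase x.1 else 0

lemma norm_prepPhase (s : Bool) : ‖prepPhase s‖ = 1 := by cases s <;> simp [prepPhase]

lemma comp_eq_re (s : Bool) (z : ℂ) : comp s z = (star z * prepPhase s).re := by
  cases s <;> simp [comp, prepPhase]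

lemma fourier_unitRec (d : ℕ) (x : Bool × Fin (2 * d - 1)) (k : ℕ) :
    fourier d (unitRec d x) k = 1 / (2 * (d : ℂ) - 1) * (star (mode d x.2 k) * prepPhase x.1) := by
  rw [fourier, Finset.sum_eq_single x.2]
  · rw [unitRec, if_pos rfl, star_mode, mode]
    congr 3
    push_cast
    ring
  · intro j _ hj
    rw [unitRec, if_neg hj, mul_zero]
  · simp

lemma norm_fourier_unitRec {d : ℕ} (hd : 2 ≤ d) (x : Bool × Fin (2 * d - 1)) (k : ℕ) :
    ‖fourier d (unitRec d x) k‖ = 1 / (2 * d - 1) := by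
  have e : (1 / (2 * (d : ℂ) - 1)) = ((1 / (2 * (d : ℝ) - 1) : ℝ) : ℂ) := by push_cast; rfl
  have hn := two_mul_sub_one_pos hd
  rw [fourier_unitRec, e, norm_mul, norm_mul, norm_star, norm_mode, norm_prepPhase,
    Complex.norm_real, Real.norm_eq_abs, abs_of_pos (by positivity)]
  ring

lemma phaseStat_eq_sum (d : ℕ) (θ ζ b : ℝ) (x : Bool × Fin (2 * d - 1)) :
    phaseStat d θ ζ b x =
      ∑ k ∈ Finset.range d, wt d k * (b / amp d θ k) * comp x.1 (ph ζ k * mode d x.2 k) := by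
  rw [phaseStat, synth, ← sum_band_ite d fun m =>
    wt d m * (b / amp d θ m) * comp x.1 (ph ζ m * mode d x.2 m), ← compCLM_apply, map_sum]
  refine Finset.sum_congr rfl fun m _ => ?_
  rw [compCLM_apply]
  split_ifs
  · rw [← comp_smul]
    congr 1
    push_cast
    ring
  · rw [zero_mul, comp_eq_re]; simp

lemma phaseStat_eq_mul (d : ℕ) (θ ζ b : ℝ) (x : Bool × Fin (2 * d - 1)) :
    phaseStat d θ ζ b x = b * phaseStat d θ ζ 1 x := by
  rw [phaseStat_eq_sum, phaseStat_eq_sum, Finset.mul_sum]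
  exact Finset.sum_congr rfl fun k _ => by ring

namespace Regime

variable {d : ℕ} {η A θ ζ : ℝ}

/-- At the exact reconstruction function `θ̂` is the mean of `|amp_m|`, hence of the order of `|θ|`. It
is neither unbiased nor does it see the sign of `θ`; the splitting angle depends on it so weakly that
only this bound matters. -/
lemma thetaHat_recon (h : Regime d η A θ ζ) :
    thetaHat d (recon d θ ζ 0) ≠ 0 ∧ |thetaHat d (recon d θ ζ 0)| ≤ 102 / 100 * |A| := by
  have hd := h.d_ge
  have hA := h.A_pos
  have e : thetaHat d (recon d θ ζ 0) = (1 / (d : ℝ)) * ∑ k : Fin d, |amp d θ (k : ℕ)| := by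
    rw [thetaHat]
    congr 1
    refine Finset.sum_congr rfl fun k _ => ?_
    rw [fourier_recon k.2, norm_mul, norm_mul, norm_ph, Complex.norm_I, Complex.norm_real,
      Real.norm_eq_abs, one_mul, mul_one]
  have hup : ∑ k : Fin d, |amp d θ (k : ℕ)| ≤ d * (102 / 100 * |A|) := by
    refine (Finset.sum_le_sum fun (k : Fin d) _ => h.abs_amp_le (mem_band k.2)).trans ?_
    simp
  have hlo : d * (98 / 100 * |A|) ≤ ∑ k : Fin d, |amp d θ (k : ℕ)| := by
    refine le_trans ?_ (Finset.sum_le_sum fun (k : Fin d) _ =>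
      h.le_abs_amp (mem_band k.2) (by positivity))
    simp
  have hS : 0 < ∑ k : Fin d, |amp d θ (k : ℕ)| := lt_of_lt_of_le (by positivity) hlo
  have hd0 : (0 : ℝ) < d := by linarith
  rw [e]
  refine ⟨by positivity, ?_⟩
  rw [abs_of_pos (by positivity), one_div_mul_eq_div, div_le_iff₀ hd0]
  linarith

/-- The differential of the phase estimator in the coordinates of the record is the phase statistic. -/
lemma sum_zetaWeight_unitRec (h : Regime d η A θ ζ) (x : Bool × Fin (2 * d - 1)) :
    ∑ k ∈ Finset.range d, zetaWeight d k *
      (fourier d (unitRec d x) k / fourier d (recon d θ ζ 0) k).im =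
      kap d / (2 * d - 1) * phaseStat d θ ζ 1 x := by
  have hn := two_mul_sub_one_pos h.two_le
  rw [phaseStat_eq_sum, Finset.mul_sum]
  refine Finset.sum_congr rfl fun k hk => ?_
  have hk := Finset.mem_range.mp hk
  have hH := h.amp_ne (mem_band hk) (by positivity)
  have hHC : (amp d θ k : ℂ) ≠ 0 := by exact_mod_cast hH
  have h2 : ph ζ k ≠ 0 := by rw [← norm_ne_zero_iff, norm_ph]; exact one_ne_zero
  have e : fourier d (unitRec d x) k / fourier d (recon d θ ζ 0) k =
      ((-(1 / ((2 * d - 1) * amp d θ k)) : ℝ) : ℂ) *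
        (Complex.I * (star (ph ζ k * mode d x.2 k) * prepPhase x.1)) := by
    rw [fourier_recon hk, fourier_unitRec]
    have hnC : 2 * (d : ℂ) - 1 ≠ 0 := by
      have := hn.ne'
      exact_mod_cast this
    have hinv : star (ph ζ k) = (ph ζ k)⁻¹ := eq_inv_of_mul_eq_one_left (star_ph_mul ζ k)
    rw [star_mul', hinv]
    push_cast
    field_simp
    rw [Complex.I_sq]
    ring
  rw [e, Complex.im_ofReal_mul, Complex.I_mul_im, ← comp_eq_re, zetaWeight, wt, kap]
  push_cast
  have : (d : ℝ) - 1 ≠ 0 := by linarith [h.d_ge]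
  field_simp
  ring

/-- The differential of the estimated splitting of one subspace. -/
lemma exists_hasFDerivAt_estimate (h : Regime d η A θ ζ) {δ : ℝ}
    (hs : ∀ θ ζ : ℝ, θ ≠ 0 → |θ| ≤ δ → |ζ| ≤ δ → ∃ bθ bζ : ℝ,
      HasFDerivAt (fun x : ℝ × ℝ => splittingAngle x.1 x.2)
        (bθ • ContinuousLinearMap.fst ℝ ℝ ℝ + bζ • ContinuousLinearMap.snd ℝ ℝ ℝ) (θ, ζ) ∧
      |bζ - 1| ≤ η ∧ |bθ| ≤ |θ|)
    (hAδ : 2 * |A| ≤ δ) (hζδ : |ζ| ≤ δ) :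
    ∃ (L : (Fin (2 * d - 1) → ℂ) →L[ℝ] ℝ) (b : ℝ) (r : Bool × Fin (2 * d - 1) → ℝ),
      HasFDerivAt (fun h => splittingAngle (thetaHat d h) (zetaHat d h)) L (recon d θ ζ 0) ∧
      |b - 1| ≤ η ∧ (∀ x, |r x| ≤ 4 * |A| / (2 * d - 1)) ∧
      ∀ x, L (unitRec d x) = kap d / (2 * d - 1) * phaseStat d θ ζ b x + r x := by
  have hd := h.two_le
  have hA := h.A_pos
  have hn := two_mul_sub_one_pos hd
  have hF : ∀ k, k < d → fourier d (recon d θ ζ 0) k =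
      Complex.I * ((amp d θ k : ℝ) : ℂ) * Complex.exp (-(Complex.I * ((2 * (k : ℂ) + 1) * ζ))) := by
    intro k hk
    rw [fourier_recon hk, ph]
    push_cast
    rfl
  have hζ : |ζ| < Real.pi / 2 := by
    have := h.zeta_le
    have := h.le_eta
    have := Real.pi_gt_three
    linarith
  obtain ⟨hz0, Lz, hLz, hLz'⟩ := exists_hasFDerivAt_zetaHat hd (H := fun k => amp d θ k) hF
    (fun k hk => h.amp_mul_pos (by omega) hk) hζ
  have hne : ∀ k, k < d → fourier d (recon d θ ζ 0) k ≠ 0 := by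
    intro k hk
    rw [fourier_recon hk]
    have h1 : (amp d θ k : ℂ) ≠ 0 := by
      exact_mod_cast h.amp_ne (mem_band hk) (by positivity)
    have h2 : ph ζ k ≠ 0 := by rw [← norm_ne_zero_iff, norm_ph]; exact one_ne_zero
    exact mul_ne_zero (mul_ne_zero Complex.I_ne_zero h1) h2
  obtain ⟨Lt, hLt, hLt'⟩ := exists_hasFDerivAt_thetaHat hne
  obtain ⟨ht0, ht1⟩ := h.thetaHat_recon
  obtain ⟨bθ, bζ, hder, hbζ, hbθ⟩ := hs (thetaHat d (recon d θ ζ 0)) ζ ht0 (by linarith) hζδ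
  have hder' : HasFDerivAt (fun x : ℝ × ℝ => splittingAngle x.1 x.2)
      (bθ • ContinuousLinearMap.fst ℝ ℝ ℝ + bζ • ContinuousLinearMap.snd ℝ ℝ ℝ)
      (thetaHat d (recon d θ ζ 0), zetaHat d (recon d θ ζ 0)) := by
    rw [hz0]; exact hder
  have hcomp := HasFDerivAt.comp (g := fun x : ℝ × ℝ => splittingAngle x.1 x.2)
    (f := fun h => (thetaHat d h, zetaHat d h)) (recon d θ ζ 0) hder' (hLt.prodMk hLz)
  refine ⟨_, bζ, fun x => bθ * Lt (unitRec d x), hcomp, hbζ, fun x => ?_, fun x => ?_⟩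
  · have h1 : |Lt (unitRec d x)| ≤ 1 / (2 * d - 1) := by
      refine (hLt' _).trans (le_of_eq ?_)
      simp_rw [norm_fourier_unitRec hd]
      have : (d : ℝ) ≠ 0 := by linarith [h.d_ge]
      rw [Finset.sum_const, Finset.card_univ, Fintype.card_fin, nsmul_eq_mul]
      field_simp
    rw [abs_mul]
    calc |bθ| * |Lt (unitRec d x)| ≤ (4 * |A|) * (1 / (2 * d - 1)) := by
          refine mul_le_mul ?_ h1 (abs_nonneg _) (by positivity)
          linarith
      _ = _ := by ring
  · have h1 : Lz (unitRec d x) = kap d / (2 * d - 1) * phaseStat d θ ζ 1 x := by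
      rw [hLz', h.sum_zetaWeight_unitRec]
    have h3 : (bθ • ContinuousLinearMap.fst ℝ ℝ ℝ + bζ • ContinuousLinearMap.snd ℝ ℝ ℝ)
        (Lt (unitRec d x), Lz (unitRec d x)) = bθ * Lt (unitRec d x) + bζ * Lz (unitRec d x) := rfl
    refine h3.trans ?_
    rw [h1, phaseStat_eq_mul d θ ζ bζ]
    ring

end Regime

section Estimator

variable {n d : ℕ} {Γ : Type} [Fintype Γ] [DecidableEq Γ]

/-- The reconstruction function as a function of a table `F` of frequencies, when the subspaces
`p` with the same value of `grp p` share their circuits. -/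
def genH (S : SubspaceChoice n) (grp : Pair n → Γ)
    (F : Γ × Bool × Fin (2 * d - 1) → Bits n → ℝ) (p : Pair n) (j : Fin (2 * d - 1)) : ℂ :=
  ((mult grp p * F (grp p, false, j) (S.zero p) - 1 / 2 : ℝ) : ℂ) +
    Complex.I * ((mult grp p * F (grp p, true, j) (S.zero p) - 1 / 2 : ℝ) : ℂ)

lemma hybridH_eq_genH {N : ℕ} (S : SubspaceChoice n) (data : HybridCircuit n d × Fin N → Bits n) :
    hybridH S data = genH S roundOf (freq data) := by
  funext p j
  simp only [hybridH, genH, mult_roundOf]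

lemma analogH_eq_genH {N : ℕ} (S : SubspaceChoice n) (data : AnalogCircuit n d × Fin N → Bits n) :
    analogH S data = genH S id (freq data) := by
  funext p j
  simp only [analogH, genH, mult_id, one_mul, id]

/-- The linear part of `genH`. -/
def genHCLM (S : SubspaceChoice n) (grp : Pair n → Γ) (p : Pair n) :
    (Γ × Bool × Fin (2 * d - 1) → Bits n → ℝ) →L[ℝ] (Fin (2 * d - 1) → ℂ) :=
  LinearMap.toContinuousLinearMap
    { toFun := fun F j => ((mult grp p * F (grp p, false, j) (S.zero p) : ℝ) : ℂ) +
        Complex.I * ((mult grp p * F (grp p, true, j) (S.zero p) : ℝ) : ℂ)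
      map_add' := fun F G => by
        funext j; simp only [Pi.add_apply]; push_cast; ring
      map_smul' := fun r F => by
        funext j
        simp only [Pi.smul_apply, smul_eq_mul, RingHom.id_apply, Complex.real_smul]
        push_cast; ring }

lemma hasFDerivAt_genH (S : SubspaceChoice n) (grp : Pair n → Γ) (p : Pair n)
    (F : Γ × Bool × Fin (2 * d - 1) → Bits n → ℝ) :
    HasFDerivAt (fun F => genH S grp F p) (genHCLM S grp p) F := by
  have e : (fun F => genH S grp F p) =
      fun F : Γ × Bool × Fin (2 * d - 1) → Bits n → ℝ =>
        (fun _ => -(1 / 2 + Complex.I * (1 / 2))) + genHCLM S grp p F := by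
    funext F j
    simp only [genH, genHCLM, LinearMap.coe_toContinuousLinearMap', LinearMap.coe_mk,
      AddHom.coe_mk, Pi.add_apply]
    push_cast
    ring
  rw [e]
  exact (genHCLM S grp p).hasFDerivAt.const_add _

lemma genHCLM_single (S : SubspaceChoice n) (grp : Pair n → Γ) (p : Pair n) (γ : Γ)
    (x : Bool × Fin (2 * d - 1)) (b : Bits n) :
    genHCLM S grp p (Pi.single (γ, x) (Pi.single b 1)) =
      if grp p = γ ∧ S.zero p = b then mult grp p • unitRec d x else 0 := by
  obtain ⟨s, j⟩ := x
  funext l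
  have hs : ∀ s', (Pi.single (γ, s, j) (Pi.single b 1) : Γ × Bool × Fin (2 * d - 1) → Bits n → ℝ)
      (grp p, s', l) (S.zero p) =
      if (grp p = γ ∧ S.zero p = b) ∧ s' = s ∧ l = j then 1 else 0 := by
    intro s'
    by_cases h1 : (grp p, s', l) = (γ, s, j)
    · rw [h1, Pi.single_eq_same, Pi.single_apply]
      simp only [Prod.mk.injEq] at h1
      simp [h1.1, h1.2.1, h1.2.2]
    · rw [Pi.single_eq_of_ne h1, Pi.zero_apply, if_neg]
      rintro ⟨⟨h2, -⟩, h3, h4⟩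
      exact h1 (by rw [h2, h3, h4])
  simp only [genHCLM, LinearMap.coe_toContinuousLinearMap', LinearMap.coe_mk, AddHom.coe_mk, hs]
  by_cases h1 : grp p = γ ∧ S.zero p = b
  · rw [if_pos h1]
    by_cases h2 : l = j
    · cases s <;> simp [h1, h2, unitRec, prepPhase, mul_comm]
    · simp [h2, unitRec]
  · simp [h1]

/-- Only the logical zeros enter the estimator, so its asymptotic variance is the covariance form
of the multinomial record. -/
lemma sum_outcomeVar {S : SubspaceChoice n} {grp : Pair n → Γ}
    (hinj : ∀ p q, grp p = grp q → S.zero p = S.zero q → p = q) {X : Type} [Fintype X]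
    (prob : Γ × X → Bits n → ℝ) (g : Pair n → X → ℝ) :
    ∑ x : Γ × X, outcomeVar (prob x) (fun b =>
      ∑ p, if grp p = x.1 ∧ S.zero p = b then g p x.2 else 0) =
      covForm grp (fun p x => prob (grp p, x) (S.zero p)) g := by
  rw [Fintype.sum_prod_type, covForm]
  refine Finset.sum_congr rfl fun γ _ => Finset.sum_congr rfl fun x _ => ?_
  set G : Bits n → ℝ := fun b => ∑ p, if grp p = γ ∧ S.zero p = b then g p x else 0 with hG
  have hGf : ∀ b, G b = ∑ p ∈ fib grp γ, if S.zero p = b then g p x else 0 := by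
    intro b
    rw [hG, fib, Finset.sum_filter]
    refine Finset.sum_congr rfl fun p _ => ?_
    by_cases h1 : grp p = γ <;> by_cases h2 : S.zero p = b <;> simp [h1, h2]
  have hGz : ∀ p ∈ fib grp γ, G (S.zero p) = g p x := by
    intro p hp
    have hp' := (Finset.mem_filter.mp hp).2
    rw [hGf, Finset.sum_eq_single p]
    · rw [if_pos rfl]
    · intro q hq hqp
      rw [if_neg]
      intro h
      exact hqp (hinj q p ((Finset.mem_filter.mp hq).2.trans hp'.symm) h)
    · exact fun h => (h hp).elim
  have hsum : ∀ w : Bits n → ℝ, ∑ b, w b * G b = ∑ p ∈ fib grp γ, w (S.zero p) * g p x := by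
    intro w
    simp_rw [hGf, Finset.mul_sum]
    rw [Finset.sum_comm]
    refine Finset.sum_congr rfl fun p _ => ?_
    simp
  rw [outcomeVar]
  have e1 : ∑ b, prob (γ, x) b * G b ^ 2 =
      ∑ p ∈ fib grp γ, prob (grp p, x) (S.zero p) * g p x ^ 2 := by
    have := hsum fun b => prob (γ, x) b * G b
    simp only [mul_assoc, ← sq] at this
    rw [this]
    refine Finset.sum_congr rfl fun p hp => ?_
    rw [hGz p hp, (Finset.mem_filter.mp hp).2, sq]
  have e2 : ∑ b, prob (γ, x) b * G b =
      ∑ p ∈ fib grp γ, prob (grp p, x) (S.zero p) * g p x := by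
    rw [hsum]
    refine Finset.sum_congr rfl fun p hp => ?_
    rw [(Finset.mem_filter.mp hp).2]
  change ∑ b, prob (γ, x) b * G b ^ 2 - (∑ b, prob (γ, x) b * G b) ^ 2 = _
  rw [e1, e2]

/-- Asymptotic variance of the coupling estimator. -/
lemma exists_tendsto_variance {S : SubspaceChoice n} {grp : Pair n → Γ}
    (hinj : ∀ p q, grp p = grp q → S.zero p = S.zero q → p = q) {T η δ : ℝ}
    (hs : ∀ θ ζ : ℝ, θ ≠ 0 → |θ| ≤ δ → |ζ| ≤ δ → ∃ bθ bζ : ℝ,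
      HasFDerivAt (fun x : ℝ × ℝ => splittingAngle x.1 x.2)
        (bθ • ContinuousLinearMap.fst ℝ ℝ ℝ + bζ • ContinuousLinearMap.snd ℝ ℝ ℝ) (θ, ζ) ∧
      |bζ - 1| ≤ η ∧ |bθ| ≤ |θ|)
    {A θ ζ : Pair n → ℝ} (hreg : ∀ p, Regime d η (A p) (θ p) (ζ p))
    (hAδ : ∀ p, 2 * |A p| ≤ δ) (hζδ : ∀ p, |ζ p| ≤ δ)
    {prob : Γ × Bool × Fin (2 * d - 1) → Bits n → ℝ} (h0 : ∀ x b, 0 ≤ prob x b)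
    (h1 : ∀ x, ∑ b, prob x b = 1)
    (hprob : ∀ p x, prob (grp p, x) (S.zero p) = zeroProb grp d θ ζ p x) (q : Pair n) :
    ∃ (b : Pair n → ℝ) (r g : Pair n → Bool × Fin (2 * d - 1) → ℝ), (∀ p, |b p - 1| ≤ η) ∧
      (∀ p x, |r p x| ≤ 4 * |A p| / (2 * d - 1)) ∧
      (∀ p x, g p x = recoverCoeff S q.1.1 q.1.2 p / T * mult grp p *
        (kap d / (2 * d - 1) * phaseStat d (θ p) (ζ p) (b p) x + r p x)) ∧
      Tendsto (fun N : ℕ => (N : ℝ) *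
        Var[fun data => couplingHat S T (genH S grp (freq data)) q; dataLaw prob N]) atTop
        (nhds (covForm grp (zeroProb grp d θ ζ) g)) := by
  choose L b r hL hb hr hLr using fun p =>
    (hreg p).exists_hasFDerivAt_estimate hs (hAδ p) (hζδ p)
  set α : Pair n → ℝ := fun p => recoverCoeff S q.1.1 q.1.2 p / T with hα
  have hrec : ∀ p, genH S grp prob p = recon d (θ p) (ζ p) 0 := by
    intro p
    funext j
    have hM : mult grp p ≠ 0 := by linarith [one_le_mult grp p]
    rw [genH, hprob, hprob, recon]
    simp only [zeroProb, mul_div_cancel₀ _ hM]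
  have hΦ : (fun F : Γ × Bool × Fin (2 * d - 1) → Bits n → ℝ => couplingHat S T (genH S grp F) q) =
      fun F => ∑ p, α p *
        splittingAngle (thetaHat d (genH S grp F p)) (zetaHat d (genH S grp F p)) := by
    funext F
    rw [couplingHat, recover_eq_sum]
  have hder : HasFDerivAt (fun F : Γ × Bool × Fin (2 * d - 1) → Bits n → ℝ =>
      couplingHat S T (genH S grp F) q)
      (∑ p, α p • (L p).comp (genHCLM S grp p)) prob := by
    rw [hΦ]
    refine HasFDerivAt.fun_sum fun p _ => ?_
    have h2 := hL p
    rw [← hrec p] at h2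
    exact (h2.comp prob (hasFDerivAt_genH S grp p prob)).const_mul (α p)
  have hbound : ∀ F : Γ × Bool × Fin (2 * d - 1) → Bits n → ℝ,
      |couplingHat S T (genH S grp F) q| ≤ ∑ p, |α p| * (Real.pi / 2) := by
    intro F
    rw [congrFun hΦ F]
    refine (Finset.abs_sum_le_sum_abs _ _).trans (Finset.sum_le_sum fun p _ => ?_)
    rw [abs_mul]
    gcongr
    exact abs_splittingAngle_le _ _
  refine ⟨b, r, fun p x => α p * mult grp p *
    (kap d / (2 * d - 1) * phaseStat d (θ p) (ζ p) (b p) x + r p x), hb, hr, fun p x => rfl, ?_⟩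
  have key := tendsto_mul_variance_freq h0 h1 hbound hder
  refine (congrArg (fun V => Tendsto _ atTop (nhds V)) ?_).mp key
  rw [show zeroProb grp d θ ζ = fun p x => prob (grp p, x) (S.zero p) from
    funext fun p => funext fun x => (hprob p x).symm, ← sum_outcomeVar hinj prob]
  refine Finset.sum_congr rfl fun x _ => ?_
  congr 1
  funext b'
  rw [_root_.sum_apply]
  refine Finset.sum_congr rfl fun p _ => ?_
  rw [_root_.smul_apply, ContinuousLinearMap.comp_apply, genHCLM_single]
  split_ifs
  · rw [map_smul, hLr, smul_eq_mul, smul_eq_mul, mul_assoc]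
  · rw [map_zero, smul_zero]

/-- The gradient of a coupling with respect to the gate angles; `χ` does not enter. -/
lemma hasFDerivAt_couplingOf (S : SubspaceChoice n) (T : ℝ) (q : Pair n) {ξ : Param n → ℝ}
    {bθ bζ : Pair n → ℝ} (h : ∀ p, HasFDerivAt (fun x : ℝ × ℝ => splittingAngle x.1 x.2)
      (bθ p • ContinuousLinearMap.fst ℝ ℝ ℝ + bζ p • ContinuousLinearMap.snd ℝ ℝ ℝ)
      (ξ (p, 0), ξ (p, 1))) (p : Pair n) (i : Fin 3) :
    fderiv ℝ (couplingOf S T q) ξ (Pi.single (p, i) 1) =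
      ![recoverCoeff S q.1.1 q.1.2 p / T * bθ p, recoverCoeff S q.1.1 q.1.2 p / T * bζ p, 0] i := by
  have e : couplingOf S T q = fun ξ : Param n → ℝ => ∑ p, recoverCoeff S q.1.1 q.1.2 p / T *
      splittingAngle (ξ (p, 0)) (ξ (p, 1)) := by
    funext ξ
    rw [couplingOf, recover_eq_sum]
  have hp := fun p => HasFDerivAt.comp (g := fun x : ℝ × ℝ => splittingAngle x.1 x.2)
    (f := fun ξ : Param n → ℝ => (ξ (p, 0), ξ (p, 1))) ξ (h p)
    ((hasFDerivAt_apply (𝕜 := ℝ) ((p, 0) : Param n) ξ).prodMk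
      (hasFDerivAt_apply (𝕜 := ℝ) ((p, 1) : Param n) ξ))
  have hd : HasFDerivAt (fun ξ : Param n → ℝ => ∑ p, recoverCoeff S q.1.1 q.1.2 p / T *
      splittingAngle (ξ (p, 0)) (ξ (p, 1))) _ ξ :=
    HasFDerivAt.fun_sum fun (p : Pair n) (_ : p ∈ Finset.univ) =>
      (hp p).const_mul (recoverCoeff S q.1.1 q.1.2 p / T)
  rw [e, hd.fderiv, _root_.sum_apply, Finset.sum_eq_single p]
  · simp only [_root_.smul_apply, ContinuousLinearMap.comp_apply, ContinuousLinearMap.prod_apply,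
      _root_.add_apply, ContinuousLinearMap.coe_fst', ContinuousLinearMap.coe_snd',
      ContinuousLinearMap.proj_apply, smul_eq_mul]
    fin_cases i <;> simp
  · intro p' _ hne
    simp only [_root_.smul_apply, ContinuousLinearMap.comp_apply, ContinuousLinearMap.prod_apply,
      _root_.add_apply, ContinuousLinearMap.coe_fst', ContinuousLinearMap.coe_snd',
      ContinuousLinearMap.proj_apply, smul_eq_mul]
    simp [hne]
  · simp

end Estimator

/-! ### Small evolution times -/

lemma abs_arctan_le (y : ℝ) : |Real.arctan y| ≤ |y| := by
  have key : ∀ y : ℝ, 0 ≤ y → |Real.arctan y| ≤ |y| := by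
    intro y hy
    have h0 := Real.arctan_nonneg.mpr hy
    have h := Real.le_tan h0 (Real.arctan_lt_pi_div_two y)
    rw [Real.tan_arctan] at h
    rwa [abs_of_nonneg h0, abs_of_nonneg hy]
  rcases le_total 0 y with hy | hy
  · exact key y hy
  · have := key (-y) (by linarith)
    rwa [Real.arctan_neg, abs_neg, abs_neg] at this

/-- The map `(A, B) ↦ (θ, ζ)` is close to `(A, B) ↦ (A, B)` near the origin. -/
lemma angles_near {A B η : ℝ} (hA : A ≠ 0) (hη : η ≤ 1 / 100)
    (hw : Real.sqrt (A ^ 2 + B ^ 2) ≤ η / 10) :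
    |Real.arcsin (A / Real.sqrt (A ^ 2 + B ^ 2) * Real.sin (Real.sqrt (A ^ 2 + B ^ 2))) - A| ≤
      η * |A| ∧
    |Real.arctan (B / Real.sqrt (A ^ 2 + B ^ 2) * Real.tan (Real.sqrt (A ^ 2 + B ^ 2)))| ≤
      2 * Real.sqrt (A ^ 2 + B ^ 2) := by
  have hApos : 0 < |A| := abs_pos.mpr hA
  have hAw : |A| ≤ Real.sqrt (A ^ 2 + B ^ 2) := by
    rw [← Real.sqrt_sq_eq_abs]; exact Real.sqrt_le_sqrt (by nlinarith [sq_nonneg B])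
  have hBw : |B| ≤ Real.sqrt (A ^ 2 + B ^ 2) := by
    rw [← Real.sqrt_sq_eq_abs]; exact Real.sqrt_le_sqrt (by nlinarith [sq_nonneg A])
  set w := Real.sqrt (A ^ 2 + B ^ 2) with hwdef
  have hw0 : 0 < w := lt_of_lt_of_le hApos hAw
  have hw1 : w ≤ 1 / 1000 := by linarith
  have hpi := Real.pi_gt_three
  have hpi4 := Real.pi_lt_four
  have hs0 : 0 < Real.sin w := Real.sin_pos_of_pos_of_lt_pi hw0 (by linarith)
  have hsw : Real.sin w ≤ w := Real.sin_le hw0.le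
  constructor
  · set x := A / w * Real.sin w with hx
    have hxA : |x| ≤ |A| := by
      rw [hx, abs_mul, abs_div, abs_of_pos hw0, abs_of_pos hs0, div_mul_eq_mul_div,
        div_le_iff₀ hw0]
      gcongr
    have hxd : |x - A| ≤ w ^ 2 * |A| := by
      have e : x - A = A / w * (Real.sin w - w) := by rw [hx]; field_simp
      have h1 := abs_sin_sub_le w (by rw [abs_of_pos hw0]; linarith)
      rw [abs_of_pos hw0] at h1
      rw [e, abs_mul, abs_div, abs_of_pos hw0]
      calc |A| / w * |Real.sin w - w| ≤ |A| / w * w ^ 3 := by gcongr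
        _ = _ := by field_simp
    have hx1 := abs_le.mp (show |x| ≤ 1 by linarith)
    set t := Real.arcsin x with ht
    have hsin : Real.sin t = x := Real.sin_arcsin hx1.1 hx1.2
    have ht1 : |t| ≤ Real.pi / 2 :=
      abs_le.mpr ⟨Real.neg_pi_div_two_le_arcsin x, Real.arcsin_le_pi_div_two x⟩
    have ht2 : |t| ≤ 2 * |x| := by
      have h1 := Real.mul_le_sin (abs_nonneg t) ht1
      rw [← Real.abs_sin_eq_sin_abs_of_abs_le_pi (by linarith), hsin] at h1
      rw [div_mul_eq_mul_div, div_le_iff₀ Real.pi_pos] at h1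
      nlinarith [abs_nonneg x]
    have ht3 : |t - x| ≤ 8 * w ^ 2 * |A| := by
      have h1 := abs_sin_sub_le t (by linarith)
      rw [hsin, abs_sub_comm] at h1
      refine h1.trans ?_
      have h2 : |t| ≤ 2 * |A| := by linarith
      calc |t| ^ 3 ≤ (2 * |A|) ^ 3 := by gcongr
        _ = 8 * |A| ^ 2 * |A| := by ring
        _ ≤ _ := by gcongr
    have h9 : 9 * w ^ 2 ≤ η := by nlinarith
    calc |t - A| ≤ |t - x| + |x - A| := abs_sub_le _ _ _
      _ ≤ 8 * w ^ 2 * |A| + w ^ 2 * |A| := add_le_add ht3 hxd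
      _ = 9 * w ^ 2 * |A| := by ring
      _ ≤ _ := by gcongr
  · refine (abs_arctan_le _).trans ?_
    have hc : 1 / 2 ≤ Real.cos w := by
      have := Real.one_sub_sq_div_two_le_cos (x := w)
      nlinarith
    have htan : |Real.tan w| ≤ 2 * w := by
      rw [Real.tan_eq_sin_div_cos, abs_of_pos (by positivity), div_le_iff₀ (by linarith)]
      nlinarith
    rw [abs_mul, abs_div, abs_of_pos hw0]
    calc |B| / w * |Real.tan w| ≤ 1 * (2 * w) := by
          refine mul_le_mul ?_ htan (abs_nonneg _) zero_le_one
          rw [div_le_one hw0]; exact hBw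
      _ = _ := one_mul _

variable {n : ℕ}

/-- For fixed couplings and small `d T` every subspace is in the regime of small angles, as `A`, `ζ`
are of order `T`. -/
lemma exists_regime (S : SubspaceChoice n) {a : Fin n → ℝ} (c : Pair n → ℝ) (ha : ∀ i, a i ≠ 0)
    {η δ : ℝ} (hη0 : 0 < η) (hη : η ≤ 1 / 100) (hδ : 0 < δ) :
    ∃ κ : ℝ, 0 < κ ∧ ∀ (d : ℕ) (T : ℝ), 2 ≤ d → 0 < T → (d : ℝ) * T ≤ κ → ∀ p : Pair n,
      Regime d η (a p.1.1 * T) (trueParam S a c T (p, 0)) (trueParam S a c T (p, 1)) ∧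
      2 * |a p.1.1 * T| ≤ δ ∧ |trueParam S a c T (p, 0)| ≤ δ ∧ |trueParam S a c T (p, 1)| ≤ δ ∧
      evolutionAngle S a c T p < Real.pi / 2 := by
  set m : ℝ := 1 + ∑ p : Pair n, (|a p.1.1| + |splitting S c p|) with hm
  have hm0 : 0 < m := by
    have : 0 ≤ ∑ p : Pair n, (|a p.1.1| + |splitting S c p|) :=
      Finset.sum_nonneg fun p _ => by positivity
    linarith
  set t : ℝ := min (η / 10) (δ / 2) with ht
  have ht0 : 0 < t := by positivity
  have htη : t ≤ η / 10 := min_le_left _ _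
  have htδ : t ≤ δ / 2 := min_le_right _ _
  refine ⟨t / m, by positivity, fun d T hd hT hdT p => ?_⟩
  have hA : a p.1.1 * T ≠ 0 := mul_ne_zero (ha _) hT.ne'
  have hd2 : (2 : ℝ) ≤ d := by exact_mod_cast hd
  rw [le_div_iff₀ hm0] at hdT
  have hle : |a p.1.1| + |splitting S c p| ≤ m := by
    have := Finset.single_le_sum (f := fun p : Pair n => |a p.1.1| + |splitting S c p|)
      (fun _ _ => by positivity) (Finset.mem_univ p)
    linarith
  have hwm : evolutionAngle S a c T p ≤ m * T := by
    rw [evolutionAngle]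
    refine Real.sqrt_le_iff.mpr ⟨by positivity, ?_⟩
    have h1 : (a p.1.1 * T) ^ 2 + (splitting S c p * T) ^ 2 ≤
        ((|a p.1.1| + |splitting S c p|) * T) ^ 2 := by
      have e : (a p.1.1 * T) ^ 2 + (splitting S c p * T) ^ 2 =
          (|a p.1.1| ^ 2 + |splitting S c p| ^ 2) * T ^ 2 := by rw [sq_abs, sq_abs]; ring
      rw [e, mul_pow]
      gcongr
      nlinarith [mul_nonneg (abs_nonneg (a p.1.1)) (abs_nonneg (splitting S c p))]
    refine h1.trans ?_
    gcongr
  have hAw : |a p.1.1 * T| ≤ evolutionAngle S a c T p := by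
    rw [evolutionAngle, ← Real.sqrt_sq_eq_abs]
    exact Real.sqrt_le_sqrt (by nlinarith [sq_nonneg (splitting S c p * T)])
  have hw0 : 0 ≤ evolutionAngle S a c T p := Real.sqrt_nonneg _
  have hdw : d * evolutionAngle S a c T p ≤ t := by nlinarith
  have hw : 2 * evolutionAngle S a c T p ≤ t := by nlinarith
  obtain ⟨h1, h2⟩ := angles_near (B := splitting S c p * T) hA hη
    (by change evolutionAngle S a c T p ≤ _; linarith)
  change |trueParam S a c T (p, 0) - a p.1.1 * T| ≤ _ at h1
  change |trueParam S a c T (p, 1)| ≤ 2 * evolutionAngle S a c T p at h2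
  have hreg : Regime d η (a p.1.1 * T) (trueParam S a c T (p, 0)) (trueParam S a c T (p, 1)) :=
    { two_le := hd
      le_eta := hη
      A_ne := hA
      near := h1
      dA := by nlinarith
      dz := by nlinarith }
  refine ⟨hreg, by linarith, ?_, by linarith, ?_⟩
  · have := hreg.theta_le
    linarith [abs_nonneg (a p.1.1 * T)]
  · linarith [Real.pi_gt_three]

/-! ### The two algorithms -/

/-- The limit of `N` times the variance, compared with the Cramér–Rao bound of one shot per
circuit, for a general assignment of circuits to subspaces. -/
lemma exists_limit_variance {d : ℕ} {Γ : Type} [Fintype Γ] [DecidableEq Γ] {S : SubspaceChoice n}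
    {a : Fin n → ℝ} {c : Pair n → ℝ} {grp : Pair n → Γ}
    (hgrp : ∀ p q, grp p = grp q → p.1.1 = q.1.1) {T η δ : ℝ} (hT : 0 < T)
    (hηE : errConst (Pair n) * η ≤ 1 / 2)
    (hs : ∀ θ ζ : ℝ, θ ≠ 0 → |θ| ≤ δ → |ζ| ≤ δ → ∃ bθ bζ : ℝ,
      HasFDerivAt (fun x : ℝ × ℝ => splittingAngle x.1 x.2)
        (bθ • ContinuousLinearMap.fst ℝ ℝ ℝ + bζ • ContinuousLinearMap.snd ℝ ℝ ℝ) (θ, ζ) ∧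
      |bζ - 1| ≤ η ∧ |bθ| ≤ |θ|)
    (hreg : ∀ p : Pair n,
      Regime d η (a p.1.1 * T) (trueParam S a c T (p, 0)) (trueParam S a c T (p, 1)) ∧
      2 * |a p.1.1 * T| ≤ δ ∧ |trueParam S a c T (p, 0)| ≤ δ ∧ |trueParam S a c T (p, 1)| ≤ δ ∧
      evolutionAngle S a c T p < Real.pi / 2)
    {prob : Γ × Bool × Fin (2 * d - 1) → Bits n → ℝ} (h0 : ∀ x b, 0 ≤ prob x b)
    (h1 : ∀ x, ∑ b, prob x b = 1)
    (hprob : ∀ p x, prob (grp p, x) (S.zero p) = zeroProb grp d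
      (fun p => trueParam S a c T (p, 0)) (fun p => trueParam S a c T (p, 1)) p x)
    {J : Matrix (Param n) (Param n) ℝ} (hJ : J.PosDef)
    (hq : ∀ v, v ⬝ᵥ (J *ᵥ v) = infoForm grp
      (zeroProb grp d (fun p => trueParam S a c T (p, 0)) fun p => trueParam S a c T (p, 1))
      (zeroResp grp d (fun p => trueParam S a c T (p, 0)) (fun p => trueParam S a c T (p, 1)) v))
    (q : Pair n) :
    ∃ V : ℝ, Tendsto (fun N : ℕ => (N : ℝ) *
        Var[fun data => couplingHat S T (genH S grp (freq data)) q; dataLaw prob N]) atTop (nhds V) ∧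
      V ≤ 3 * scale grp d (fun p => a p.1.1 * T) (fun p => recoverCoeff S q.1.1 q.1.2 p / T) ∧
      0 < cramerRao J (couplingOf S T q) (trueParam S a c T) ∧
      |V - cramerRao J (couplingOf S T q) (trueParam S a c T)| ≤
        4 * errConst (Pair n) * η * cramerRao J (couplingOf S T q) (trueParam S a c T) := by
  have : Nonempty (Pair n) := ⟨q⟩
  obtain ⟨b, r, g, hb, hr, hg, hlim⟩ := exists_tendsto_variance
    (fun p p' h h' => zero_injective_of_fst S (hgrp p p' h) h') hs (fun p => (hreg p).1)
    (fun p => (hreg p).2.1) (fun p => (hreg p).2.2.2.1) h0 h1 hprob q (T := T)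
  choose bθ bζ hder hbζ hbθ using fun p => hs _ _ (hreg p).1.theta_ne (hreg p).2.2.1
    (hreg p).2.2.2.1
  obtain ⟨c1, c2, c3⟩ := compare_cramerRao (fun p => (hreg p).1)
    (fun p p' h => by rw [hgrp p p' h]) hηE hbθ hbζ hb hr hg hJ hq
    (u := fun k => fderiv ℝ (couplingOf S T q) (trueParam S a c T) (Pi.single k 1))
    (fun p i => hasFDerivAt_couplingOf S T q hder p i)
  refine ⟨_, hlim, c1, c2 ?_, c3⟩
  obtain ⟨p, hp⟩ := exists_recoverCoeff_ne_zero S q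
  have hd := (hreg p).1.two_le
  have h2 : 0 < (recoverCoeff S q.1.1 q.1.2 p / T * mult grp p / (a p.1.1 * T)) ^ 2 := by
    have hM : mult grp p ≠ 0 := by linarith [one_le_mult grp p]
    have := (hreg p).1.A_ne
    have := hT.ne'
    positivity
  refine mul_pos (div_pos (kap_pos hd) (two_mul_sub_one_pos hd)) (lt_of_lt_of_le h2 ?_)
  exact Finset.single_le_sum (f := fun p : Pair n =>
    (recoverCoeff S q.1.1 q.1.2 p / T * mult grp p / (a p.1.1 * T)) ^ 2)
    (fun _ _ => sq_nonneg _) (Finset.mem_univ p)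

lemma kap_div_le {d : ℕ} (hd : 2 ≤ d) : kap d / (2 * d - 1) ≤ 3 / (d : ℝ) ^ 4 := by
  have hd2 : (2 : ℝ) ≤ d := by exact_mod_cast hd
  have h1 : 0 < (d : ℝ) - 1 := by linarith
  have h2 := two_mul_sub_one_pos hd
  rw [kap, div_div]
  refine div_le_div_of_nonneg_left (by norm_num) (by positivity) ?_
  have h3 : 3 / 4 * (d : ℝ) ^ 2 ≤ (d - 1) * (d + 1) := by nlinarith
  have h4 : 3 / 2 * (d : ℝ) ≤ 2 * d - 1 := by linarith
  calc (d : ℝ) ^ 4 ≤ 9 / 8 * d ^ 4 := by nlinarith [show 0 ≤ (d : ℝ) ^ 4 by positivity]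
    _ = (3 / 4 * (d : ℝ) ^ 2) * d * (3 / 2 * d) := by ring
    _ ≤ ((d - 1) * (d + 1)) * d * (2 * d - 1) := by gcongr
    _ = _ := by ring

/-- The scale of the variance in terms of the couplings `a_r` of the rounds up to `i`. -/
lemma scale_le {d : ℕ} (hd : 2 ≤ d) {Γ : Type} [Fintype Γ] [DecidableEq Γ] (S : SubspaceChoice n)
    {a : Fin n → ℝ} (ha : ∀ i, a i ≠ 0) (grp : Pair n → Γ) {T K : ℝ} (hT : 0 < T)
    (hK : ∀ i j p, |recoverCoeff S i j p| ≤ K) (q : Pair n) :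
    scale grp d (fun p => a p.1.1 * T) (fun p => recoverCoeff S q.1.1 q.1.2 p / T) ≤
      3 * (K ^ 2 * (Fintype.card (Pair n) : ℝ) ^ 3) *
        (∑ r ∈ Finset.Iic q.1.1, 1 / a r ^ 2) / (T ^ 4 * d ^ 4) := by
  set sa := ∑ r ∈ Finset.Iic q.1.1, 1 / a r ^ 2 with hsa
  have hd0 : (0 : ℝ) < d := by
    have : (2 : ℝ) ≤ d := by exact_mod_cast hd
    linarith
  have hsa0 : 0 ≤ sa := Finset.sum_nonneg fun r _ => by positivity
  have hterm : ∀ p : Pair n, (recoverCoeff S q.1.1 q.1.2 p / T * mult grp p / (a p.1.1 * T)) ^ 2 ≤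
      K ^ 2 * (Fintype.card (Pair n) : ℝ) ^ 2 * sa / T ^ 4 := by
    intro p
    by_cases hp : q.1.1 < p.1.1
    · rw [recoverCoeff_eq_zero S q.1.2 hp]
      have e : ((0 : ℝ) / T * mult grp p / (a p.1.1 * T)) ^ 2 = 0 := by ring
      rw [e]
      positivity
    · have h1 : 1 / a p.1.1 ^ 2 ≤ sa :=
        Finset.single_le_sum (f := fun r => 1 / a r ^ 2) (fun _ _ => by positivity)
          (Finset.mem_Iic.mpr (not_lt.mp hp))
      have h2 : recoverCoeff S q.1.1 q.1.2 p ^ 2 ≤ K ^ 2 := by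
        rw [← sq_abs]; exact pow_le_pow_left₀ (abs_nonneg _) (hK _ _ _) 2
      have h3 : mult grp p ^ 2 ≤ (Fintype.card (Pair n) : ℝ) ^ 2 :=
        pow_le_pow_left₀ (by linarith [one_le_mult grp p]) (mult_le grp p) 2
      have := ha p.1.1
      calc _ = recoverCoeff S q.1.1 q.1.2 p ^ 2 * mult grp p ^ 2 * (1 / a p.1.1 ^ 2) / T ^ 4 := by
            field_simp
        _ ≤ _ := by gcongr
  have hsum := Finset.sum_le_sum fun (p : Pair n) (_ : p ∈ Finset.univ) => hterm p
  rw [Finset.sum_const, Finset.card_univ, nsmul_eq_mul] at hsum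
  calc _ ≤ 3 / (d : ℝ) ^ 4 * ((Fintype.card (Pair n) : ℝ) *
        (K ^ 2 * (Fintype.card (Pair n) : ℝ) ^ 2 * sa / T ^ 4)) := by
        refine mul_le_mul (kap_div_le hd) hsum (Finset.sum_nonneg fun _ _ => sq_nonneg _)
          (by positivity)
    _ = _ := by field_simp

/-- One-shot Fisher information, hybrid mode. -/
abbrev hybridShotInfo (S : SubspaceChoice n) (a : Fin n → ℝ) (c : Pair n → ℝ) (T : ℝ) (d : ℕ) :
    Matrix (Param n) (Param n) ℝ :=
  ∑ x : HybridCircuit n d, fisher (hybridModel x) (trueParam S a c T)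

/-- One-shot Fisher information, analog mode. -/
abbrev analogShotInfo (S : SubspaceChoice n) (a : Fin n → ℝ) (c : Pair n → ℝ) (T : ℝ) (d : ℕ) :
    Matrix (Param n) (Param n) ℝ :=
  ∑ x : AnalogCircuit n d, fisher (analogModel x) (trueParam S a c T)

/-- The limit of `N` times the variance, for both modes, in terms of the one-shot information. -/
lemma exists_limit_both (S : SubspaceChoice n) {a : Fin n → ℝ} (c : Pair n → ℝ)
    (ha : ∀ i, a i ≠ 0) {η : ℝ} (hη0 : 0 < η) (hη : η ≤ 1 / 100)
    (hηE : errConst (Pair n) * η ≤ 1 / 2) :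
    ∃ κ : ℝ, 0 < κ ∧ ∀ (d : ℕ) (T : ℝ), 2 ≤ d → 0 < T → (d : ℝ) * T ≤ κ →
      (hybridShotInfo S a c T d).PosDef ∧ (analogShotInfo S a c T d).PosDef ∧ ∀ q,
      (∃ V : ℝ, Tendsto (fun N : ℕ => (N : ℝ) * hybridVar S a c T d N q) atTop (nhds V) ∧
        V ≤ 3 * scale roundOf d (fun p => a p.1.1 * T) (fun p => recoverCoeff S q.1.1 q.1.2 p / T) ∧
        0 < cramerRao (hybridShotInfo S a c T d) (couplingOf S T q) (trueParam S a c T) ∧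
        |V - cramerRao (hybridShotInfo S a c T d) (couplingOf S T q) (trueParam S a c T)| ≤
          4 * errConst (Pair n) * η *
            cramerRao (hybridShotInfo S a c T d) (couplingOf S T q) (trueParam S a c T)) ∧
      (∃ V : ℝ, Tendsto (fun N : ℕ => (N : ℝ) * analogVar S a c T d N q) atTop (nhds V) ∧
        V ≤ 3 * scale id d (fun p => a p.1.1 * T) (fun p => recoverCoeff S q.1.1 q.1.2 p / T) ∧
        0 < cramerRao (analogShotInfo S a c T d) (couplingOf S T q) (trueParam S a c T) ∧
        |V - cramerRao (analogShotInfo S a c T d) (couplingOf S T q) (trueParam S a c T)| ≤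
          4 * errConst (Pair n) * η *
            cramerRao (analogShotInfo S a c T d) (couplingOf S T q) (trueParam S a c T)) := by
  obtain ⟨δ, hδ, hs⟩ := exists_hasFDerivAt_splittingAngle hη0
  obtain ⟨κ, hκ, hreg⟩ := exists_regime S c ha hη0 hη hδ
  refine ⟨κ, hκ, fun d T hd hT hdT => ?_⟩
  have hreg := hreg d T hd hT hdT
  have hchi : ∀ p, trueParam S a c T (p, 2) = 0 := fun p => rfl
  have qh := dotProduct_sum_fisher_hybrid (d := d) (by omega) hchi
  have qa := dotProduct_sum_fisher_analog (d := d) (by omega) hchi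
  have ph : (hybridShotInfo S a c T d).PosDef := posDef_of_form (fun p => (hreg p).1)
    (isHermitian_sum _ fun x => isHermitian_fisher _ _) qh
  have pa : (analogShotInfo S a c T d).PosDef := posDef_of_form (fun p => (hreg p).1)
    (isHermitian_sum _ fun x => isHermitian_fisher _ _) qa
  refine ⟨ph, pa, fun q => ⟨?_, ?_⟩⟩
  · have := exists_limit_variance (grp := roundOf)
      (fun p p' h => congrArg (fun i : Round n => i.1) h) hT hηE hs hreg
      (hybridProb_nonneg S a c T d) (sum_hybridProb S a c T d)
      (fun p x => by
        rw [hybridProb_zero S a c d p (hreg p).1.A_ne (fun q => (hreg q).2.2.2.2), zeroProb,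
          mult_roundOf, hchi]) ph qh q
    simpa only [hybridVar, hybridH_eq_genH] using this
  · have := exists_limit_variance (grp := (id : Pair n → Pair n))
      (fun p p' h => congrArg (fun p : Pair n => p.1.1) h) hT hηE hs hreg
      (analogProb_nonneg S a c T d) (sum_analogProb S a c T d)
      (fun p x => by
        rw [id, analogProb_zero S a c d p (hreg p).1.A_ne (hreg p).2.2.2.2, zeroProb,
          mult_id, hchi, div_one]) pa qa q
    simpa only [analogVar, analogH_eq_genH] using this

lemma eventually_le_of_tendsto {f : ℕ → ℝ} {V M : ℝ}
    (h : Tendsto (fun N : ℕ => (N : ℝ) * f N) atTop (nhds V)) (hVM : V < M) :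
    ∀ᶠ N : ℕ in atTop, f N ≤ M / N := by
  filter_upwards [h.eventually_lt_const hVM, eventually_gt_atTop 0] with N hN hN0
  have : (0 : ℝ) < N := by exact_mod_cast hN0
  rw [le_div_iff₀ this]
  linarith

lemma eventually_abs_sub_le_of_tendsto {f : ℕ → ℝ} {V B ε : ℝ} (hε : 0 < ε) (hB : 0 < B)
    (h : Tendsto (fun N : ℕ => (N : ℝ) * f N) atTop (nhds V)) (hV : |V - B| ≤ ε / 2 * B) :
    ∀ᶠ N : ℕ in atTop, |f N - B / N| ≤ ε * (B / N) := by
  have h1 : Tendsto (fun N : ℕ => |(N : ℝ) * f N - B|) atTop (nhds |V - B|) := (h.sub_const B).abs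
  filter_upwards [h1.eventually_lt_const (show |V - B| < ε * B by nlinarith [mul_pos hε hB]),
    eventually_gt_atTop 0] with N hN hN0
  have hN' : (0 : ℝ) < N := by exact_mod_cast hN0
  have e : f N - B / N = ((N : ℝ) * f N - B) / N := by field_simp
  rw [e, abs_div, abs_of_pos hN', ← mul_div_assoc]
  gcongr

end HamLearn

end

theorem mainTheorem2 (n : ℕ) :
    ∃ C : ℝ, 0 < C ∧
      ∀ (S : HamLearn.SubspaceChoice n) (a : Fin n → ℝ) (c : HamLearn.Pair n → ℝ),
        (∀ i, a i ≠ 0) →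
        (∃ κ : ℝ, 0 < κ ∧ ∀ (d : ℕ) (T : ℝ), 2 ≤ d → 0 < T → (d : ℝ) * T ≤ κ →
          ∀ᶠ N : ℕ in atTop, ∀ q : HamLearn.Pair n,
            HamLearn.hybridVar S a c T d N q ≤
              C / T ^ 4 * (∑ r ∈ Finset.Iic q.1.1, 1 / a r ^ 2) * (1 / ((N : ℝ) * (d : ℝ) ^ 4)) ∧
            HamLearn.analogVar S a c T d N q ≤
              C / T ^ 4 * (∑ r ∈ Finset.Iic q.1.1, 1 / a r ^ 2) *
                (1 / ((N : ℝ) * (d : ℝ) ^ 4))) ∧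
        (∀ ε : ℝ, 0 < ε →
          ∃ κ : ℝ, 0 < κ ∧ ∀ (d : ℕ) (T : ℝ), 2 ≤ d → 0 < T → (d : ℝ) * T ≤ κ →
          ∀ᶠ N : ℕ in atTop,
            (HamLearn.hybridInfo d N (HamLearn.trueParam S a c T)).PosDef ∧
            (HamLearn.analogInfo d N (HamLearn.trueParam S a c T)).PosDef ∧
            ∀ q : HamLearn.Pair n,
              |HamLearn.hybridVar S a c T d N q - HamLearn.hybridBound S a c T d N q| ≤
                ε * HamLearn.hybridBound S a c T d N q ∧
              |HamLearn.analogVar S a c T d N q - HamLearn.analogBound S a c T d N q| ≤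
                ε * HamLearn.analogBound S a c T d N q) := by
  obtain ⟨K, hK0, hK⟩ := HamLearn.exists_abs_recoverCoeff_le n
  set E := HamLearn.errConst (HamLearn.Pair n) with hE
  have hE0 : 0 ≤ E := by rw [hE, HamLearn.errConst]; positivity
  set C := 9 * (K ^ 2 * (Fintype.card (HamLearn.Pair n) : ℝ) ^ 3) + 1 with hC
  have hC0 : 0 < C := by positivity
  refine ⟨C, hC0, fun S a c ha => ⟨?_, fun ε hε => ?_⟩⟩
  -- a bound on the variance needs no accuracy beyond a fixed `η`, so `κ` depends on no `ε` here
  · set η := min (1 / 100) (1 / (2 * (E + 1))) with hη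
    have hη0 : 0 < η := by positivity
    have hEη : E * η ≤ 1 / 2 := by
      have h1 : η * (2 * (E + 1)) ≤ 1 := by
        rw [← le_div_iff₀ (by positivity)]; exact min_le_right _ _
      nlinarith
    obtain ⟨κ, hκ, H⟩ := HamLearn.exists_limit_both S c ha hη0 (min_le_left _ _) hEη
    refine ⟨κ, hκ, fun d T hd hT hdT => ?_⟩
    obtain ⟨-, -, H⟩ := H d T hd hT hdT
    have hd0 : (0 : ℝ) < d := by
      have : 0 < d := by omega
      exact_mod_cast this
    rw [eventually_all]
    intro q
    have hsum : 0 < ∑ r ∈ Finset.Iic q.1.1, 1 / a r ^ 2 :=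
      Finset.sum_pos (fun r _ => by have := ha r; positivity) ⟨q.1.1, Finset.mem_Iic.mpr le_rfl⟩
    -- the limit of `N * Var` lies strictly below `C / T ^ 4 * sum / d ^ 4`
    have hlt : ∀ {V R : ℝ}, V ≤ 3 * R →
        R ≤ 3 * (K ^ 2 * (Fintype.card (HamLearn.Pair n) : ℝ) ^ 3) *
          (∑ r ∈ Finset.Iic q.1.1, 1 / a r ^ 2) / (T ^ 4 * d ^ 4) →
        V < C / T ^ 4 * (∑ r ∈ Finset.Iic q.1.1, 1 / a r ^ 2) / d ^ 4 := by
      intro V R h1 h2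
      have h3 : 0 < (∑ r ∈ Finset.Iic q.1.1, 1 / a r ^ 2) / (T ^ 4 * d ^ 4) := by positivity
      have e : C / T ^ 4 * (∑ r ∈ Finset.Iic q.1.1, 1 / a r ^ 2) / d ^ 4 =
          3 * (3 * (K ^ 2 * (Fintype.card (HamLearn.Pair n) : ℝ) ^ 3) *
          (∑ r ∈ Finset.Iic q.1.1, 1 / a r ^ 2) / (T ^ 4 * d ^ 4)) +
          (∑ r ∈ Finset.Iic q.1.1, 1 / a r ^ 2) / (T ^ 4 * d ^ 4) := by
        rw [hC]; field_simp; ring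
      rw [e]
      linarith
    obtain ⟨⟨V, hV, hVle, -, -⟩, V', hV', hVle', -, -⟩ := H q
    have b1 := hlt hVle (HamLearn.scale_le hd S ha _ hT (hK S) q)
    have b2 := hlt hVle' (HamLearn.scale_le hd S ha _ hT (hK S) q)
    filter_upwards [HamLearn.eventually_le_of_tendsto hV b1,
      HamLearn.eventually_le_of_tendsto hV' b2] with N h1 h2
    have e : C / T ^ 4 * (∑ r ∈ Finset.Iic q.1.1, 1 / a r ^ 2) / d ^ 4 / (N : ℝ) =
        C / T ^ 4 * (∑ r ∈ Finset.Iic q.1.1, 1 / a r ^ 2) * (1 / ((N : ℝ) * (d : ℝ) ^ 4)) := by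
      rw [div_div, mul_comm ((d : ℝ) ^ 4), ← div_eq_mul_one_div]
    rw [e] at h1 h2
    exact ⟨h1, h2⟩
  -- the limit is within `4 E η ≤ ε / 2` of the bound, which leaves `ε / 2` for finite `N`
  · set η := min (1 / 100) (min (1 / (2 * (E + 1))) (ε / (8 * (E + 1)))) with hη
    have hη0 : 0 < η := by positivity
    have hEη : E * η ≤ 1 / 2 := by
      have h1 : η * (2 * (E + 1)) ≤ 1 := by
        rw [← le_div_iff₀ (by positivity)]
        exact (min_le_right _ _).trans (min_le_left _ _)
      nlinarith
    have hεη : 4 * E * η ≤ ε / 2 := by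
      have h1 : η * (8 * (E + 1)) ≤ ε := by
        rw [← le_div_iff₀ (by positivity)]
        exact (min_le_right _ _).trans (min_le_right _ _)
      nlinarith
    obtain ⟨κ, hκ, H⟩ := HamLearn.exists_limit_both S c ha hη0 (min_le_left _ _) hEη
    refine ⟨κ, hκ, fun d T hd hT hdT => ?_⟩
    obtain ⟨ph, pa, H⟩ := H d T hd hT hdT
    have hall : ∀ᶠ N : ℕ in atTop, ∀ q : HamLearn.Pair n,
        |HamLearn.hybridVar S a c T d N q - HamLearn.cramerRao (HamLearn.hybridShotInfo S a c T d)
          (HamLearn.couplingOf S T q) (HamLearn.trueParam S a c T) / N| ≤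
          ε * (HamLearn.cramerRao (HamLearn.hybridShotInfo S a c T d)
          (HamLearn.couplingOf S T q) (HamLearn.trueParam S a c T) / N) ∧
        |HamLearn.analogVar S a c T d N q - HamLearn.cramerRao (HamLearn.analogShotInfo S a c T d)
          (HamLearn.couplingOf S T q) (HamLearn.trueParam S a c T) / N| ≤
          ε * (HamLearn.cramerRao (HamLearn.analogShotInfo S a c T d)
          (HamLearn.couplingOf S T q) (HamLearn.trueParam S a c T) / N) := by
      rw [eventually_all]
      intro q
      obtain ⟨⟨V, hV, -, hB, hVB⟩, V', hV', -, hB', hVB'⟩ := H q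
      exact (HamLearn.eventually_abs_sub_le_of_tendsto hε hB hV
        (hVB.trans (mul_le_mul_of_nonneg_right hεη hB.le))).and
        (HamLearn.eventually_abs_sub_le_of_tendsto hε hB' hV'
        (hVB'.trans (mul_le_mul_of_nonneg_right hεη hB'.le)))
    filter_upwards [hall, eventually_gt_atTop 0] with N hN hN0
    have hN' : (0 : ℝ) < N := by exact_mod_cast hN0
    refine ⟨ph.smul hN', pa.smul hN', fun q => ?_⟩
    rw [HamLearn.hybridBound, HamLearn.analogBound, HamLearn.hybridInfo, HamLearn.analogInfo,
      HamLearn.cramerRao_smul ph _ _ hN'.ne', HamLearn.cramerRao_smul pa _ _ hN'.ne']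
    exact hN q
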